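/- **Setting.** Let $\mathsf H$ be a separable real Hilbert space, $T>0$, $\mathsf E\subset\mathsf H$ convex, and $\mathcal E:[0,T]\times\mathsf E\to\mathbb R$, written $\mathcal E_t(u)$, such that: (E.1) $\mathcal E$ has compact sublevels in $[0,T]\times\mathsf E$; (E.2) with $\widetilde{\mathcal E}=\mathcal E-\min\mathcal E+1$, the derivative $\mathcal P_t(u)=\partial_t\mathcal E_t(u)$ exists everywhere, $|\mathcal P_t(u)|\le C_P\widetilde{\mathcal E}_t(u)$ for some constant $C_P\ge0$, and $\mathcal P_t(u_n)\to\mathcal P_t(u)$ whenever $u_n\to u$ in $\mathsf E$ and $\sup_n\mathcal E_t(u_n)<\infty$; (E.3) for some $\lambda\ge0$ the maps $u\mapsto\mathcal E_t(u)+\frac\lambda2\|u\|^2$ are convex on $\mathsf E$ for all $t\in[0,T]$. Let $\partial\mathcal E_t$ be the Fréchet subdifferential in $u$, let $|\partial^\circ\mathcal E_t|(u)\in[0,\infty]$ be the minimal norm of the elements of $\partial\mathcal E_t(u)$ ($+\infty$ if $\partial\mathcal E_t(u)=\emptyset$), $C(t)=\{u:0\in\partial\mathcal E_t(u)\}$,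 $G(t)=\mathsf H\setminus C(t)$. Assume (C): $\mathscr L^1(\mathcal E_t(C(t)))=0$ for every $t\in[0,T]$. For $\rho>0$ let $D_\rho=\{u\in\mathsf E:\widetilde{\mathcal E}_t(u)\le\rho\ \forall t\in[0,T]\}$. Let $\mathfrak E(t)$ be the family of compact connected sets $U\subset \mathsf H$ that are either a connected component of $C(t)$ or a singleton $\{x\}$ with $x\in G(t)$. For $V\subset C(t)$ nonempty and connected, $C(t,V)$ is the connected component of $C(t)$ containing $V$. $\mathrm{Ls}$, $\mathrm{Li}$ are the upper and lower Kuratowski limits, and $\overset{K}{\to}$ is Kuratowski convergence. For $\boldsymbol\Theta\subset[0,1]\times\mathsf H$ write $\Theta(r)=\{x:(r,x)\in\boldsymbol\Theta\}$; $\boldsymbol\Theta$ is *fiberwise connected* if it and all its sections are connected. Put $G_t[\boldsymbol\Theta]=\{s\in[0,1]:\Theta(s)\cap G(t)\ne\emptyset\}$ and, for $\vartheta:[0,1]\to\mathsf H$, $G_t[\vartheta]=\{s\in[0,1]:\vartheta(s)\in G(t)\}$. In products, $0\cdot\infty=0$. *Graphs.* Consider the property (B) $\boldsymbol\Theta\subset[0,1]\times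 D_\rho$ is compact and fiberwise connected, its projection to $[0,1]$ is $[0,1]$, and $\Theta(s)$ is a singleton for every $s\in G_t[\boldsymbol\Theta]$. An *admissible selection* of such a $\boldsymbol\Theta$ is a map $\vartheta$ with $\vartheta(s)\in\Theta(s)$ for all $s\in[0,1]$, locally Lipschitz on $G_t[\boldsymbol\Theta]$, with $\mathrm{Ls}_{s\to r}\{\vartheta(s)\}\subset C(t,\Theta(r))$ for $r\in[0,1]\setminus G_t[\boldsymbol\Theta]$ and $\int_{G_t[\boldsymbol\Theta]}|\partial^\circ\mathcal E_t|(\vartheta)\|\vartheta'\|\,ds<\infty$. The *graph energy* of $\boldsymbol\Theta$ is the function $\mathsf e:[0,1]\to\mathbb R$ with $\mathsf e(s)=\mathcal E_t(x)$ for all $(s,x)\in\boldsymbol\Theta$. An *admissible graph transition* between $U_0,U_1\in\mathfrak E(t)$ is a set $\boldsymbol\Theta$ satisfying (B) such that $\Theta(0)\subset U_0$, $\Theta(1)\subset U_1$; $\boldsymbol\Theta\cap([0,1]\times G(t))$ is the graph over $G_t[\boldsymbol\Theta]$ of an admissible selection $\vartheta$ for which $|\partial^\circ\mathcal E_t|(\vartheta)\|\vartheta'\|$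 is essentially bounded on $G_t[\boldsymbol\Theta]$; and the graph energy of $\boldsymbol\Theta$ is well defined and Lipschitz on $[0,1]$. An *admissible transition curve* between $U_0$ and $U_1$ is a map $\vartheta:[0,1]\to\mathsf E$ with $\vartheta(i)\in U_i$ ($i=0,1$), $G_t[\vartheta]$ relatively open in $[0,1]$, $\vartheta$ locally Lipschitz on $G_t[\vartheta]$ with $|\partial^\circ\mathcal E_t|(\vartheta)\|\vartheta'\|$ essentially bounded there, $s\mapsto\mathcal E_t(\vartheta(s))$ Lipschitz on $[0,1]$, and $\mathrm{Ls}_{s\to r}\{\vartheta(s)\}\subset C(t,\{\vartheta(r)\})$ for $r\in[0,1]\setminus G_t[\vartheta]$. **Theorem.** Let $t\in[0,T]$, $U_0,U_1\in\mathfrak E(t)$, $\rho>0$, $L,L'>0$. For $n\in\mathbb N$ let $\vartheta_n:[0,1]\to\mathsf H$, $\mathsf t_n:[0,1]\to[0,T]$, and let $\boldsymbol\Theta_n\subset[0,1]\times D_\rho$ be compact and fiberwise connected. Put $G_n=\{r\in[0,1]:\Theta_n(r)\cap G(\mathsf t_n(r))\neq\emptyset\}$ and suppose: i) $\vartheta_n(r)\in\Theta_n(r)$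 for all $r\in[0,1]$, and $\Theta_n(r)=\{\vartheta_n(r)\}$ for $r\in G_n$; ii) $\mathsf t_n$ is Lipschitz and nondecreasing, $\vartheta_n$ is locally Lipschitz on $G_n$, and $\mathsf t_n'(r)+|\partial^\circ\mathcal E_{\mathsf t_n(r)}|(\vartheta_n(r))\|\vartheta_n'(r)\|\le L$ for a.a. $r\in G_n$; iii) $r\mapsto\mathcal E_{\mathsf t_n(r)}(\vartheta_n(r))$ is Lipschitz on $[0,1]$ and $\frac{d}{dr}\mathcal E_{\mathsf t_n(r)}(\vartheta_n(r))\le L'$ for a.a. $r\in(0,1)$; iv) $\mathrm{Ls}_{n\to\infty}\Theta_n(i)\subset U_i$ for $i=0,1$, and $\sup_{r\in[0,1]}|\mathsf t_n(r)-t|\to0$. Let $S_n:[0,1]\to[0,\infty]$, $S_n(r)=|\partial^\circ\mathcal E_{\mathsf t_n(r)}|(\vartheta_n(r))$ for $r\in G_n$ and $S_n(r)=0$ otherwise. Then there exist a subsequence (not relabeled), a set $\boldsymbol\Theta$ satisfying (B), a lower semicontinuous $S:[0,1]\to[0,\infty]$ and a map $\vartheta:[0,1]\to D_\rho$ such that 1)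 $S_n$ $\Gamma$-converges to $S$ on $[0,1]$; 2) $\boldsymbol\Theta_n\overset{K}{\to}\boldsymbol\Theta$; 3) $\boldsymbol\Theta$ is an admissible graph transition between $U_0$ and $U_1$, and $\vartheta$ is an admissible selection of $\boldsymbol\Theta$ (hence also an admissible transition curve between $U_0$ and $U_1$); 4) $G_t[\vartheta]=G_t[\boldsymbol\Theta]$, and $\vartheta_n\to\vartheta$ uniformly on each compact subset of this set; 5) $\displaystyle\liminf_{n\to\infty}\int_{G_n}|\partial^\circ\mathcal E_{\mathsf t_n(r)}|(\vartheta_n(r))\|\vartheta_n'(r)\|\,dr\ \ge\int_{G_t[\vartheta]}|\partial^\circ\mathcal E_t|(\vartheta(r))\|\vartheta'(r)\|\,dr$; 6) $|\partial^\circ\mathcal E_t|(\vartheta(r))\|\vartheta'(r)\|\le L$ for a.a. $r\in(0,1)$ (the left-hand side being $0$ where $\vartheta(r)\in C(t)$); 7) the graph energy $\mathsf e$ of $\boldsymbol\Theta$ is Lipschitz on $[0,1]$ with constant at most $L$, and $\mathcal E_{\mathsf t_n(\cdot)}(\vartheta_n(\cdot))\to\mathsf e$ uniformly on $F_0=\overline{\{r\in[0,1]:S(r)<\infty\}}$.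 -/

import Mathlib

open Set Filter Topology MeasureTheory
open scoped ENNReal NNReal

/-- Upper Kuratowski limit of a family of sets along a filter. -/
def kuratowskiLs {ι X : Type*} [PseudoMetricSpace X] (l : Filter ι) (F : ι → Set X) : Set X :=
  {x | Filter.liminf (fun i => Metric.infEDist x (F i)) l = 0}

/-- Lower Kuratowski limit of a family of sets along a filter. -/
def kuratowskiLi {ι X : Type*} [PseudoMetricSpace X] (l : Filter ι) (F : ι → Set X) : Set X :=
  {x | Filter.limsup (fun i => Metric.infEDist x (F i)) l = 0}

/-- Kuratowski convergence of a sequence of sets. -/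
def KuratowskiTendsto {X : Type*} [PseudoMetricSpace X] (F : ℕ → Set X) (A : Set X) : Prop :=
  kuratowskiLi atTop F = A ∧ kuratowskiLs atTop F = A

/-- Sequential `Γ`-convergence on the set `A` of the functions `S n` to `S₀`. -/
def GammaTendstoOn {X : Type*} [TopologicalSpace X] (A : Set X)
    (S : ℕ → X → ℝ≥0∞) (S₀ : X → ℝ≥0∞) : Prop :=
  (∀ r ∈ A, ∀ x : ℕ → X, (∀ n, x n ∈ A) → Tendsto x atTop (𝓝 r) →
      S₀ r ≤ Filter.liminf (fun n => S n (x n)) atTop) ∧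
  (∀ r ∈ A, ∃ x : ℕ → X, (∀ n, x n ∈ A) ∧ Tendsto x atTop (𝓝 r) ∧
      Tendsto (fun n => S n (x n)) atTop (𝓝 (S₀ r)))

/-- The section of `Θ` at `r`. -/
def fiber {X : Type*} (Θ : Set (ℝ × X)) (r : ℝ) : Set X :=
  {x | (r, x) ∈ Θ}

/-- Fiberwise connected sets: connected, with connected sections. -/
def FiberwiseConnected {X : Type*} [TopologicalSpace X] (Θ : Set (ℝ × X)) : Prop :=
  IsConnected Θ ∧ ∀ r, IsPreconnected (fiber Θ r)

/-- A time-dependent energy on `[0, T] × dom`, with `dom` a convex subset of `H`. Only the values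
`en t u` with `t ∈ [0, T]` and `u ∈ dom` are meaningful. -/
structure EnergyFunctional (H : Type*) [NormedAddCommGroup H] [InnerProductSpace ℝ H] where
  T : ℝ
  T_pos : 0 < T
  dom : Set H
  convex_dom : Convex ℝ dom
  en : ℝ → H → ℝ

namespace EnergyFunctional

variable {H : Type*} [NormedAddCommGroup H] [InnerProductSpace ℝ H]

/-- The minimum of the energy on `[0, T] × dom` (attained if the sublevels are compact). -/
noncomputable def minEn (𝓔 : EnergyFunctional H) : ℝ :=
  sInf ((fun p : ℝ × H => 𝓔.en p.1 p.2) '' (Icc 0 𝓔.T ×ˢ 𝓔.dom))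

/-- The translated energy, which is at least `1`. -/
noncomputable def enTilde (𝓔 : EnergyFunctional H) (t : ℝ) (u : H) : ℝ :=
  𝓔.en t u - 𝓔.minEn + 1

/-- The points whose translated energy is at most `ρ` at every time. -/
def sublevel (𝓔 : EnergyFunctional H) (ρ : ℝ) : Set H :=
  {u | u ∈ 𝓔.dom ∧ ∀ t ∈ Icc 0 𝓔.T, 𝓔.enTilde t u ≤ ρ}

/-- The partial time derivative of the energy (one-sided at the end points of `[0, T]`). -/
noncomputable def power (𝓔 : EnergyFunctional H) (t : ℝ) (u : H) : ℝ :=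
  derivWithin (fun s => 𝓔.en s u) (Icc 0 𝓔.T) t

/-- The Fréchet subdifferential of `u ↦ en t u` (extended by `+∞` outside `dom`). -/
def subdiff (𝓔 : EnergyFunctional H) (t : ℝ) (u : H) : Set H :=
  {ξ | u ∈ 𝓔.dom ∧ ∀ ε > 0, ∀ᶠ v in 𝓝[𝓔.dom] u,
    inner ℝ ξ (v - u) - ε * ‖v - u‖ ≤ 𝓔.en t v - 𝓔.en t u}

/-- The minimal norm of the elements of the subdifferential, `∞` if there are none. -/
noncomputable def slope (𝓔 : EnergyFunctional H) (t : ℝ) (u : H) : ℝ≥0∞ :=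
  ⨅ ξ ∈ 𝓔.subdiff t u, ‖ξ‖ₑ

/-- The critical points of `u ↦ en t u`. -/
def crit (𝓔 : EnergyFunctional H) (t : ℝ) : Set H :=
  {x | (0 : H) ∈ 𝓔.subdiff t x}

/-- For a nonempty connected subset `V` of the critical set: the connected component of the
critical set that contains `V`. -/
def critComp (𝓔 : EnergyFunctional H) (t : ℝ) (V : Set H) : Set H :=
  ⋃ x ∈ V, connectedComponentIn (𝓔.crit t) x

/-- The structural conditions on the energy. -/
structure Standing (𝓔 : EnergyFunctional H) : Prop where
  /-- compact sublevels in `[0, T] × dom` -/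
  coercive : ∀ c : ℝ, IsCompact {p : ℝ × H | p.1 ∈ Icc 0 𝓔.T ∧ p.2 ∈ 𝓔.dom ∧ 𝓔.en p.1 p.2 ≤ c}
  /-- existence of the partial time derivative -/
  differentiable : ∀ t ∈ Icc 0 𝓔.T, ∀ u ∈ 𝓔.dom,
    DifferentiableWithinAt ℝ (fun s => 𝓔.en s u) (Icc 0 𝓔.T) t
  /-- power control -/
  power_le : ∃ CP : ℝ, 0 ≤ CP ∧ ∀ t ∈ Icc 0 𝓔.T, ∀ u ∈ 𝓔.dom,
    |𝓔.power t u| ≤ CP * 𝓔.enTilde t u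
  /-- continuity of the power along sequences with bounded energy -/
  power_tendsto : ∀ t ∈ Icc 0 𝓔.T, ∀ u ∈ 𝓔.dom, ∀ v : ℕ → H, (∀ n, v n ∈ 𝓔.dom) →
    Tendsto v atTop (𝓝 u) → (∃ c : ℝ, ∀ n, 𝓔.en t (v n) ≤ c) →
    Tendsto (fun n => 𝓔.power t (v n)) atTop (𝓝 (𝓔.power t u))
  /-- `(-lam)`-convexity, uniformly in time -/
  semiconvex : ∃ lam : ℝ, 0 ≤ lam ∧ ∀ t ∈ Icc 0 𝓔.T,
    ConvexOn ℝ 𝓔.dom (fun u => 𝓔.en t u + lam / 2 * ‖u‖ ^ 2)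

/-- The fibered Lusin property: critical values are negligible at every time. -/
def FiberedLusin (𝓔 : EnergyFunctional H) : Prop :=
  ∀ t ∈ Icc 0 𝓔.T, volume (𝓔.en t '' 𝓔.crit t) = 0

/-- The class of compact connected sets between which transitions occur at time `t`: connected
components of the critical set, and singletons of noncritical points. -/
def transitionSets (𝓔 : EnergyFunctional H) (t : ℝ) : Set (Set H) :=
  {U | IsCompact U ∧ IsConnected U ∧
    ((∃ x ∈ 𝓔.crit t, U = connectedComponentIn (𝓔.crit t) x) ∨ (∃ x ∉ 𝓔.crit t, U = {x}))}

/-- The noncritical parameters of a curve `θ : [0, 1] → H`. -/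
def curveG (𝓔 : EnergyFunctional H) (t : ℝ) (θ : ℝ → H) : Set ℝ :=
  {s | s ∈ Icc (0 : ℝ) 1 ∧ θ s ∉ 𝓔.crit t}

/-- The noncritical parameters of a graph over `[0, 1]`; the time is frozen along the constant
map `τ = fun _ => t`, or depends on the parameter through `τ`. -/
def graphG (𝓔 : EnergyFunctional H) (τ : ℝ → ℝ) (Θ : Set (ℝ × H)) : Set ℝ :=
  {s | s ∈ Icc (0 : ℝ) 1 ∧ ∃ x ∈ fiber Θ s, x ∉ 𝓔.crit (τ s)}

/-- Admissible transition curves at time `t` between `U₀` and `U₁`. -/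
structure AdmissibleTransition (𝓔 : EnergyFunctional H) (t : ℝ) (U₀ U₁ : Set H)
    (θ : ℝ → H) : Prop where
  mem_dom : ∀ s ∈ Icc (0 : ℝ) 1, θ s ∈ 𝓔.dom
  start_mem : θ 0 ∈ U₀
  end_mem : θ 1 ∈ U₁
  relOpen : ∃ O : Set ℝ, IsOpen O ∧ 𝓔.curveG t θ = O ∩ Icc 0 1
  locLip : LocallyLipschitzOn (𝓔.curveG t θ) θ
  bound : ∃ L : ℝ≥0, ∀ᵐ s ∂(volume.restrict (𝓔.curveG t θ)),
    𝓔.slope t (θ s) * ‖deriv θ s‖ₑ ≤ L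
  energy_lip : ∃ M : ℝ≥0, LipschitzOnWith M (fun s => 𝓔.en t (θ s)) (Icc 0 1)
  ls_subset : ∀ r ∈ Icc (0 : ℝ) 1 \ 𝓔.curveG t θ,
    kuratowskiLs (𝓝[Icc 0 1 \ {r}] r) (fun s => ({θ s} : Set H)) ⊆ 𝓔.critComp t {θ r}

/-- Compact fiberwise connected subsets of `[0, 1] × sublevel ρ` whose projection is `[0, 1]` and
whose sections over the noncritical parameters at time `t` are singletons. -/
structure BasicGraph (𝓔 : EnergyFunctional H) (t ρ : ℝ) (Θ : Set (ℝ × H)) : Prop where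
  subset : Θ ⊆ Icc 0 1 ×ˢ 𝓔.sublevel ρ
  compact : IsCompact Θ
  connected : FiberwiseConnected Θ
  proj : Prod.fst '' Θ = Icc 0 1
  singleton : ∀ s ∈ 𝓔.graphG (fun _ => t) Θ, ∃ x, fiber Θ s = {x}

/-- Admissible selections in a graph. -/
structure AdmissibleSelection (𝓔 : EnergyFunctional H) (t : ℝ) (Θ : Set (ℝ × H))
    (θ : ℝ → H) : Prop where
  mem : ∀ s ∈ Icc (0 : ℝ) 1, θ s ∈ fiber Θ s
  locLip : LocallyLipschitzOn (𝓔.graphG (fun _ => t) Θ) θ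
  ls_subset : ∀ r ∈ Icc (0 : ℝ) 1 \ 𝓔.graphG (fun _ => t) Θ,
    kuratowskiLs (𝓝[Icc 0 1 \ {r}] r) (fun s => ({θ s} : Set H)) ⊆ 𝓔.critComp t (fiber Θ r)
  integral_lt : ∫⁻ s in 𝓔.graphG (fun _ => t) Θ, 𝓔.slope t (θ s) * ‖deriv θ s‖ₑ < ∞

/-- `e` is the energy profile of the graph `Θ` at time `t`; it is determined on `[0, 1]` if all
the sections are nonempty. -/
def IsGraphEnergy (𝓔 : EnergyFunctional H) (t : ℝ) (Θ : Set (ℝ × H)) (e : ℝ → ℝ) : Prop :=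
  ∀ s x, (s, x) ∈ Θ → e s = 𝓔.en t x

/-- Admissible graph transitions at time `t` between `U₀` and `U₁`. -/
structure GraphTransition (𝓔 : EnergyFunctional H) (t ρ : ℝ) (U₀ U₁ : Set H)
    (Θ : Set (ℝ × H)) : Prop where
  basic : 𝓔.BasicGraph t ρ Θ
  start_subset : fiber Θ 0 ⊆ U₀
  end_subset : fiber Θ 1 ⊆ U₁
  selection : ∃ θ : ℝ → H, 𝓔.AdmissibleSelection t Θ θ ∧
    {p ∈ Θ | p.2 ∉ 𝓔.crit t} = (fun s => (s, θ s)) '' 𝓔.graphG (fun _ => t) Θ ∧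
    ∃ L : ℝ, 0 < L ∧ ∀ᵐ s ∂(volume.restrict (𝓔.graphG (fun _ => t) Θ)),
      𝓔.slope t (θ s) * ‖deriv θ s‖ₑ ≤ ENNReal.ofReal L
  energy_lip : ∃ e : ℝ → ℝ, 𝓔.IsGraphEnergy t Θ e ∧ ∃ M : ℝ≥0, LipschitzOnWith M e (Icc 0 1)

/-- The slope function along a curve `(τ, θ)` with graph `Θ`, set to zero off the noncritical
parameters of the graph. -/
noncomputable def slopeFun (𝓔 : EnergyFunctional H) (τ : ℝ → ℝ) (Θ : Set (ℝ × H))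
    (θ : ℝ → H) : ℝ → ℝ≥0∞ :=
  (𝓔.graphG τ Θ).indicator (fun r => 𝓔.slope (τ r) (θ r))

end EnergyFunctional

/-! On the noncritical part of an approximating graph slope times speed is at most `L`, so wherever
the slope is at least `M > 0` the curve is `L / M`-Lipschitz (`ParametrizedGraph.mul_norm_sub_le`).
The proof follows three objects together: the slopes `S_n`, the graphs `Θ_n` and the accumulated
dissipations `ψ_n(r) = ∫₀ʳ slope · speed`. Each ranges in a compact space (for Γ-convergence, the
Hausdorff distance and pointwise convergence of `L`-Lipschitz functions), and
`exists_subseq_graphLimit` extracts common limits `S`, `Θ`, `ψ`.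

The Γ-limit `S` sorts the parameters. If `S(r) > 0`, the curves are equi-Lipschitz near `r` and the
section `Θ(r)` is a point (`ApproxLimit.fiber_eq`). If `S(r) = 0`, the whole section is critical
(`ApproxLimit.fiber_subset_crit`): near a noncritical point the slope exceeds some `c > 0` by lower
semicontinuity, and a graph passing there needs a definite parameter length to reach a small slope
(`ParametrizedGraph.mul_le_of_slope_gt`), which a recovery sequence contradicts. Limit sections are
connected, and the energy is constant on connected critical sets because critical values are
negligible. Hence any selection `ϑ` of `Θ` serves. The bound `M ‖ϑ(b) - ϑ(a)‖ ≤ |ψ(b) - ψ(a)|`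
survives in the limit; differentiating gives slope · speed `≤ ψ' ≤ L`, and integrating gives the
lower semicontinuity of the dissipation.

For the energies, a chain-rule inequality (`ParametrizedGraph.ae_abs_deriv_en_le`) bounds their
derivative on the noncritical set by `K τ'` plus slope · speed, while at critical parameters they
eventually lie in an open set of small measure containing the critical values at time `t`. Covering
the interval between two energy values by these two contributions bounds the oscillation by the
dissipation plus `ε` (`ApproxLimit.eventually_abs_en_sub_le`). Energies converge where `S < ∞`,
since bounded slopes make the energy continuous; across gaps where `S = ∞` the selection is
constant. So the limit energy is controlled by `ψ` on all of `[0, 1]`. -/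

namespace EnergyFunctional

variable {H : Type*} [NormedAddCommGroup H] [InnerProductSpace ℝ H] {𝓔 : EnergyFunctional H}

/-! ### Semicontinuity of the energy and of its slope. -/

section Closedness

variable {ι : Type*} {l : Filter ι} {s : ι → ℝ} {u : ι → H} {s₀ : ℝ} {u₀ : H}

theorem Standing.en_le_of_frequently (h : 𝓔.Standing) (hs : Tendsto s l (𝓝 s₀))
    (hu : Tendsto u l (𝓝 u₀)) {c : ℝ}
    (hc : ∃ᶠ i in l, s i ∈ Icc 0 𝓔.T ∧ u i ∈ 𝓔.dom ∧ 𝓔.en (s i) (u i) ≤ c) :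
    s₀ ∈ Icc 0 𝓔.T ∧ u₀ ∈ 𝓔.dom ∧ 𝓔.en s₀ u₀ ≤ c :=
  (h.coercive c).isClosed.mem_of_frequently_of_tendsto hc (hs.prodMk_nhds hu)

theorem Standing.eventually_lt_en (h : 𝓔.Standing) (hs : Tendsto s l (𝓝 s₀))
    (hu : Tendsto u l (𝓝 u₀)) (hmem : ∀ᶠ i in l, s i ∈ Icc 0 𝓔.T ∧ u i ∈ 𝓔.dom) {c : ℝ}
    (hc : c < 𝓔.en s₀ u₀) : ∀ᶠ i in l, c < 𝓔.en (s i) (u i) := by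
  by_contra hcon
  rw [not_eventually] at hcon
  have := h.en_le_of_frequently hs hu (c := c)
    ((hcon.and_eventually hmem).mono fun i hi => ⟨hi.2.1, hi.2.2, not_lt.1 hi.1⟩)
  exact absurd this.2.2 (not_le.2 hc)

theorem Standing.tendsto_en_time (h : 𝓔.Standing) (hs : Tendsto s l (𝓝 s₀))
    (hs₀ : s₀ ∈ Icc 0 𝓔.T) (hmem : ∀ᶠ i in l, s i ∈ Icc 0 𝓔.T) {v : H} (hv : v ∈ 𝓔.dom) :
    Tendsto (fun i => 𝓔.en (s i) v) l (𝓝 (𝓔.en s₀ v)) :=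
  (h.differentiable s₀ hs₀ v hv).continuousWithinAt.tendsto.comp
    (tendsto_nhdsWithin_iff.2 ⟨hs, hmem⟩)

end Closedness

theorem Standing.isCompact_sublevel (h : 𝓔.Standing) (ρ : ℝ) : IsCompact (𝓔.sublevel ρ) := by
  set K := {p : ℝ × H | p.1 ∈ Icc 0 𝓔.T ∧ p.2 ∈ 𝓔.dom ∧ 𝓔.en p.1 p.2 ≤ ρ + 𝓔.minEn - 1}
  have hK : IsCompact K := h.coercive _
  have h0 : (0 : ℝ) ∈ Icc 0 𝓔.T := ⟨le_rfl, 𝓔.T_pos.le⟩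
  have heq : 𝓔.sublevel ρ = ⋂ t ∈ Icc 0 𝓔.T, (fun u : H => (t, u)) ⁻¹' K := by
    ext u
    simp only [sublevel, enTilde, mem_ofPred_eq, mem_iInter, mem_preimage, K]
    constructor
    · rintro ⟨hu, hu'⟩ t ht
      exact ⟨ht, hu, by linarith [hu' t ht]⟩
    · intro hu
      exact ⟨(hu 0 h0).2.1, fun t ht => by linarith [(hu t ht).2.2]⟩
  refine IsCompact.of_isClosed_subset (hK.image continuous_snd) ?_ ?_
  · rw [heq]
    exact isClosed_biInter fun t _ => hK.isClosed.preimage (by fun_prop)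
  · rw [heq]
    intro u hu
    simp only [mem_iInter] at hu
    exact ⟨(0, u), hu 0 h0, rfl⟩

theorem Standing.exists_en_sub_le (h : 𝓔.Standing) (ρ : ℝ) :
    ∃ K : ℝ, 0 ≤ K ∧ ∀ u ∈ 𝓔.sublevel ρ, ∀ s ∈ Icc 0 𝓔.T, ∀ s' ∈ Icc 0 𝓔.T,
      |𝓔.en s u - 𝓔.en s' u| ≤ K * |s - s'| := by
  obtain ⟨C, hC, hP⟩ := h.power_le
  refine ⟨|C * ρ|, abs_nonneg _, fun u hu s hs s' hs' => ?_⟩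
  have := (convex_Icc 0 𝓔.T).norm_image_sub_le_of_norm_derivWithin_le (f := fun s => 𝓔.en s u)
    (C := |C * ρ|) (fun t ht => h.differentiable t ht u hu.1) (fun t ht => ?_) hs' hs
  · simpa [Real.norm_eq_abs] using this
  · rw [Real.norm_eq_abs]
    exact ((hP t ht u hu.1).trans (mul_le_mul_of_nonneg_left (hu.2 t ht) hC)).trans (le_abs_self _)

/-- Fréchet subgradients of a semiconvex energy satisfy a global inequality. -/
theorem Standing.exists_mem_subdiff_iff (h : 𝓔.Standing) :
    ∃ lam : ℝ, 0 ≤ lam ∧ ∀ t ∈ Icc 0 𝓔.T, ∀ u ξ : H, ξ ∈ 𝓔.subdiff t u ↔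
      u ∈ 𝓔.dom ∧ ∀ v ∈ 𝓔.dom,
        inner ℝ ξ (v - u) - lam / 2 * ‖v - u‖ ^ 2 ≤ 𝓔.en t v - 𝓔.en t u := by
  obtain ⟨lam, hlam, hconv⟩ := h.semiconvex
  refine ⟨lam, hlam, fun t ht u ξ => ⟨fun ⟨hu, hξ⟩ => ⟨hu, fun v hv => ?_⟩, fun ⟨hu, hξ⟩ =>
    ⟨hu, fun ε hε => ?_⟩⟩⟩
  · have key : ∀ ε > 0, inner ℝ ξ (v - u) - ε * ‖v - u‖ - lam / 2 * ‖v - u‖ ^ 2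
        ≤ 𝓔.en t v - 𝓔.en t u := by
      intro ε hε
      have hmap : Tendsto (fun h : ℝ => u + h • (v - u)) (𝓝[>] 0) (𝓝[𝓔.dom] u) := by
        refine tendsto_nhdsWithin_iff.2 ⟨?_, ?_⟩
        · have : Continuous fun h : ℝ => u + h • (v - u) := by fun_prop
          have := (this.tendsto 0).mono_left (nhdsWithin_le_nhds (s := Ioi 0))
          simpa using this
        · filter_upwards [Ioc_mem_nhdsGT (zero_lt_one' ℝ)] with h hh
          have := 𝓔.convex_dom hu hv (a := 1 - h) (b := h) (by linarith [hh.2]) hh.1.le (by ring)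
          convert this using 1
          module
      obtain ⟨k, hk, hk01⟩ := ((hmap.eventually (hξ ε hε)).and
        (Ioc_mem_nhdsGT (zero_lt_one' ℝ))).exists
      obtain ⟨-, hcv⟩ := hconv t ht
      replace hcv := hcv hu hv (a := 1 - k) (b := k) (by linarith [hk01.2]) hk01.1.le (by ring)
      have hpt : (1 - k) • u + k • v = u + k • (v - u) := by module
      rw [hpt] at hcv
      simp only [smul_eq_mul] at hcv
      simp only [add_sub_cancel_left, inner_smul_right, norm_smul, Real.norm_eq_abs,
        abs_of_pos hk01.1] at hk
      -- The quadratic identity turns convexity of the perturbed energy into semiconvexity along the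
      -- segment; after division by `k` the leftover term of order `k` has a favourable sign.
      have hid : ‖u + k • (v - u)‖ ^ 2
          = (1 - k) * ‖u‖ ^ 2 + k * ‖v‖ ^ 2 - k * (1 - k) * ‖v - u‖ ^ 2 := by
        rw [← real_inner_self_eq_norm_sq, ← real_inner_self_eq_norm_sq,
          ← real_inner_self_eq_norm_sq, ← real_inner_self_eq_norm_sq]
        simp only [inner_add_left, inner_add_right, inner_sub_left, inner_sub_right,
          inner_smul_left, inner_smul_right, real_inner_comm u v, RCLike.conj_to_real]
        ring
      rw [hid] at hcv
      have h1 : k * (inner ℝ ξ (v - u) - ε * ‖v - u‖ - lam / 2 * ‖v - u‖ ^ 2)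
          ≤ k * (𝓔.en t v - 𝓔.en t u) := by
        have : 0 ≤ lam / 2 * k ^ 2 * ‖v - u‖ ^ 2 := by positivity
        nlinarith
      exact le_of_mul_le_mul_left h1 hk01.1
    have hlim : Tendsto (fun ε : ℝ => inner ℝ ξ (v - u) - ε * ‖v - u‖ - lam / 2 * ‖v - u‖ ^ 2)
        (𝓝[>] 0) (𝓝 (inner ℝ ξ (v - u) - 0 * ‖v - u‖ - lam / 2 * ‖v - u‖ ^ 2)) :=
      (Continuous.tendsto (by fun_prop) 0).mono_left nhdsWithin_le_nhds
    rw [zero_mul, sub_zero] at hlim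
    exact le_of_tendsto hlim (eventually_mem_nhdsWithin.mono fun ε hε => key ε hε)
  · have hev : ∀ᶠ v in 𝓝 u, lam / 2 * ‖v - u‖ ≤ ε := by
      have : Tendsto (fun v => lam / 2 * ‖v - u‖) (𝓝 u) (𝓝 (lam / 2 * ‖u - u‖)) :=
        Continuous.tendsto (by fun_prop) u
      rw [sub_self, norm_zero, mul_zero] at this
      exact this.eventually_le_const hε
    filter_upwards [self_mem_nhdsWithin, hev.filter_mono nhdsWithin_le_nhds] with v hv hv'
    refine le_trans ?_ (hξ v hv)
    have := mul_le_mul_of_nonneg_right hv' (norm_nonneg (v - u))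
    nlinarith

/-- The minimal norm of the subgradients controls the decrease of the energy. -/
theorem Standing.exists_en_le (h : 𝓔.Standing) :
    ∃ lam : ℝ, 0 ≤ lam ∧ ∀ t ∈ Icc 0 𝓔.T, ∀ u, ∀ v ∈ 𝓔.dom, ∀ M : ℝ, 0 ≤ M →
      𝓔.slope t u ≤ ENNReal.ofReal M →
      𝓔.en t u ≤ 𝓔.en t v + M * ‖v - u‖ + lam / 2 * ‖v - u‖ ^ 2 := by
  obtain ⟨lam, hlam, hsub⟩ := h.exists_mem_subdiff_iff
  refine ⟨lam, hlam, fun t ht u v hv M hM hslope => ?_⟩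
  have key : ∀ M' > M, 𝓔.en t u ≤ 𝓔.en t v + M' * ‖v - u‖ + lam / 2 * ‖v - u‖ ^ 2 := by
    intro M' hM'
    have hlt : 𝓔.slope t u < ENNReal.ofReal M' :=
      hslope.trans_lt ((ENNReal.ofReal_lt_ofReal_iff (hM.trans_lt hM')).2 hM')
    simp only [slope, iInf_lt_iff] at hlt
    obtain ⟨ξ, hξ, hξM⟩ := hlt
    have h1 := ((hsub t ht u ξ).1 hξ).2 v hv
    have h2 : ‖ξ‖ ≤ M' := by
      rw [← ofReal_norm] at hξM
      exact ((ENNReal.ofReal_lt_ofReal_iff (hM.trans_lt hM')).1 hξM).le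
    have h3 : |inner ℝ ξ (v - u)| ≤ ‖ξ‖ * ‖v - u‖ := abs_real_inner_le_norm _ _
    have h4 := neg_le_of_abs_le h3
    have h5 := mul_le_mul_of_nonneg_right h2 (norm_nonneg (v - u))
    linarith
  have hlim : Tendsto (fun M' : ℝ => 𝓔.en t v + M' * ‖v - u‖ + lam / 2 * ‖v - u‖ ^ 2)
      (𝓝[>] M) (𝓝 (𝓔.en t v + M * ‖v - u‖ + lam / 2 * ‖v - u‖ ^ 2)) :=
    (Continuous.tendsto (by fun_prop) M).mono_left nhdsWithin_le_nhds
  exact ge_of_tendsto hlim (eventually_mem_nhdsWithin.mono fun ε hε => key ε hε)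

theorem slope_eq_zero_of_mem_crit {t : ℝ} {u : H} (hu : u ∈ 𝓔.crit t) : 𝓔.slope t u = 0 := by
  refine le_antisymm ?_ zero_le
  exact (iInf₂_le (0 : H) hu).trans (by simp)

theorem mem_dom_of_slope_lt_top {t : ℝ} {u : H} (hu : 𝓔.slope t u < ∞) : u ∈ 𝓔.dom := by
  simp only [slope, iInf_lt_iff] at hu
  obtain ⟨ξ, hξ, -⟩ := hu
  exact hξ.1

/-- The infimum in the slope need not be known to be attained: slope zero gives `exists_en_le` with
`M = 0`, which already implies the Fréchet condition for the zero vector. -/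
theorem Standing.mem_crit_iff (h : 𝓔.Standing) {t : ℝ} (ht : t ∈ Icc 0 𝓔.T) {u : H} :
    u ∈ 𝓔.crit t ↔ 𝓔.slope t u = 0 := by
  refine ⟨slope_eq_zero_of_mem_crit, fun hu => ?_⟩
  have hdom : u ∈ 𝓔.dom := mem_dom_of_slope_lt_top (hu ▸ ENNReal.zero_lt_top)
  obtain ⟨lam, -, hsub⟩ := h.exists_mem_subdiff_iff
  obtain ⟨lam', hlam', hle⟩ := h.exists_en_le
  refine ⟨hdom, fun ε hε => ?_⟩
  have hev : ∀ᶠ v in 𝓝 u, lam' / 2 * ‖v - u‖ ≤ ε := by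
    have : Tendsto (fun v => lam' / 2 * ‖v - u‖) (𝓝 u) (𝓝 (lam' / 2 * ‖u - u‖)) :=
      Continuous.tendsto (by fun_prop) u
    rw [sub_self, norm_zero, mul_zero] at this
    exact this.eventually_le_const hε
  filter_upwards [self_mem_nhdsWithin, hev.filter_mono nhdsWithin_le_nhds] with v hv hv'
  have h1 := hle t ht u v hv 0 le_rfl (by simp [hu])
  have := mul_le_mul_of_nonneg_right hv' (norm_nonneg (v - u))
  rw [inner_zero_left]
  nlinarith

section Limits

variable {ι : Type*} {l : Filter ι} {s : ι → ℝ} {u : ι → H} {s₀ : ℝ} {u₀ : H}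

/-- Lower semicontinuity comes from the closed sublevels; the slope bound supplies the reverse
inequality, with the limit point `u₀` as competitor in `exists_en_le`. -/
theorem Standing.tendsto_en (h : 𝓔.Standing) (hs : Tendsto s l (𝓝 s₀)) (hs₀ : s₀ ∈ Icc 0 𝓔.T)
    (hu : Tendsto u l (𝓝 u₀)) (hu₀ : u₀ ∈ 𝓔.dom) (hmem : ∀ᶠ i in l, s i ∈ Icc 0 𝓔.T)
    {c : ℝ≥0∞} (hc : c ≠ ∞) (hslope : ∀ᶠ i in l, 𝓔.slope (s i) (u i) ≤ c) :
    Tendsto (fun i => 𝓔.en (s i) (u i)) l (𝓝 (𝓔.en s₀ u₀)) := by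
  obtain ⟨lam, hlam, hle⟩ := h.exists_en_le
  have hdom : ∀ᶠ i in l, s i ∈ Icc 0 𝓔.T ∧ u i ∈ 𝓔.dom := by
    filter_upwards [hmem, hslope] with i hi hi'
    exact ⟨hi, mem_dom_of_slope_lt_top (hi'.trans_lt hc.lt_top)⟩
  refine tendsto_order.2 ⟨fun a ha => h.eventually_lt_en hs hu hdom ha, fun a ha => ?_⟩
  have hlim : Tendsto (fun i => 𝓔.en (s i) u₀ + c.toReal * ‖u₀ - u i‖
      + lam / 2 * ‖u₀ - u i‖ ^ 2) l
      (𝓝 (𝓔.en s₀ u₀ + c.toReal * ‖u₀ - u₀‖ + lam / 2 * ‖u₀ - u₀‖ ^ 2)) := by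
    have hn : Tendsto (fun i => ‖u₀ - u i‖) l (𝓝 ‖u₀ - u₀‖) := (tendsto_const_nhds.sub hu).norm
    exact ((h.tendsto_en_time hs hs₀ hmem hu₀).add (hn.const_mul _)).add ((hn.pow 2).const_mul _)
  simp only [sub_self, norm_zero, mul_zero, add_zero, ne_eq, OfNat.ofNat_ne_zero,
    not_false_eq_true, zero_pow] at hlim
  filter_upwards [hlim.eventually_lt_const ha, hmem, hslope] with i hi hi' hi''
  exact (hle _ hi' _ _ hu₀ _ ENNReal.toReal_nonneg
    (hi''.trans_eq (ENNReal.ofReal_toReal hc).symm)).trans_lt hi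

/-- Nearly minimal subgradients are bounded, hence converge weakly along an ultrafilter. The global
subgradient inequality survives, because the points converge strongly and the energy is lower
semicontinuous. -/
theorem Standing.slope_le_of_frequently [CompleteSpace H] (h : 𝓔.Standing)
    (hs : Tendsto s l (𝓝 s₀)) (hs₀ : s₀ ∈ Icc 0 𝓔.T)
    (hu : Tendsto u l (𝓝 u₀)) (hu₀ : u₀ ∈ 𝓔.dom) (hmem : ∀ᶠ i in l, s i ∈ Icc 0 𝓔.T)
    {c : ℝ≥0∞} (hslope : ∃ᶠ i in l, 𝓔.slope (s i) (u i) ≤ c) : 𝓔.slope s₀ u₀ ≤ c := by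
  obtain ⟨lam, hlam, hsub⟩ := h.exists_mem_subdiff_iff
  refine le_of_forall_gt_imp_ge_of_dense fun c' hc' => ?_
  rcases eq_or_ne c' ∞ with rfl | hc'top
  · exact le_top
  have hne : (l ⊓ 𝓟 {i | 𝓔.slope (s i) (u i) ≤ c}).NeBot := frequently_mem_iff_neBot.1 hslope
  let g : Ultrafilter ι := Ultrafilter.of (l ⊓ 𝓟 {i | 𝓔.slope (s i) (u i) ≤ c})
  have hg : (g : Filter ι) ≤ l ⊓ 𝓟 {i | 𝓔.slope (s i) (u i) ≤ c} := Ultrafilter.of_le _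
  have hgl : (g : Filter ι) ≤ l := hg.trans inf_le_left
  have hgs : ∀ᶠ i in (g : Filter ι), 𝓔.slope (s i) (u i) ≤ c :=
    hg.trans inf_le_right (mem_principal_self _)
  have hex : ∀ i, ∃ ξ : H, 𝓔.slope (s i) (u i) ≤ c → ξ ∈ 𝓔.subdiff (s i) (u i) ∧ ‖ξ‖ₑ < c' := by
    intro i
    by_cases hi : 𝓔.slope (s i) (u i) ≤ c
    · have hlt := hi.trans_lt hc'
      simp only [slope, iInf_lt_iff] at hlt
      obtain ⟨ξ, hξ, hξM⟩ := hlt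
      exact ⟨ξ, fun _ => ⟨hξ, hξM⟩⟩
    · exact ⟨0, fun hi' => absurd hi' hi⟩
  choose ξ hξ using hex
  have hξn : ∀ᶠ i in (g : Filter ι), ‖ξ i‖ ≤ c'.toReal := hgs.mono fun i hi => by
    have := (hξ i hi).2
    rw [← ofReal_norm, ENNReal.ofReal_lt_iff_lt_toReal (norm_nonneg _) hc'top] at this
    exact this.le
  have hcpt := WeakDual.isCompact_closedBall (𝕜 := ℝ) (E := H) 0 c'.toReal
  obtain ⟨ζ, hζ, hlim⟩ := hcpt.ultrafilter_le_nhds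
    (g.map fun i => StrongDual.toWeakDual (InnerProductSpace.toDual ℝ H (ξ i))) (by
      rw [Ultrafilter.coe_map, le_principal_iff, mem_map]
      filter_upwards [hξn] with i hi
      simpa using hi)
  have hinner : ∀ v : H, Tendsto (fun i => inner ℝ (ξ i) v) g (𝓝 (ζ v)) := by
    intro v
    have := ((WeakDual.eval_continuous (𝕜 := ℝ) (E := H) v).tendsto ζ).comp hlim
    simpa [Function.comp_def] using this
  set η : H := (InnerProductSpace.toDual ℝ H).symm (WeakDual.toStrongDual ζ) with hη
  have hηv : ∀ v, inner ℝ η v = ζ v := fun v => by simp [hη]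
  have hηn : ‖η‖ ≤ c'.toReal := by
    have : ‖WeakDual.toStrongDual ζ‖ ≤ c'.toReal := by simpa using hζ
    rwa [hη, LinearIsometryEquiv.norm_map]
  have hηmem : η ∈ 𝓔.subdiff s₀ u₀ := by
    refine (hsub s₀ hs₀ u₀ η).2 ⟨hu₀, fun v hv => ?_⟩
    refine le_of_forall_pos_le_add fun ε hε => ?_
    have hu' : Tendsto u g (𝓝 u₀) := hu.mono_left hgl
    have hs' : Tendsto s g (𝓝 s₀) := hs.mono_left hgl
    have hmem' : ∀ᶠ i in (g : Filter ι), s i ∈ Icc 0 𝓔.T := hmem.filter_mono hgl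
    have h1 : Tendsto (fun i => inner ℝ (ξ i) (v - u i)) g (𝓝 (inner ℝ η (v - u₀))) := by
      -- Split `v - u i` into the fixed vector `v - u₀`, where weak convergence applies, and `u₀ - u
      -- i`, which tends to zero against bounded subgradients.
      have hz : Tendsto (fun i => inner ℝ (ξ i) (u₀ - u i)) g (𝓝 0) := by
        have hn : Tendsto (fun i => c'.toReal * ‖u₀ - u i‖) g (𝓝 (c'.toReal * ‖u₀ - u₀‖)) :=
          ((tendsto_const_nhds.sub hu').norm).const_mul _
        rw [sub_self, norm_zero, mul_zero] at hn
        refine squeeze_zero_norm' (hξn.mono fun i hi => ?_) hn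
        exact (norm_inner_le_norm _ _).trans (mul_le_mul_of_nonneg_right hi (norm_nonneg _))
      have := (hinner (v - u₀)).add hz
      rw [add_zero, ← hηv] at this
      refine this.congr fun i => ?_
      rw [← inner_add_right]
      congr 1
      abel
    have h2 : Tendsto (fun i => inner ℝ (ξ i) (v - u i) - lam / 2 * ‖v - u i‖ ^ 2
        - 𝓔.en (s i) v) g
        (𝓝 (inner ℝ η (v - u₀) - lam / 2 * ‖v - u₀‖ ^ 2 - 𝓔.en s₀ v)) :=
      (h1.sub ((((tendsto_const_nhds.sub hu').norm).pow 2).const_mul _)).sub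
        (h.tendsto_en_time hs' hs₀ hmem' hv)
    have h3 : ∀ᶠ i in (g : Filter ι), 𝓔.en s₀ u₀ - ε < 𝓔.en (s i) (u i) :=
      h.eventually_lt_en hs' hu' (by
        filter_upwards [hmem', hgs] with i hi hi'
        exact ⟨hi, (hξ i hi').1.1⟩) (by linarith)
    have h4 := le_of_tendsto h2 (b := -(𝓔.en s₀ u₀ - ε)) (by
      filter_upwards [h3, hmem', hgs] with i hi hi' hi''
      have := ((hsub _ hi' _ _).1 (hξ i hi'').1).2 v hv
      linarith)
    linarith
  calc 𝓔.slope s₀ u₀ ≤ ‖η‖ₑ := iInf₂_le η hηmem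
    _ ≤ c' := by
      rw [← ofReal_norm]
      exact ENNReal.ofReal_le_of_le_toReal hηn

theorem Standing.eventually_lt_slope [CompleteSpace H] (h : 𝓔.Standing)
    (hs : Tendsto s l (𝓝 s₀)) (hs₀ : s₀ ∈ Icc 0 𝓔.T)
    (hu : Tendsto u l (𝓝 u₀)) (hu₀ : u₀ ∈ 𝓔.dom) (hmem : ∀ᶠ i in l, s i ∈ Icc 0 𝓔.T)
    {c : ℝ≥0∞} (hc : c < 𝓔.slope s₀ u₀) : ∀ᶠ i in l, c < 𝓔.slope (s i) (u i) := by
  by_contra hcon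
  rw [not_eventually] at hcon
  exact absurd (h.slope_le_of_frequently hs hs₀ hu hu₀ hmem (hcon.mono fun i hi => not_lt.1 hi))
    (not_le.2 hc)

end Limits

/-- The slope vanishes on `V`, so the energy is continuous there and its image is an interval; a
negligible interval is a point. -/
theorem Standing.en_eq_of_isPreconnected (h : 𝓔.Standing) (hC : 𝓔.FiberedLusin) {t : ℝ}
    (ht : t ∈ Icc 0 𝓔.T) {V : Set H} (hV : IsPreconnected V) (hsub : V ⊆ 𝓔.crit t) {x y : H}
    (hx : x ∈ V) (hy : y ∈ V) : 𝓔.en t x = 𝓔.en t y := by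
  have hcont : ContinuousOn (𝓔.en t) V := fun u hu =>
    h.tendsto_en tendsto_const_nhds ht (tendsto_id.mono_left nhdsWithin_le_nhds) (hsub hu).1
      (Eventually.of_forall fun _ => ht) ENNReal.zero_ne_top
      (eventually_mem_nhdsWithin.mono fun v hv => (slope_eq_zero_of_mem_crit (hsub hv)).le)
  have himg : IsPreconnected (𝓔.en t '' V) := hV.image _ hcont
  have hnull : volume (𝓔.en t '' V) = 0 := measure_mono_null (image_mono hsub) (hC t ht)
  by_contra hne
  wlog hlt : 𝓔.en t x < 𝓔.en t y generalizing x y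
  · exact this hy hx (Ne.symm hne) (lt_of_le_of_ne (not_lt.1 hlt) (Ne.symm hne))
  have hsubI : Icc (𝓔.en t x) (𝓔.en t y) ⊆ 𝓔.en t '' V :=
    himg.Icc_subset (mem_image_of_mem _ hx) (mem_image_of_mem _ hy)
  have := measure_mono_null hsubI hnull
  rw [Real.volume_Icc, ENNReal.ofReal_eq_zero] at this
  linarith

end EnergyFunctional

/-! ### Lipschitz curves in a separable Hilbert space. -/

section HilbertCurves

variable {H : Type*} [NormedAddCommGroup H] [InnerProductSpace ℝ H]

theorem Orthonormal.countable_of_separableSpace [TopologicalSpace.SeparableSpace H] {w : Set H}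
    (hw : Orthonormal ℝ ((↑) : w → H)) : w.Countable := by
  have hdisj : w.PairwiseDisjoint fun x => Metric.ball x (1 / 2) := by
    intro x hx y hy hxy
    refine Metric.ball_disjoint_ball ?_
    have hin : inner ℝ x y = (0 : ℝ) :=
      hw.2 (i := ⟨x, hx⟩) (j := ⟨y, hy⟩) fun h => hxy (congrArg Subtype.val h)
    have hx1 : ‖x‖ = 1 := hw.1 ⟨x, hx⟩
    have hy1 : ‖y‖ = 1 := hw.1 ⟨y, hy⟩
    have h2 : ‖x - y‖ ^ 2 = 2 := by
      rw [norm_sub_sq_real, hin, hx1, hy1]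
      norm_num
    rw [dist_eq_norm]
    nlinarith [norm_nonneg (x - y)]
  exact hdisj.countable_of_isOpen (fun _ _ => Metric.isOpen_ball)
    (fun x _ => ⟨x, Metric.mem_ball_self (by norm_num)⟩)

variable [CompleteSpace H] [TopologicalSpace.SeparableSpace H]

/-- A Lipschitz curve in a separable Hilbert space is the integral of a bounded function. -/
theorem LipschitzWith.exists_eq_intervalIntegral {K : ℝ≥0} {f : ℝ → H} (hf : LipschitzWith K f) :
    ∃ v : ℝ → H, LocallyIntegrable v volume ∧ ∀ a b, f b - f a = ∫ r in a..b, v r := by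
  obtain ⟨w, b, hb⟩ := exists_hilbertBasis ℝ H
  have hon : Orthonormal ℝ ((↑) : w → H) := hb ▸ b.orthonormal
  have : Countable w := hon.countable_of_separableSpace.to_subtype
  let g : w → ℝ → ℝ := fun i r => inner ℝ (b i) (f r)
  have hg : ∀ i, LipschitzWith K (g i) := fun i => by
    refine LipschitzWith.of_dist_le_mul fun x y => ?_
    rw [Real.dist_eq, ← inner_sub_right]
    refine (abs_real_inner_le_norm _ _).trans ?_
    rw [b.orthonormal.1 i, one_mul, ← dist_eq_norm]
    exact hf.dist_le_mul x y
  have hgd : ∀ᵐ r, ∀ i, DifferentiableAt ℝ (g i) r :=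
    ae_all_iff.2 fun i => (hg i).ae_differentiableAt_real
  let V : Finset w → ℝ → H := fun s r => ∑ i ∈ s, deriv (g i) r • b i
  -- Bessel's inequality for the difference quotients of `f`, of norm at most `K`, passes to the
  -- limit and makes the coordinate derivatives square summable.
  have hVn : ∀ᵐ r, ∀ s : Finset w, ∑ i ∈ s, ‖deriv (g i) r‖ ^ 2 ≤ (K : ℝ) ^ 2 := by
    filter_upwards [hgd] with r hr s
    have hlim : Tendsto (fun y => ∑ i ∈ s, ‖slope (g i) r y‖ ^ 2) (𝓝[≠] r)
        (𝓝 (∑ i ∈ s, ‖deriv (g i) r‖ ^ 2)) :=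
      tendsto_finsetSum _ fun i _ =>
        ((hasDerivAt_iff_tendsto_slope.1 (hr i).hasDerivAt).norm).pow 2
    refine le_of_tendsto hlim (eventually_mem_nhdsWithin.mono fun y hy => ?_)
    have hyr : 0 < |y - r| := abs_pos.2 (sub_ne_zero.2 hy)
    have h1 : ∀ i, slope (g i) r y = inner ℝ (b i) ((y - r)⁻¹ • (f y - f r)) := fun i => by
      simp [slope, g, inner_smul_right, inner_sub_right]
    simp only [h1]
    refine (b.orthonormal.sum_inner_products_le _).trans ?_
    have h2 : ‖(y - r)⁻¹ • (f y - f r)‖ ≤ K := by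
      rw [norm_smul, norm_inv, Real.norm_eq_abs, inv_mul_le_iff₀ hyr, mul_comm, ← dist_eq_norm,
        ← Real.dist_eq]
      exact hf.dist_le_mul y r
    gcongr
  let v : ℝ → H := fun r => ∑' i, deriv (g i) r • b i
  have hv : ∀ᵐ r, HasSum (fun i => deriv (g i) r • b i) (v r) := by
    filter_upwards [hVn] with r hr
    have hmem : Memℓp (fun i => deriv (g i) r) 2 := by
      refine memℓp_gen ?_
      simp only [ENNReal.toReal_ofNat, Real.rpow_ofNat]
      exact summable_of_sum_le (fun i => by positivity) hr
    exact (b.hasSum_repr_symm ⟨_, hmem⟩).summable.hasSum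
  have hVeq : ∀ s r, ‖V s r‖ ^ 2 = ∑ i ∈ s, ‖deriv (g i) r‖ ^ 2 := fun s r => by
    rw [← real_inner_self_eq_norm_sq, b.orthonormal.inner_sum]
    simp [sq]
  have hvn : ∀ᵐ r, ‖v r‖ ≤ K := by
    filter_upwards [hVn, hv] with r hr hr'
    refine le_of_tendsto hr'.norm (Eventually.of_forall fun s => ?_)
    refine le_of_sq_le_sq ?_ K.2
    exact (hVeq s r).trans_le (hr s)
  have hvm : AEStronglyMeasurable v volume := by
    refine aestronglyMeasurable_of_tendsto_ae (u := (atTop : Filter (Finset w))) (f := V)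
      (fun s => ?_) (hv.mono fun r hr => hr)
    exact (Finset.stronglyMeasurable_fun_sum s fun i _ =>
      (stronglyMeasurable_deriv (g i)).smul_const (b i)).aestronglyMeasurable
  have hvint : LocallyIntegrable v volume := by
    refine (locallyIntegrable_const (K : ℝ)).mono hvm ?_
    filter_upwards [hvn] with r hr
    simpa using hr
  refine ⟨v, hvint, fun x y => ?_⟩
  have hvi : IntervalIntegrable v volume x y :=
    (hvint.integrableOn_isCompact isCompact_uIcc).intervalIntegrable
  -- Compare coordinates: each one is the fundamental theorem of calculus for a real Lipschitz
  -- function.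
  refine b.repr.injective (Subtype.ext (funext fun i => ?_))
  rw [b.repr_apply_apply, b.repr_apply_apply, ← innerSL_apply_apply ℝ (b i) (∫ r in x..y, v r),
    ← (innerSL ℝ (b i)).intervalIntegral_comp_comm hvi, inner_sub_right]
  change g i y - g i x = _
  rw [← ((hg i).lipschitzOnWith).absolutelyContinuousOnInterval.integral_deriv_eq_sub]
  refine intervalIntegral.integral_congr_ae (hv.mono fun r hr _ => ?_)
  have h1 := hr.mapL (innerSL ℝ (b i))
  have h2 : HasSum (fun j => (innerSL ℝ (b i)) (deriv (g j) r • b j)) (deriv (g i) r) := by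
    have := hasSum_single (f := fun j => (innerSL ℝ (b i)) (deriv (g j) r • b j)) i
      (fun j hj => by
        simp [b.orthonormal.2 hj.symm])
    simpa [inner_smul_right, b.orthonormal.1 i] using this
  exact h2.unique h1

theorem LipschitzWith.ae_differentiableAt_curve {K : ℝ≥0} {f : ℝ → H} (hf : LipschitzWith K f) :
    ∀ᵐ r, DifferentiableAt ℝ f r := by
  obtain ⟨v, hv, hvf⟩ := hf.exists_eq_intervalIntegral
  filter_upwards [_root_.LocallyIntegrable.ae_hasDerivAt_integral hv] with r hr
  have : f = fun r => f 0 + ∫ x in (0 : ℝ)..r, v x := by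
    funext r
    rw [← hvf, add_sub_cancel]
  rw [this]
  exact ((hr 0).const_add _).differentiableAt

theorem LipschitzWith.norm_sub_le_integral_norm_deriv {K : ℝ≥0} {f : ℝ → H}
    (hf : LipschitzWith K f) {a b : ℝ} (hab : a ≤ b) :
    ‖f b - f a‖ ≤ ∫ r in a..b, ‖deriv f r‖ := by
  obtain ⟨v, hv, hvf⟩ := hf.exists_eq_intervalIntegral
  have hae : ∀ᵐ r, deriv f r = v r := by
    filter_upwards [_root_.LocallyIntegrable.ae_hasDerivAt_integral hv] with r hr
    have : f = fun r => f 0 + ∫ x in (0 : ℝ)..r, v x := by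
      funext r
      rw [← hvf, add_sub_cancel]
    rw [this]
    exact ((hr 0).const_add _).deriv
  rw [hvf a b]
  refine (intervalIntegral.norm_integral_le_integral_norm hab).trans_eq ?_
  exact intervalIntegral.integral_congr_ae (hae.mono fun r hr _ => by rw [hr])

theorem LipschitzOnWith.ae_differentiableAt_curve {K : ℝ≥0} {f : ℝ → H} {a b : ℝ}
    (hf : LipschitzOnWith K f (Icc a b)) : ∀ᵐ r, r ∈ Ioo a b → DifferentiableAt ℝ f r := by
  rcases le_or_gt a b with hab | hab
  · have hlip : LipschitzWith K (IccExtend hab ((Icc a b).domRestrict f)) := by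
      simpa [IccExtend] using (lipschitzOnWith_iff_restrict.1 hf).comp (LipschitzWith.projIcc hab)
    filter_upwards [hlip.ae_differentiableAt_curve] with r hr hrab
    refine hr.congr_of_eventuallyEq ?_
    filter_upwards [Ioo_mem_nhds hrab.1 hrab.2] with x hx
    rw [IccExtend_of_mem _ _ (Ioo_subset_Icc_self hx)]
    rfl
  · exact Eventually.of_forall fun r hr => absurd (hr.1.trans hr.2) hab.not_gt

theorem LipschitzOnWith.norm_sub_le_integral_norm_deriv {K : ℝ≥0} {f : ℝ → H} {a b : ℝ}
    (hf : LipschitzOnWith K f (Icc a b)) (hab : a ≤ b) :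
    ‖f b - f a‖ ≤ ∫ r in a..b, ‖deriv f r‖ := by
  have hlip : LipschitzWith K (IccExtend hab ((Icc a b).domRestrict f)) := by
    simpa [IccExtend] using (lipschitzOnWith_iff_restrict.1 hf).comp (LipschitzWith.projIcc hab)
  have h := hlip.norm_sub_le_integral_norm_deriv hab
  rw [IccExtend_of_mem _ _ (left_mem_Icc.2 hab), IccExtend_of_mem _ _ (right_mem_Icc.2 hab)] at h
  refine h.trans_eq (intervalIntegral.integral_congr_uIoo fun r hr => ?_)
  rw [uIoo_of_le hab] at hr
  congr 1
  refine EventuallyEq.deriv_eq ?_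
  filter_upwards [Ioo_mem_nhds hr.1 hr.2] with x hx
  rw [IccExtend_of_mem _ _ (Ioo_subset_Icc_self hx)]
  rfl

end HilbertCurves

/-! ### Measures of images, sections of compact sets, one-sided derivative tests. -/

theorem LipschitzOnWith.volume_image_eq_zero {K : ℝ≥0} {f : ℝ → ℝ} {A : Set ℝ}
    (hf : LipschitzOnWith K f A) (hA : volume A = 0) : volume (f '' A) = 0 := by
  have h := hf.hausdorffMeasure_image_le (d := 1) zero_le_one
  rw [hausdorffMeasure_real] at h
  simpa [hA] using h

/-- The exceptional null set, enlarged to a measurable one, has null image because `f` is Lipschitz;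
on the rest the area inequality applies. -/
theorem LipschitzOnWith.volume_image_le_lintegral {K : ℝ≥0} {f g : ℝ → ℝ} {A : Set ℝ}
    (hf : LipschitzOnWith K f A) (hA : MeasurableSet A)
    (hd : ∀ᵐ r, r ∈ A → DifferentiableAt ℝ f r ∧ |deriv f r| ≤ g r) :
    volume (f '' A) ≤ ∫⁻ r in A, ENNReal.ofReal (g r) := by
  set N := toMeasurable volume {r | ¬ (r ∈ A → DifferentiableAt ℝ f r ∧ |deriv f r| ≤ g r)} with hN
  have hN0 : volume N = 0 := (measure_toMeasurable _).trans hd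
  have hNm : MeasurableSet N := measurableSet_toMeasurable _ _
  have hgood : ∀ r ∈ A \ N, DifferentiableAt ℝ f r ∧ |deriv f r| ≤ g r := fun r hr => by
    by_contra hcon
    exact hr.2 (subset_toMeasurable _ _ fun h => hcon (h hr.1))
  have hsub : f '' A ⊆ f '' (A \ N) ∪ f '' (A ∩ N) := by
    rw [← image_union, sdiff_union_inter]
  calc volume (f '' A) ≤ volume (f '' (A \ N)) + volume (f '' (A ∩ N)) :=
        (measure_mono hsub).trans (measure_union_le _ _)
    _ = volume (f '' (A \ N)) := by
        rw [(hf.mono inter_subset_left).volume_image_eq_zero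
          (measure_mono_null inter_subset_right hN0), add_zero]
    _ ≤ ∫⁻ r in A \ N, ENNReal.ofReal |(fderiv ℝ f r).det| :=
        addHaar_image_le_lintegral_abs_det_fderiv volume (hA.diff hNm)
          fun r hr => (hgood r hr).1.hasFDerivAt.hasFDerivWithinAt
    _ ≤ ∫⁻ r in A \ N, ENNReal.ofReal (g r) := by
        refine setLIntegral_mono_ae' (hA.diff hNm) (Eventually.of_forall fun r hr => ?_)
        have hdet : (fderiv ℝ f r).det = deriv f r := by
          simp [ContinuousLinearMap.det]
        rw [hdet]
        exact ENNReal.ofReal_le_ofReal (hgood r hr).2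
    _ ≤ ∫⁻ r in A, ENNReal.ofReal (g r) := lintegral_mono_set sdiff_subset

/-- The sections of a compact set depend upper semicontinuously on the parameter. -/
theorem IsCompact.eventually_fiber_subset {X : Type*} [TopologicalSpace X] [T2Space X]
    {K : Set (ℝ × X)} (hK : IsCompact K) {r : ℝ} {V : Set X} (hV : IsOpen V)
    (hr : fiber K r ⊆ V) : ∀ᶠ r' in 𝓝 r, fiber K r' ⊆ V := by
  have hcl : IsClosed (Prod.fst '' (K \ (univ ×ˢ V))) :=
    ((hK.diff (isOpen_univ.prod hV)).image continuous_fst).isClosed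
  have hmem : r ∈ (Prod.fst '' (K \ (univ ×ˢ V)))ᶜ := by
    rintro ⟨⟨r', x⟩, ⟨hx, hx'⟩, rfl⟩
    exact hx' ⟨mem_univ _, hr hx⟩
  filter_upwards [hcl.isOpen_compl.mem_nhds hmem] with r' hr' x hx
  by_contra hxV
  exact hr' ⟨(r', x), ⟨hx, fun h => hxV h.2⟩, rfl⟩

/-- Substitute for a subgradient at a point `r` of infinite slope. A minimizer `x` of `S` between
`r` and `y` bounds `S` from below on the whole interval from `r` to `x`, so its own value may be
used as `M`. If the minimum is infinite, every `M` is allowed and `θ` does not move. -/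
theorem exists_ne_argmin {H : Type*} [NormedAddCommGroup H] {S : ℝ → ℝ≥0∞} {θ : ℝ → H}
    {ψ : ℝ → ℝ} {r y : ℝ} (hS : LowerSemicontinuousOn S (uIcc r y)) (hr : S r = ∞) (hne : r ≠ y)
    (hθ : ∀ x ∈ uIcc r y, ∀ M : ℝ, 0 < M → (∀ z ∈ uIcc r x, ENNReal.ofReal M ≤ S z) →
      M * ‖θ x - θ r‖ ≤ |ψ x - ψ r|) :
    ∃ x ∈ uIcc r y, x ≠ r ∧ S x ≤ S y ∧
      ((S x ≠ ∞ ∧ (S x).toReal * ‖θ x - θ r‖ ≤ |ψ x - ψ r|) ∨ θ x = θ r) := by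
  obtain ⟨x, hx, hmin⟩ := hS.exists_isMinOn ⟨r, left_mem_uIcc⟩ isCompact_uIcc
  rcases eq_or_ne (S x) ∞ with htop | htop
  · refine ⟨y, right_mem_uIcc, hne.symm, le_rfl, Or.inr ?_⟩
    have hall : ∀ z ∈ uIcc r y, S z = ∞ := fun z hz => top_le_iff.1 (htop ▸ hmin hz)
    by_contra hcon
    have hpos : 0 < ‖θ y - θ r‖ := norm_pos_iff.2 (sub_ne_zero.2 hcon)
    have h1 := hθ y right_mem_uIcc ((|ψ y - ψ r| + 1) / ‖θ y - θ r‖) (by positivity)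
      (fun z hz => by rw [hall z hz]; exact le_top)
    rw [div_mul_cancel₀ _ hpos.ne'] at h1
    linarith
  · refine ⟨x, hx, fun h => htop (h ▸ hr), hmin right_mem_uIcc, Or.inl ⟨htop, ?_⟩⟩
    rcases eq_or_ne (S x) 0 with h0 | h0
    · simp [h0]
    · refine hθ x hx _ (ENNReal.toReal_pos h0 htop) fun z hz => ?_
      rw [ENNReal.ofReal_toReal htop]
      exact hmin (uIcc_subset_uIcc_left hx hz)

theorem HasDerivAt.nonneg_of_frequently_nhdsGT {q : ℝ → ℝ} {q' r : ℝ} (hq : HasDerivAt q q' r)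
    (h0 : q r = 0) (h : ∃ᶠ x in 𝓝[>] r, 0 ≤ q x) : 0 ≤ q' := by
  have hlim := (hasDerivAt_iff_tendsto_slope.1 hq).mono_left
    (nhdsWithin_mono r fun x (hx : r < x) => hx.ne')
  refine ge_of_tendsto_of_frequently hlim
    ((h.and_eventually eventually_mem_nhdsWithin).mono fun x hx => ?_)
  rw [slope_def_field, h0, sub_zero]
  exact div_nonneg hx.1 (sub_nonneg.2 (le_of_lt hx.2))

theorem HasDerivAt.nonpos_of_frequently_nhdsLT {q : ℝ → ℝ} {q' r : ℝ} (hq : HasDerivAt q q' r)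
    (h0 : q r = 0) (h : ∃ᶠ x in 𝓝[<] r, 0 ≤ q x) : q' ≤ 0 := by
  have hlim := (hasDerivAt_iff_tendsto_slope.1 hq).mono_left
    (nhdsWithin_mono r fun x (hx : x < r) => hx.ne)
  refine le_of_tendsto_of_frequently hlim
    ((h.and_eventually eventually_mem_nhdsWithin).mono fun x hx => ?_)
  rw [slope_def_field, h0, sub_zero]
  exact div_nonpos_of_nonneg_of_nonpos hx.1 (sub_nonpos.2 (le_of_lt hx.2))

/-! ### A single parametrized graph: slope, dissipation and chain rule. -/

namespace EnergyFunctional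

variable {H : Type*} [NormedAddCommGroup H] [InnerProductSpace ℝ H] {𝓔 : EnergyFunctional H}

/-- A graph with a selection `θ` and a time parametrization `τ` for which slope times speed is
bounded by `L` on the noncritical set. -/
structure ParametrizedGraph (𝓔 : EnergyFunctional H) (ρ L : ℝ) (τ : ℝ → ℝ) (θ : ℝ → H)
    (Θ : Set (ℝ × H)) : Prop where
  maps : MapsTo τ (Icc 0 1) (Icc 0 𝓔.T)
  subset : Θ ⊆ Icc 0 1 ×ˢ 𝓔.sublevel ρ
  compact : IsCompact Θ
  conn : FiberwiseConnected Θ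
  mem : ∀ r ∈ Icc (0 : ℝ) 1, θ r ∈ fiber Θ r
  single : ∀ r ∈ 𝓔.graphG τ Θ, fiber Θ r = {θ r}
  lip : ∃ K : ℝ≥0, LipschitzOnWith K τ (Icc 0 1)
  mono : MonotoneOn τ (Icc 0 1)
  locLip : LocallyLipschitzOn (𝓔.graphG τ Θ) θ
  bound : ∀ᵐ r ∂(volume.restrict (𝓔.graphG τ Θ)),
      ENNReal.ofReal (deriv τ r) + 𝓔.slope (τ r) (θ r) * ‖deriv θ r‖ₑ ≤ ENNReal.ofReal L
  en_lip : ∃ K : ℝ≥0, LipschitzOnWith K (fun r => 𝓔.en (τ r) (θ r)) (Icc 0 1)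

/-- The product of slope and speed along a parametrized graph. -/
noncomputable def rate (𝓔 : EnergyFunctional H) (τ : ℝ → ℝ) (Θ : Set (ℝ × H)) (θ : ℝ → H)
    (r : ℝ) : ℝ :=
  (𝓔.slopeFun τ Θ θ r * ‖deriv θ r‖ₑ).toReal

/-- The dissipation accumulated up to the parameter `r`. -/
noncomputable def dissip (𝓔 : EnergyFunctional H) (τ : ℝ → ℝ) (Θ : Set (ℝ × H)) (θ : ℝ → H)
    (r : ℝ) : ℝ :=
  ∫ x in (0 : ℝ)..r, 𝓔.rate τ Θ θ x

namespace ParametrizedGraph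

variable {ρ L : ℝ} {τ : ℝ → ℝ} {θ : ℝ → H} {Θ : Set (ℝ × H)}

theorem mem_sublevel (h : ParametrizedGraph 𝓔 ρ L τ θ Θ) {r : ℝ} (hr : r ∈ Icc (0 : ℝ) 1) :
    θ r ∈ 𝓔.sublevel ρ := (h.subset (h.mem r hr)).2

theorem not_mem_crit (h : ParametrizedGraph 𝓔 ρ L τ θ Θ) {r : ℝ} (hr : r ∈ 𝓔.graphG τ Θ) :
    θ r ∉ 𝓔.crit (τ r) := by
  obtain ⟨x, hx, hx'⟩ := hr.2
  rw [h.single r hr, mem_singleton_iff] at hx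
  exact hx ▸ hx'

theorem slopeFun_eq (h : ParametrizedGraph 𝓔 ρ L τ θ Θ) {r : ℝ} (hr : r ∈ Icc (0 : ℝ) 1) :
    𝓔.slopeFun τ Θ θ r = 𝓔.slope (τ r) (θ r) := by
  by_cases hG : r ∈ 𝓔.graphG τ Θ
  · exact indicator_of_mem hG _
  · rw [slopeFun, indicator_of_notMem hG]
    refine (slope_eq_zero_of_mem_crit ?_).symm
    by_contra hcon
    exact hG ⟨hr, _, h.mem r hr, hcon⟩

theorem mem_graphG_iff (h𝓔 : 𝓔.Standing) (h : ParametrizedGraph 𝓔 ρ L τ θ Θ) {r : ℝ} :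
    r ∈ 𝓔.graphG τ Θ ↔ 0 < 𝓔.slopeFun τ Θ θ r := by
  constructor
  · intro hr
    rw [h.slopeFun_eq hr.1, pos_iff_ne_zero, Ne, ← h𝓔.mem_crit_iff (h.maps hr.1)]
    exact h.not_mem_crit hr
  · intro hr
    by_contra hG
    rw [slopeFun, indicator_of_notMem hG] at hr
    exact lt_irrefl _ hr

theorem tendsto_curve (h : ParametrizedGraph 𝓔 ρ L τ θ Θ) {r : ℝ} (hr : r ∈ 𝓔.graphG τ Θ) :
    Tendsto θ (𝓝[Icc 0 1] r) (𝓝 (θ r)) := by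
  refine tendsto_nhds.2 fun V hV hVr => ?_
  filter_upwards [(h.compact.eventually_fiber_subset hV (by
    rw [h.single r hr]; exact singleton_subset_iff.2 hVr)).filter_mono nhdsWithin_le_nhds,
    self_mem_nhdsWithin] with x hx hxI
  exact hx (h.mem x hxI)

theorem tendsto_time (h : ParametrizedGraph 𝓔 ρ L τ θ Θ) {r : ℝ} (hr : r ∈ Icc (0 : ℝ) 1) :
    Tendsto τ (𝓝[Icc 0 1] r) (𝓝 (τ r)) := by
  obtain ⟨K, hK⟩ := h.lip
  exact hK.continuousOn r hr

theorem rate_nonneg (r : ℝ) : 0 ≤ 𝓔.rate τ Θ θ r := ENNReal.toReal_nonneg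

theorem exists_lipschitzOnWith (h : ParametrizedGraph 𝓔 ρ L τ θ Θ) {a b : ℝ}
    (hab : Icc a b ⊆ 𝓔.graphG τ Θ) : ∃ K : ℝ≥0, LipschitzOnWith K θ (Icc a b) :=
  (h.locLip.mono hab).exists_lipschitzOnWith_of_compact isCompact_Icc

variable [CompleteSpace H]

theorem lowerSemicontinuousOn (h𝓔 : 𝓔.Standing) (h : ParametrizedGraph 𝓔 ρ L τ θ Θ) :
    LowerSemicontinuousOn (𝓔.slopeFun τ Θ θ) (Icc 0 1) := by
  intro r hr c hc
  have hG : r ∈ 𝓔.graphG τ Θ := (h.mem_graphG_iff h𝓔).2 (pos_of_gt hc)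
  rw [h.slopeFun_eq hr] at hc
  filter_upwards [h𝓔.eventually_lt_slope (h.tendsto_time hr) (h.maps hr) (h.tendsto_curve hG)
    (h.mem_sublevel hr).1 (eventually_mem_nhdsWithin.mono fun x hx => h.maps hx) hc,
    self_mem_nhdsWithin] with x hx hxI
  rwa [h.slopeFun_eq hxI]

theorem measurable_slopeFun (h𝓔 : 𝓔.Standing) (h : ParametrizedGraph 𝓔 ρ L τ θ Θ) :
    Measurable (𝓔.slopeFun τ Θ θ) := by
  refine measurable_of_Ioi fun c => ?_
  obtain ⟨u, hu, hu'⟩ := lowerSemicontinuousOn_iff_preimage_Ioi.1 (h.lowerSemicontinuousOn h𝓔) c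
  have : 𝓔.slopeFun τ Θ θ ⁻¹' Ioi c = Icc 0 1 ∩ 𝓔.slopeFun τ Θ θ ⁻¹' Ioi c := by
    refine (inter_eq_right.2 fun r hr => ?_).symm
    exact ((h.mem_graphG_iff h𝓔).2 (pos_of_gt hr)).1
  rw [this, hu']
  exact measurableSet_Icc.inter hu.measurableSet

theorem measurableSet_graphG (h𝓔 : 𝓔.Standing) (h : ParametrizedGraph 𝓔 ρ L τ θ Θ) :
    MeasurableSet (𝓔.graphG τ Θ) := by
  have : 𝓔.graphG τ Θ = 𝓔.slopeFun τ Θ θ ⁻¹' Ioi 0 := by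
    ext r
    exact h.mem_graphG_iff h𝓔
  rw [this]
  exact h.measurable_slopeFun h𝓔 measurableSet_Ioi

theorem ae_mul_le (h𝓔 : 𝓔.Standing) (h : ParametrizedGraph 𝓔 ρ L τ θ Θ) :
    ∀ᵐ r, 𝓔.slopeFun τ Θ θ r * ‖deriv θ r‖ₑ ≤ ENNReal.ofReal L := by
  have := (ae_restrict_iff' (h.measurableSet_graphG h𝓔)).1 h.bound
  filter_upwards [this] with r hr
  by_cases hG : r ∈ 𝓔.graphG τ Θ
  · rw [slopeFun, indicator_of_mem hG]
    exact le_add_self.trans (hr hG)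
  · rw [slopeFun, indicator_of_notMem hG, zero_mul]
    exact zero_le

theorem ofReal_rate (h𝓔 : 𝓔.Standing) (h : ParametrizedGraph 𝓔 ρ L τ θ Θ) :
    ∀ᵐ r, ENNReal.ofReal (𝓔.rate τ Θ θ r) = 𝓔.slopeFun τ Θ θ r * ‖deriv θ r‖ₑ := by
  filter_upwards [h.ae_mul_le h𝓔] with r hr
  exact ENNReal.ofReal_toReal (hr.trans_lt ENNReal.ofReal_lt_top).ne

theorem measurable_rate (h𝓔 : 𝓔.Standing) (h : ParametrizedGraph 𝓔 ρ L τ θ Θ) :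
    Measurable (𝓔.rate τ Θ θ) :=
  ((h.measurable_slopeFun h𝓔).mul (stronglyMeasurable_deriv θ).enorm).ennreal_toReal

theorem rate_le (h𝓔 : 𝓔.Standing) (hL : 0 < L) (h : ParametrizedGraph 𝓔 ρ L τ θ Θ) :
    ∀ᵐ r, 𝓔.rate τ Θ θ r ≤ L := by
  filter_upwards [h.ae_mul_le h𝓔] with r hr
  exact ENNReal.toReal_le_of_le_ofReal hL.le hr

theorem locallyIntegrable_rate (h𝓔 : 𝓔.Standing) (hL : 0 < L)
    (h : ParametrizedGraph 𝓔 ρ L τ θ Θ) : LocallyIntegrable (𝓔.rate τ Θ θ) volume := by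
  refine (locallyIntegrable_const L).mono (h.measurable_rate h𝓔).aestronglyMeasurable ?_
  filter_upwards [h.rate_le h𝓔 hL] with r hr
  rw [Real.norm_of_nonneg (rate_nonneg r), Real.norm_of_nonneg hL.le]
  exact hr

theorem intervalIntegrable_rate (h𝓔 : 𝓔.Standing) (hL : 0 < L)
    (h : ParametrizedGraph 𝓔 ρ L τ θ Θ) (a b : ℝ) :
    IntervalIntegrable (𝓔.rate τ Θ θ) volume a b :=
  ((h.locallyIntegrable_rate h𝓔 hL).integrableOn_isCompact isCompact_uIcc).intervalIntegrable

theorem dissip_sub (h𝓔 : 𝓔.Standing) (hL : 0 < L) (h : ParametrizedGraph 𝓔 ρ L τ θ Θ) (a b : ℝ) :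
    𝓔.dissip τ Θ θ b - 𝓔.dissip τ Θ θ a = ∫ r in a..b, 𝓔.rate τ Θ θ r :=
  intervalIntegral.integral_interval_sub_left (h.intervalIntegrable_rate h𝓔 hL _ _)
    (h.intervalIntegrable_rate h𝓔 hL _ _)

theorem dissip_mono (h𝓔 : 𝓔.Standing) (hL : 0 < L) (h : ParametrizedGraph 𝓔 ρ L τ θ Θ) :
    Monotone (𝓔.dissip τ Θ θ) := fun a b hab => by
  rw [← sub_nonneg, h.dissip_sub h𝓔 hL]
  exact intervalIntegral.integral_nonneg hab fun r _ => rate_nonneg r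

theorem abs_dissip_sub_le (h𝓔 : 𝓔.Standing) (hL : 0 < L) (h : ParametrizedGraph 𝓔 ρ L τ θ Θ)
    (a b : ℝ) : |𝓔.dissip τ Θ θ b - 𝓔.dissip τ Θ θ a| ≤ L * |b - a| := by
  rw [h.dissip_sub h𝓔 hL, ← Real.norm_eq_abs]
  refine intervalIntegral.norm_integral_le_of_norm_le_const_ae ?_
  filter_upwards [h.rate_le h𝓔 hL] with r hr _
  rwa [Real.norm_of_nonneg (rate_nonneg r)]

theorem hasDerivAt_dissip (h𝓔 : 𝓔.Standing) (hL : 0 < L) (h : ParametrizedGraph 𝓔 ρ L τ θ Θ) :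
    ∀ᵐ r, HasDerivAt (𝓔.dissip τ Θ θ) (𝓔.rate τ Θ θ r) r := by
  filter_upwards [_root_.LocallyIntegrable.ae_hasDerivAt_integral
    (h.locallyIntegrable_rate h𝓔 hL)] with r hr
  exact hr 0

theorem lintegral_eq_ofReal_dissip (h𝓔 : 𝓔.Standing) (hL : 0 < L)
    (h : ParametrizedGraph 𝓔 ρ L τ θ Θ) :
    ∫⁻ r in 𝓔.graphG τ Θ, 𝓔.slope (τ r) (θ r) * ‖deriv θ r‖ₑ
      = ENNReal.ofReal (𝓔.dissip τ Θ θ 1) := by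
  rw [dissip, intervalIntegral.integral_of_le zero_le_one, ← integral_Icc_eq_integral_Ioc,
    ofReal_integral_eq_lintegral_ofReal
      ((h.locallyIntegrable_rate h𝓔 hL).integrableOn_isCompact isCompact_Icc)
      (Eventually.of_forall fun r => rate_nonneg r)]
  rw [lintegral_congr_ae ((ae_restrict_of_ae (h.ofReal_rate h𝓔))),
    ← lintegral_indicator (h.measurableSet_graphG h𝓔), ← lintegral_indicator measurableSet_Icc]
  refine lintegral_congr fun r => ?_
  by_cases hG : r ∈ 𝓔.graphG τ Θ
  · rw [indicator_of_mem hG, indicator_of_mem hG.1, slopeFun, indicator_of_mem hG]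
  · rw [indicator_of_notMem hG]
    by_cases hI : r ∈ Icc (0 : ℝ) 1
    · rw [indicator_of_mem hI, slopeFun, indicator_of_notMem hG, zero_mul]
    · rw [indicator_of_notMem hI]

theorem eventually_mem_graphG (h𝓔 : 𝓔.Standing) (h : ParametrizedGraph 𝓔 ρ L τ θ Θ) {r : ℝ}
    (hr : r ∈ 𝓔.graphG τ Θ) (hr' : r ∈ Ioo (0 : ℝ) 1) : ∀ᶠ x in 𝓝 r, x ∈ 𝓔.graphG τ Θ := by
  have := h.lowerSemicontinuousOn h𝓔 r hr.1 0 ((h.mem_graphG_iff h𝓔).1 hr)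
  rw [nhdsWithin_eq_nhds.2 (Icc_mem_nhds hr'.1 hr'.2)] at this
  exact this.mono fun x hx => (h.mem_graphG_iff h𝓔).2 hx

variable [TopologicalSpace.SeparableSpace H]

/-- A positive lower bound on the slope keeps the interval inside the noncritical set, where `θ` is
Lipschitz; integrate `M ‖θ'‖ ≤ rate`. -/
theorem mul_norm_sub_le (h𝓔 : 𝓔.Standing) (hL : 0 < L) (h : ParametrizedGraph 𝓔 ρ L τ θ Θ)
    {a b M : ℝ} (hM : 0 < M)
    (hS : ∀ x ∈ uIcc a b, ENNReal.ofReal M ≤ 𝓔.slopeFun τ Θ θ x) :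
    M * ‖θ b - θ a‖ ≤ |𝓔.dissip τ Θ θ b - 𝓔.dissip τ Θ θ a| := by
  wlog hab : a ≤ b generalizing a b
  · rw [norm_sub_rev, abs_sub_comm]
    exact this (fun x hx => hS x (uIcc_comm a b ▸ hx)) (le_of_not_ge hab)
  rw [uIcc_of_le hab] at hS
  have hG : Icc a b ⊆ 𝓔.graphG τ Θ := fun x hx =>
    (h.mem_graphG_iff h𝓔).2 ((ENNReal.ofReal_pos.2 hM).trans_le (hS x hx))
  obtain ⟨K, hK⟩ := h.exists_lipschitzOnWith hG
  rw [h.dissip_sub h𝓔 hL]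
  refine le_trans ?_ (le_abs_self _)
  calc M * ‖θ b - θ a‖ ≤ M * ∫ r in a..b, ‖deriv θ r‖ :=
        mul_le_mul_of_nonneg_left (hK.norm_sub_le_integral_norm_deriv hab) hM.le
    _ = ∫ r in a..b, M * ‖deriv θ r‖ := (intervalIntegral.integral_const_mul _ _).symm
    _ ≤ ∫ r in a..b, 𝓔.rate τ Θ θ r := by
        have hle : ∀ᵐ r ∂(volume.restrict (Icc a b)), M * ‖deriv θ r‖ ≤ 𝓔.rate τ Θ θ r := by
          rw [ae_restrict_iff' measurableSet_Icc]
          filter_upwards [h.ofReal_rate h𝓔] with r hr hrab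
          rw [← ENNReal.ofReal_le_ofReal_iff (rate_nonneg r), hr, ENNReal.ofReal_mul hM.le,
            ofReal_norm]
          gcongr
          exact hS r hrab
        refine intervalIntegral.integral_mono_ae_restrict hab ?_
          (h.intervalIntegrable_rate h𝓔 hL a b) hle
        refine (h.intervalIntegrable_rate h𝓔 hL a b).mono_fun
          ((stronglyMeasurable_deriv θ).norm.const_mul M).aestronglyMeasurable ?_
        rw [uIoc_of_le hab]
        filter_upwards [ae_restrict_of_ae_restrict_of_subset Ioc_subset_Icc_self hle] with r hr
        rwa [Real.norm_of_nonneg (by positivity), Real.norm_of_nonneg (rate_nonneg r)]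

theorem ae_differentiableAt_curve (h𝓔 : 𝓔.Standing) (h : ParametrizedGraph 𝓔 ρ L τ θ Θ) :
    ∀ᵐ r, r ∈ 𝓔.graphG τ Θ → r ∈ Ioo (0 : ℝ) 1 → DifferentiableAt ℝ θ r := by
  -- Each compact interval has its own null set; rational end points keep their number countable.
  have hall : ∀ᵐ r, ∀ p q : ℚ, Icc (p : ℝ) q ⊆ 𝓔.graphG τ Θ → r ∈ Ioo (p : ℝ) q →
      DifferentiableAt ℝ θ r := by
    refine ae_all_iff.2 fun p => ae_all_iff.2 fun q => ?_
    by_cases hpq : Icc (p : ℝ) q ⊆ 𝓔.graphG τ Θ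
    · obtain ⟨K, hK⟩ := h.exists_lipschitzOnWith hpq
      filter_upwards [hK.ae_differentiableAt_curve] with r hr _ hr'
      exact hr hr'
    · exact Eventually.of_forall fun r hr => absurd hr hpq
  filter_upwards [hall] with r hr hG hI
  obtain ⟨a, b, hab, hsub⟩ := mem_nhds_iff_exists_Ioo_subset.1 (h.eventually_mem_graphG h𝓔 hG hI)
  obtain ⟨p, hp, hp'⟩ := exists_rat_btwn hab.1
  obtain ⟨q, hq, hq'⟩ := exists_rat_btwn hab.2
  exact hr p q ((Icc_subset_Ioo hp hq').trans hsub) ⟨hp', hq⟩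

/-- The energy changes at most at the rate given by the power and by slope times speed. -/
theorem ae_abs_deriv_en_le (h𝓔 : 𝓔.Standing) (hL : 0 < L) (h : ParametrizedGraph 𝓔 ρ L τ θ Θ)
    {K : ℝ} (hK : ∀ u ∈ 𝓔.sublevel ρ, ∀ s ∈ Icc 0 𝓔.T, ∀ s' ∈ Icc 0 𝓔.T,
      |𝓔.en s u - 𝓔.en s' u| ≤ K * |s - s'|) :
    ∀ᵐ r, r ∈ 𝓔.graphG τ Θ → DifferentiableAt ℝ (fun r => 𝓔.en (τ r) (θ r)) r ∧
      |deriv (fun r => 𝓔.en (τ r) (θ r)) r| ≤ K * deriv τ r + 𝓔.rate τ Θ θ r := by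
  obtain ⟨lam, hlam, hsub⟩ := h𝓔.exists_mem_subdiff_iff
  obtain ⟨lam', hlam', hle⟩ := h𝓔.exists_en_le
  obtain ⟨K1, hK1⟩ := h.lip
  obtain ⟨K2, hK2⟩ := h.en_lip
  have hends : ∀ᵐ r : ℝ, r ≠ 0 ∧ r ≠ 1 := by
    filter_upwards [compl_mem_ae_iff.2 (measure_singleton (0 : ℝ)),
      compl_mem_ae_iff.2 (measure_singleton (1 : ℝ))] with r h0 h1
    exact ⟨h0, h1⟩
  filter_upwards [hends, hK1.ae_differentiableAt_curve, hK2.ae_differentiableAt_curve,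
    h.ae_differentiableAt_curve h𝓔, h.hasDerivAt_dissip h𝓔 hL] with r hr01 hτ he hθ hψ hG
  have hI : r ∈ Ioo (0 : ℝ) 1 := ⟨lt_of_le_of_ne hG.1.1 hr01.1.symm, lt_of_le_of_ne hG.1.2 hr01.2⟩
  replace hτ := (hτ hI).hasDerivAt
  replace he := he hI
  replace hθ := (hθ hG hI).hasDerivAt
  refine ⟨he, ?_⟩
  replace he := he.hasDerivAt
  set e : ℝ → ℝ := fun r => 𝓔.en (τ r) (θ r) with he_def
  set e' := deriv e r
  set τ' := deriv τ r
  set θ' := deriv θ r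
  have hnear : ∀ᶠ x in 𝓝 r, x ∈ Icc (0 : ℝ) 1 := Icc_mem_nhds hI.1 hI.2
  have hsq : HasDerivAt (fun x => ‖θ x - θ r‖ ^ 2) 0 r := by
    have := (hθ.sub_const (θ r)).norm_sq
    simpa using this
  have htime : ∀ x ∈ Icc (0 : ℝ) 1, ∀ y ∈ Icc (0 : ℝ) 1, ∀ z ∈ Icc (0 : ℝ) 1,
      |𝓔.en (τ x) (θ z) - 𝓔.en (τ y) (θ z)| ≤ K * |τ x - τ y| := fun x hx y hy z hz =>
    hK _ (h.mem_sublevel hz) _ (h.maps hx) _ (h.maps hy)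
  -- With infinite slope there may be no subgradient at `θ r`. As `e` is already differentiable at
  -- `r`, it suffices to bound `e x - e r` from above at points `x ≠ r` arbitrarily close to `r` on
  -- each side, and `exists_ne_argmin` provides them.
  rcases eq_or_ne (𝓔.slopeFun τ Θ θ r) ∞ with htop | htop
  · have hargmin : ∀ y ∈ Icc (0 : ℝ) 1, y ≠ r → ∃ x ∈ uIcc r y, x ≠ r ∧
        e x - e r ≤ K * |τ x - τ r| + |𝓔.dissip τ Θ θ x - 𝓔.dissip τ Θ θ r|
          + lam' / 2 * ‖θ x - θ r‖ ^ 2 := by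
      intro y hy hyr
      have hsubI : uIcc r y ⊆ Icc (0 : ℝ) 1 := uIcc_subset_Icc hG.1 hy
      obtain ⟨x, hx, hxr, -, hx'⟩ := exists_ne_argmin (θ := θ) (ψ := 𝓔.dissip τ Θ θ)
        ((h.lowerSemicontinuousOn h𝓔).mono hsubI)
        htop hyr.symm (fun x hx M hM hz => h.mul_norm_sub_le h𝓔 hL hM hz)
      refine ⟨x, hx, hxr, ?_⟩
      have h1 := (abs_le.1 (htime x (hsubI hx) r hG.1 r hG.1)).2
      rcases hx' with ⟨hxtop, hx'⟩ | hx'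
      · have h2 := hle _ (h.maps (hsubI hx)) (θ x) (θ r) (h.mem_sublevel hG.1).1
          (𝓔.slopeFun τ Θ θ x).toReal ENNReal.toReal_nonneg
          (by rw [ENNReal.ofReal_toReal hxtop, h.slopeFun_eq (hsubI hx)])
        rw [norm_sub_rev (θ r) (θ x)] at h2
        simp only [he_def]
        linarith
      · simp only [he_def, hx', sub_self, norm_zero]
        have := abs_nonneg (𝓔.dissip τ Θ θ x - 𝓔.dissip τ Θ θ r)
        linarith
    -- Since `τ` and the dissipation are monotone, the sign `σ = 1` on the right and `σ = -1` on the
    -- left replaces the absolute values by a differentiable expression.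
    have hq : ∀ σ : ℝ, HasDerivAt (fun x => σ * (K * (τ x - τ r)
        + (𝓔.dissip τ Θ θ x - 𝓔.dissip τ Θ θ r)) + lam' / 2 * ‖θ x - θ r‖ ^ 2 - (e x - e r))
        (σ * (K * τ' + 𝓔.rate τ Θ θ r) + lam' / 2 * 0 - e') r := fun σ =>
      ((((hτ.sub_const _).const_mul K).add (hψ.sub_const _)).const_mul σ).add
        (hsq.const_mul _) |>.sub (he.sub_const _)
    have hmono := h.dissip_mono h𝓔 hL
    rw [abs_le]
    constructor
    · have h1 := (hq (-1)).nonpos_of_frequently_nhdsLT (by simp) (by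
        rw [frequently_nhdsWithin_iff, Metric.nhds_basis_ball.frequently_iff]
        intro ε hε
        obtain ⟨y, hy, hyr⟩ := exists_between (max_lt hI.1 (sub_lt_self r hε))
        obtain ⟨x, hx, hxr, hxe⟩ := hargmin y
          ⟨((le_max_left _ _).trans_lt hy).le, hyr.le.trans hG.1.2⟩ hyr.ne
        rw [uIcc_of_ge hyr.le] at hx
        have hlt : x < r := lt_of_le_of_ne hx.2 hxr
        have hxI : x ∈ Icc (0 : ℝ) 1 :=
          ⟨((le_max_left _ _).trans_lt hy).le.trans hx.1, hlt.le.trans hG.1.2⟩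
        refine ⟨x, ?_, ?_, hlt⟩
        · rw [Metric.mem_ball, Real.dist_eq, abs_lt]
          constructor <;> linarith [hx.1, (le_max_right _ _).trans_lt hy]
        · rw [abs_of_nonpos (sub_nonpos.2 (h.mono hxI hG.1 hlt.le)),
            abs_of_nonpos (sub_nonpos.2 (hmono hlt.le))] at hxe
          linarith)
      linarith
    · have h1 := (hq 1).nonneg_of_frequently_nhdsGT (by simp) (by
        rw [frequently_nhdsWithin_iff, Metric.nhds_basis_ball.frequently_iff]
        intro ε hε
        obtain ⟨y, hyr, hy⟩ := exists_between (lt_min hI.2 (lt_add_of_pos_right r hε))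
        obtain ⟨x, hx, hxr, hxe⟩ := hargmin y
          ⟨hG.1.1.trans hyr.le, (hy.trans_le (min_le_left _ _)).le⟩ hyr.ne'
        rw [uIcc_of_le hyr.le] at hx
        have hlt : r < x := lt_of_le_of_ne hx.1 hxr.symm
        have hxI : x ∈ Icc (0 : ℝ) 1 :=
          ⟨hG.1.1.trans hlt.le, hx.2.trans (hy.trans_le (min_le_left _ _)).le⟩
        refine ⟨x, ?_, ?_, hlt⟩
        · rw [Metric.mem_ball, Real.dist_eq, abs_lt]
          constructor <;> linarith [hx.2, hy.trans_le (min_le_right _ _)]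
        · rw [abs_of_nonneg (sub_nonneg.2 (h.mono hG.1 hxI hlt.le)),
            abs_of_nonneg (sub_nonneg.2 (hmono hlt.le))] at hxe
          linarith)
      linarith
  -- A subgradient bounds `e x - e r` from below on both sides of `r`, which bounds `e'` from above
  -- and below. The minimal norm is then approached up to `ε`.
  · have hξ : ∀ ξ ∈ 𝓔.subdiff (τ r) (θ r), |e'| ≤ K * τ' + ‖ξ‖ * ‖θ'‖ := by
      intro ξ hξ
      have hq : ∀ σ : ℝ, HasDerivAt (fun x => e x - e r + σ * (K * (τ x - τ r))
          - inner ℝ ξ (θ x - θ r) + lam / 2 * ‖θ x - θ r‖ ^ 2)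
          (e' + σ * (K * τ') - inner ℝ ξ θ' + lam / 2 * 0) r := fun σ =>
        (((he.sub_const _).add (((hτ.sub_const _).const_mul K).const_mul σ)).sub
          ((innerSL ℝ ξ).hasFDerivAt.comp_hasDerivAt r (hθ.sub_const (θ r)))).add (hsq.const_mul _)
      have hbelow : ∀ x ∈ Icc (0 : ℝ) 1, 0 ≤ e x - e r + K * |τ x - τ r|
          - inner ℝ ξ (θ x - θ r) + lam / 2 * ‖θ x - θ r‖ ^ 2 := by
        intro x hx
        have h1 := ((hsub _ (h.maps hG.1) _ _).1 hξ).2 (θ x) (h.mem_sublevel hx).1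
        have h2 := (abs_le.1 (htime x hx r hG.1 x hx)).1
        simp only [he_def]
        linarith
      have hR := (hq 1).nonneg_of_frequently_nhdsGT (by simp) (by
        refine Eventually.frequently ?_
        filter_upwards [hnear.filter_mono nhdsWithin_le_nhds, self_mem_nhdsWithin] with x hx hlt
        have := hbelow x hx
        rw [abs_of_nonneg (sub_nonneg.2 (h.mono hG.1 hx (le_of_lt hlt)))] at this
        linarith)
      have hLf := (hq (-1)).nonpos_of_frequently_nhdsLT (by simp) (by
        refine Eventually.frequently ?_
        filter_upwards [hnear.filter_mono nhdsWithin_le_nhds, self_mem_nhdsWithin] with x hx hlt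
        have := hbelow x hx
        rw [abs_of_nonpos (sub_nonpos.2 (h.mono hx hG.1 (le_of_lt hlt)))] at this
        linarith)
      have h3 := abs_le.1 (abs_real_inner_le_norm ξ θ')
      rw [abs_le]
      constructor <;> linarith
    have hlim : Tendsto (fun ε : ℝ => K * τ' + ((𝓔.slopeFun τ Θ θ r).toReal + ε) * ‖θ'‖) (𝓝[>] 0)
        (𝓝 (K * τ' + ((𝓔.slopeFun τ Θ θ r).toReal + 0) * ‖θ'‖)) :=
      (Continuous.tendsto (by fun_prop) 0).mono_left nhdsWithin_le_nhds
    have hrate : 𝓔.rate τ Θ θ r = (𝓔.slopeFun τ Θ θ r).toReal * ‖θ'‖ := by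
      rw [rate, ENNReal.toReal_mul, toReal_enorm]
    rw [hrate]
    rw [add_zero] at hlim
    refine ge_of_tendsto hlim (eventually_mem_nhdsWithin.mono fun ε (hε : 0 < ε) => ?_)
    have hlt : 𝓔.slope (τ r) (θ r) < ENNReal.ofReal ((𝓔.slopeFun τ Θ θ r).toReal + ε) := by
      rw [← h.slopeFun_eq hG.1, ENNReal.lt_ofReal_iff_toReal_lt htop]
      linarith
    simp only [slope, iInf_lt_iff] at hlt
    obtain ⟨ξ, hξmem, hξlt⟩ := hlt
    refine (hξ ξ hξmem).trans ?_
    gcongr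
    rw [← ofReal_norm] at hξlt
    exact ((ENNReal.ofReal_lt_ofReal_iff (by positivity)).1 hξlt).le

end ParametrizedGraph

end EnergyFunctional

/-! ### Compactness for Γ-convergence on subsets of the line. -/

section GammaCompactness

/-- The infimum of `S` over the part of `A` in the interval `(p.1, p.2)`. -/
noncomputable def intervalInf (A : Set ℝ) (S : ℝ → ℝ≥0∞) (p : ℚ × ℚ) : ℝ≥0∞ :=
  ⨅ x ∈ A ∩ Ioo (p.1 : ℝ) p.2, S x

/-- The lower semicontinuous function built from interval infima. -/
noncomputable def lscOfInf (m : ℚ × ℚ → ℝ≥0∞) (r : ℝ) : ℝ≥0∞ :=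
  ⨆ p : ℚ × ℚ, ⨆ _ : r ∈ Ioo (p.1 : ℝ) p.2, m p

theorem lt_lscOfInf_iff {m : ℚ × ℚ → ℝ≥0∞} {r : ℝ} {c : ℝ≥0∞} :
    c < lscOfInf m r ↔ ∃ p : ℚ × ℚ, r ∈ Ioo (p.1 : ℝ) p.2 ∧ c < m p := by
  simp only [lscOfInf, lt_iSup_iff, exists_prop]

theorem lowerSemicontinuous_lscOfInf (m : ℚ × ℚ → ℝ≥0∞) : LowerSemicontinuous (lscOfInf m) := by
  intro r c hc
  obtain ⟨p, hp, hcp⟩ := lt_lscOfInf_iff.1 hc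
  filter_upwards [Ioo_mem_nhds hp.1 hp.2] with x hx
  exact lt_lscOfInf_iff.2 ⟨p, hx, hcp⟩

variable {A : Set ℝ} {S : ℕ → ℝ → ℝ≥0∞} {m : ℚ × ℚ → ℝ≥0∞}

/-- The lower Γ-inequality in a form uniform near `r`: one rational interval around `r` works for
all large `n`. -/
theorem eventually_lt_of_lt_lscOfInf
    (hm : ∀ p, Tendsto (fun n => intervalInf A (S n) p) atTop (𝓝 (m p))) {r : ℝ} {c : ℝ≥0∞}
    (hc : c < lscOfInf m r) : ∀ᶠ q in atTop ×ˢ 𝓝[A] r, c < S q.1 q.2 := by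
  obtain ⟨p, hp, hcp⟩ := lt_lscOfInf_iff.1 hc
  filter_upwards [((hm p).eventually_const_lt hcp).prod_mk
    (inter_mem_nhdsWithin A (Ioo_mem_nhds hp.1 hp.2))] with q hq
  exact hq.1.trans_le (iInf₂_le q.2 hq.2)

/-- Take near-minimizers of the distance to `r` plus the truncated excess of `S n` over the limit
value; the lower inequality gives the other half. -/
theorem exists_recovery_seq
    (hm : ∀ p, Tendsto (fun n => intervalInf A (S n) p) atTop (𝓝 (m p))) {r : ℝ} (hr : r ∈ A) :
    ∃ x : ℕ → ℝ, (∀ n, x n ∈ A) ∧ Tendsto x atTop (𝓝 r) ∧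
      Tendsto (fun n => S n (x n)) atTop (𝓝 (lscOfInf m r)) := by
  have hlow : ∀ x : ℕ → ℝ, (∀ n, x n ∈ A) → Tendsto x atTop (𝓝 r) → ∀ c < lscOfInf m r,
      ∀ᶠ n in atTop, c < S n (x n) := fun x hxA hx c hc =>
    (tendsto_id.prodMk (tendsto_nhdsWithin_iff.2
      ⟨hx, Eventually.of_forall hxA⟩)).eventually (eventually_lt_of_lt_lscOfInf hm hc)
  -- For an infinite value the lower inequality alone makes the constant sequence a recovery
  -- sequence.
  rcases eq_or_ne (lscOfInf m r) ∞ with htop | htop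
  · refine ⟨fun _ => r, fun _ => hr, tendsto_const_nhds, tendsto_order.2
      ⟨hlow _ (fun _ => hr) tendsto_const_nhds, fun c hc => ?_⟩⟩
    exact absurd (htop ▸ hc) (not_lt.2 le_top)
  have key : ∀ ε : ℝ≥0∞, 0 < ε → ∀ᶠ n in atTop, ∃ x ∈ A,
      edist x r + (S n x - lscOfInf m r) ≤ ε := by
    intro ε hε
    have hε2 : 0 < ε / 2 := ENNReal.half_pos hε.ne'
    obtain ⟨δ, hδ, hδε⟩ := Metric.mem_nhds_iff.1 (Metric.eball_mem_nhds r hε2)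
    obtain ⟨p, hp, hp'⟩ := exists_rat_btwn (sub_lt_self r hδ)
    obtain ⟨q, hq, hq'⟩ := exists_rat_btwn (lt_add_of_pos_right r hδ)
    have hmle : m (p, q) < lscOfInf m r + ε / 2 := by
      refine lt_of_le_of_lt ?_ (ENNReal.lt_add_right htop hε2.ne')
      exact le_iSup₂_of_le (p, q) ⟨hp', hq⟩ le_rfl
    filter_upwards [(hm (p, q)).eventually_lt_const hmle] with n hn
    simp only [intervalInf, iInf_lt_iff] at hn
    obtain ⟨x, ⟨hxA, hx⟩, hxn⟩ := hn
    refine ⟨x, hxA, ?_⟩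
    have h1 : edist x r < ε / 2 := by
      refine hδε ?_
      rw [Metric.mem_ball, Real.dist_eq, abs_lt]
      constructor
      · linarith [hx.1]
      · linarith [hx.2]
    have h2 : S n x - lscOfInf m r ≤ ε / 2 := tsub_le_iff_left.2 hxn.le
    exact (add_le_add h1.le h2).trans_eq (ENNReal.add_halves ε)
  set F : ℕ → ℝ≥0∞ := fun n => ⨅ x ∈ A, edist x r + (S n x - lscOfInf m r) with hF
  have hF0 : Tendsto F atTop (𝓝 0) := by
    refine ENNReal.tendsto_nhds_zero.2 fun ε hε => (key ε hε).mono fun n ⟨x, hxA, hx⟩ => ?_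
    exact (iInf₂_le x hxA).trans hx
  have hpos : ∀ n : ℕ, (0 : ℝ≥0∞) < ((n : ℝ≥0∞))⁻¹ := fun n =>
    ENNReal.inv_pos.2 (ENNReal.natCast_ne_top n)
  -- At `n = 0` the tolerance is `∞`, which is harmless.
  have hex : ∀ n, ∃ x ∈ A, edist x r + (S n x - lscOfInf m r) ≤ F n + ((n : ℝ≥0∞))⁻¹ := by
    intro n
    rcases eq_or_ne (F n) ∞ with h | h
    · exact ⟨r, hr, by rw [h, top_add]; exact le_top⟩
    · have hlt : F n < F n + ((n : ℝ≥0∞))⁻¹ := ENNReal.lt_add_right h (hpos n).ne'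
      obtain ⟨x, hx⟩ := iInf_lt_iff.1 hlt
      obtain ⟨hxA, hx⟩ := iInf_lt_iff.1 hx
      exact ⟨x, hxA, hx.le⟩
  choose x hxA hx using hex
  have hval : Tendsto (fun n => edist (x n) r + (S n (x n) - lscOfInf m r)) atTop (𝓝 0) := by
    have := hF0.add ENNReal.tendsto_inv_nat_nhds_zero
    rw [add_zero] at this
    exact tendsto_of_tendsto_of_tendsto_of_le_of_le tendsto_const_nhds this
      (fun n => zero_le) hx
  have hxr : Tendsto x atTop (𝓝 r) := by
    refine tendsto_iff_edist_tendsto_0.2 ?_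
    exact tendsto_of_tendsto_of_tendsto_of_le_of_le tendsto_const_nhds hval
      (fun n => zero_le) (fun n => le_self_add)
  refine ⟨x, hxA, hxr, tendsto_order.2 ⟨hlow x hxA hxr, fun c hc => ?_⟩⟩
  have hup : Tendsto (fun n => lscOfInf m r + (edist (x n) r + (S n (x n) - lscOfInf m r))) atTop
      (𝓝 (lscOfInf m r)) := by
    simpa using (tendsto_const_nhds (x := lscOfInf m r)).add hval
  filter_upwards [hup.eventually_lt_const hc] with n hn
  exact (tsub_le_iff_left.1 le_add_self).trans_lt hn

end GammaCompactness

/-! ### Hausdorff convergence, Kuratowski convergence and sections. -/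

section HausdorffLimits

variable {X : Type*} [MetricSpace X]

variable {F : ℕ → Set X} {A : Set X}

theorem tendsto_infEDist_of_hausdorffEDist
    (hF : Tendsto (fun n => Metric.hausdorffEDist (F n) A) atTop (𝓝 0)) (x : X) :
    Tendsto (fun n => Metric.infEDist x (F n)) atTop (𝓝 (Metric.infEDist x A)) := by
  have h1 : ∀ n, Metric.infEDist x (F n) ≤ Metric.infEDist x A + Metric.hausdorffEDist (F n) A :=
    fun n => by
      rw [Metric.hausdorffEDist_comm]
      exact Metric.infEDist_le_infEDist_add_hausdorffEDist
  have h2 : ∀ n, Metric.infEDist x A - Metric.hausdorffEDist (F n) A ≤ Metric.infEDist x (F n) :=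
    fun n => tsub_le_iff_right.2 Metric.infEDist_le_infEDist_add_hausdorffEDist
  have hlow : Tendsto (fun n => Metric.infEDist x A - Metric.hausdorffEDist (F n) A) atTop
      (𝓝 (Metric.infEDist x A)) := by
    have := ENNReal.Tendsto.sub (tendsto_const_nhds (x := Metric.infEDist x A)) hF
      (Or.inr ENNReal.zero_ne_top)
    simpa using this
  have hup : Tendsto (fun n => Metric.infEDist x A + Metric.hausdorffEDist (F n) A) atTop
      (𝓝 (Metric.infEDist x A)) := by
    simpa using (tendsto_const_nhds (x := Metric.infEDist x A)).add hF
  exact tendsto_of_tendsto_of_tendsto_of_le_of_le hlow hup h2 h1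

theorem kuratowskiTendsto_of_hausdorffEDist (hA : IsClosed A)
    (hF : Tendsto (fun n => Metric.hausdorffEDist (F n) A) atTop (𝓝 0)) :
    KuratowskiTendsto F A := by
  have h := tendsto_infEDist_of_hausdorffEDist hF
  constructor
  · ext x
    rw [kuratowskiLi, mem_ofPred_eq, (h x).limsup_eq, ← Metric.mem_iff_infEDist_zero_of_closed hA]
  · ext x
    rw [kuratowskiLs, mem_ofPred_eq, (h x).liminf_eq, ← Metric.mem_iff_infEDist_zero_of_closed hA]

theorem exists_seq_tendsto_of_hausdorffEDist (hne : ∀ n, (F n).Nonempty)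
    (hF : Tendsto (fun n => Metric.hausdorffEDist (F n) A) atTop (𝓝 0)) {x : X} (hx : x ∈ A) :
    ∃ q : ℕ → X, (∀ n, q n ∈ F n) ∧ Tendsto q atTop (𝓝 x) := by
  have h := tendsto_infEDist_of_hausdorffEDist hF x
  rw [Metric.infEDist_zero_of_mem hx] at h
  have hex : ∀ n : ℕ, ∃ y ∈ F n, edist x y ≤ Metric.infEDist x (F n) + ((n : ℝ≥0∞))⁻¹ := by
    intro n
    have hlt : Metric.infEDist x (F n) < Metric.infEDist x (F n) + ((n : ℝ≥0∞))⁻¹ :=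
      ENNReal.lt_add_right (Metric.infEDist_ne_top (hne n))
        (ENNReal.inv_pos.2 (ENNReal.natCast_ne_top n)).ne'
    obtain ⟨y, hy, hxy⟩ := Metric.infEDist_lt_iff.1 hlt
    exact ⟨y, hy, hxy.le⟩
  choose q hq hxq using hex
  refine ⟨q, hq, tendsto_iff_edist_tendsto_0.2 ?_⟩
  have := h.add ENNReal.tendsto_inv_nat_nhds_zero
  rw [add_zero] at this
  exact tendsto_of_tendsto_of_tendsto_of_le_of_le tendsto_const_nhds this
    (fun n => zero_le) (fun n => by rw [edist_comm]; exact hxq n)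

/-- Semicontinuity jointly in `n` and the parameter: `A` lies in the open set of points outside a
thin slab over `r` or with second component in `V`, and so do all late `F n`. -/
theorem eventually_fiber_subset_of_hausdorffEDist {F : ℕ → Set (ℝ × X)} {A : Set (ℝ × X)}
    (hA : IsCompact A) (hF : Tendsto (fun n => Metric.hausdorffEDist (F n) A) atTop (𝓝 0))
    {r : ℝ} {V : Set X} (hV : IsOpen V) (hr : fiber A r ⊆ V) :
    ∀ᶠ q in atTop ×ˢ 𝓝 r, fiber (F q.1) q.2 ⊆ V := by
  obtain ⟨δ, hδ, hδV⟩ := Metric.eventually_nhds_iff.1 (hA.eventually_fiber_subset hV hr)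
  set W : Set (ℝ × X) := (Metric.closedBall r (δ / 2))ᶜ ×ˢ univ ∪ univ ×ˢ V
  have hW : IsOpen W :=
    (Metric.isClosed_closedBall.isOpen_compl.prod isOpen_univ).union (isOpen_univ.prod hV)
  have hAW : A ⊆ W := by
    rintro ⟨r', x⟩ hx
    by_cases h : r' ∈ Metric.closedBall r (δ / 2)
    · refine Or.inr ⟨mem_univ _, hδV ?_ hx⟩
      exact (Metric.mem_closedBall.1 h).trans_lt (half_lt_self hδ)
    · exact Or.inl ⟨h, mem_univ _⟩
  obtain ⟨ε, hε, hεW⟩ := hA.exists_thickening_subset_open hW hAW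
  have hFW : ∀ᶠ n in atTop, F n ⊆ W := by
    filter_upwards [hF.eventually_lt_const (ENNReal.ofReal_pos.2 hε)] with n hn x hx
    refine hεW ?_
    exact (Metric.infEDist_le_hausdorffEDist_of_mem hx).trans_lt hn
  filter_upwards [hFW.prod_mk (Metric.closedBall_mem_nhds r (half_pos hδ))] with q hq x hx
  rcases hq.1 hx with h | h
  · exact absurd hq.2 h.1
  · exact h.2

end HausdorffLimits

/-! ### Joint extraction of limits, and connectedness over an interval. -/

theorem exists_tendsto_of_tendsto_rat {ψ : ℕ → ℝ → ℝ} {L : ℝ} (hL : 0 < L)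
    (hψ : ∀ n a b, |ψ n b - ψ n a| ≤ L * |b - a|)
    (hq : ∀ q : ℚ, ∃ y, Tendsto (fun n => ψ n q) atTop (𝓝 y)) (r : ℝ) :
    ∃ y, Tendsto (fun n => ψ n r) atTop (𝓝 y) := by
  refine cauchySeq_tendsto_of_complete (Metric.cauchySeq_iff'.2 fun ε hε => ?_)
  obtain ⟨q, hq1, hq2⟩ := exists_rat_btwn (lt_add_of_pos_right r
    (show 0 < ε / (4 * L) by positivity))
  obtain ⟨y, hy⟩ := hq q
  obtain ⟨N, hN⟩ := Metric.cauchySeq_iff'.1 hy.cauchySeq (ε / 4) (by positivity)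
  refine ⟨N, fun n hn => ?_⟩
  have h1 : ∀ k, |ψ k q - ψ k r| ≤ ε / 4 := fun k => by
    refine (hψ k r q).trans ?_
    rw [abs_of_pos (sub_pos.2 hq1), ← le_div_iff₀' hL, div_div]
    linarith
  have h2 := hN n hn
  rw [Real.dist_eq] at h2 ⊢
  have h3 := abs_le.1 (h1 n)
  have h4 := abs_le.1 (h1 N)
  rw [abs_lt] at h2 ⊢
  constructor <;> linarith

/-- Joint convergence of slope functions, graphs and dissipation functions on `[0, 1]`. -/
structure GraphLimit {X : Type*} [MetricSpace X] (S : ℕ → ℝ → ℝ≥0∞) (Θ : ℕ → Set (ℝ × X))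
    (ψ : ℕ → ℝ → ℝ) (S₀ : ℝ → ℝ≥0∞) (Θ₀ : Set (ℝ × X)) (ψ₀ : ℝ → ℝ) : Prop where
  lsc : LowerSemicontinuous S₀
  eventually_lt : ∀ r, ∀ c < S₀ r, ∀ᶠ q in atTop ×ˢ 𝓝[Icc 0 1] r, c < S q.1 q.2
  recovery : ∀ r ∈ Icc (0 : ℝ) 1, ∃ x : ℕ → ℝ, (∀ n, x n ∈ Icc (0 : ℝ) 1) ∧
    Tendsto x atTop (𝓝 r) ∧ Tendsto (fun n => S n (x n)) atTop (𝓝 (S₀ r))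
  compact : IsCompact Θ₀
  kuratowski : KuratowskiTendsto Θ Θ₀
  upper : ∀ r, ∀ V, IsOpen V → fiber Θ₀ r ⊆ V → ∀ᶠ q in atTop ×ˢ 𝓝 r, fiber (Θ q.1) q.2 ⊆ V
  lower : ∀ p ∈ Θ₀, ∃ q : ℕ → ℝ × X, (∀ n, q n ∈ Θ n) ∧ Tendsto q atTop (𝓝 p)
  dissip : ∀ r, Tendsto (fun n => ψ n r) atTop (𝓝 (ψ₀ r))

/-- Encode the data in one compact metrizable product: a closed subset of `C`, the infima of `S n`
on rational intervals, and the values of `ψ n` at rationals. A single extraction then suffices. -/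
theorem exists_subseq_graphLimit {X : Type*} [MetricSpace X] (S : ℕ → ℝ → ℝ≥0∞)
    {Θ : ℕ → Set (ℝ × X)} {ψ : ℕ → ℝ → ℝ} {C : Set (ℝ × X)} (hC : IsCompact C)
    (hΘC : ∀ n, Θ n ⊆ C) (hΘ : ∀ n, IsCompact (Θ n)) (hne : ∀ n, (Θ n).Nonempty) {L : ℝ}
    (hL : 0 < L) (hψ : ∀ n a b, |ψ n b - ψ n a| ≤ L * |b - a|) (hψ0 : ∀ n, ψ n 0 = 0) :
    ∃ (φ : ℕ → ℕ) (S₀ : ℝ → ℝ≥0∞) (Θ₀ : Set (ℝ × X)) (ψ₀ : ℝ → ℝ), StrictMono φ ∧ Θ₀ ⊆ C ∧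
      GraphLimit (fun n => S (φ n)) (fun n => Θ (φ n)) (fun n => ψ (φ n)) S₀ Θ₀ ψ₀ := by
  have : CompactSpace C := isCompact_iff_compactSpace.1 hC
  have hψq : ∀ n (q : ℚ), ψ n q ∈ Icc (-(L * |(q : ℝ)|)) (L * |(q : ℝ)|) := fun n q => by
    have := hψ n 0 q
    rw [hψ0, sub_zero, sub_zero] at this
    exact abs_le.1 this
  let Z : ℕ → TopologicalSpace.Closeds C × (ℚ × ℚ → ℝ≥0∞) ×
      ((q : ℚ) → Icc (-(L * |(q : ℝ)|)) (L * |(q : ℝ)|)) := fun n =>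
    (⟨Subtype.val ⁻¹' Θ n, (hΘ n).isClosed.preimage continuous_subtype_val⟩,
      intervalInf (Icc 0 1) (S n), fun q => ⟨ψ n q, hψq n q⟩)
  obtain ⟨⟨A, m, y⟩, φ, hφ, hlim⟩ := CompactSpace.tendsto_subseq Z
  have hlimA := (continuous_fst.tendsto _).comp hlim
  have hlimm := (continuous_fst.tendsto _).comp ((continuous_snd.tendsto _).comp hlim)
  have hlimy := (continuous_snd.tendsto _).comp ((continuous_snd.tendsto _).comp hlim)
  have hm : ∀ p, Tendsto (fun n => intervalInf (Icc 0 1) (S (φ n)) p) atTop (𝓝 (m p)) := fun p =>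
    (tendsto_pi_nhds.1 hlimm) p
  have hy : ∀ q : ℚ, Tendsto (fun n => ψ (φ n) q) atTop (𝓝 (y q)) := fun q =>
    (continuous_subtype_val.tendsto _).comp ((tendsto_pi_nhds.1 hlimy) q)
  choose ψ₀ hψ₀ using exists_tendsto_of_tendsto_rat (ψ := fun n => ψ (φ n)) hL
    (fun n => hψ (φ n)) (fun q => ⟨_, hy q⟩)
  have hA : IsCompact (Subtype.val '' (A : Set C)) :=
    A.isClosed.isCompact.image continuous_subtype_val
  have hH : Tendsto (fun n => Metric.hausdorffEDist (Θ (φ n)) (Subtype.val '' (A : Set C))) atTop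
      (𝓝 0) := by
    have := tendsto_iff_edist_tendsto_0.1 hlimA
    refine this.congr fun n => ?_
    change Metric.hausdorffEDist (Subtype.val ⁻¹' Θ (φ n) : Set C) (A : Set C) = _
    rw [← Metric.hausdorffEDist_image (Φ := Subtype.val) isometry_subtype_coe,
      Subtype.image_preimage_coe, inter_eq_right.2 (hΘC _)]
  exact ⟨φ, lscOfInf m, Subtype.val '' (A : Set C), ψ₀, hφ, by rintro _ ⟨x, -, rfl⟩; exact x.2,
    { lsc := lowerSemicontinuous_lscOfInf m
      eventually_lt := fun r c hc => eventually_lt_of_lt_lscOfInf hm hc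
      recovery := fun r hr => exists_recovery_seq hm hr
      compact := hA
      kuratowski := kuratowskiTendsto_of_hausdorffEDist hA.isClosed hH
      upper := fun r V hV hr => eventually_fiber_subset_of_hausdorffEDist hA hH hV hr
      lower := fun p hp => exists_seq_tendsto_of_hausdorffEDist (fun n => hne _) hH hp
      dissip := hψ₀ }⟩

/-- A compact set with connected sections over an interval is connected. -/
theorem IsCompact.isPreconnected_of_fiber {X : Type*} [TopologicalSpace X] [T2Space X]
    {K : Set (ℝ × X)} (hK : IsCompact K) {I : Set ℝ} (hI : IsPreconnected I)
    (hproj : Prod.fst '' K = I) (hfib : ∀ r, IsPreconnected (fiber K r)) : IsPreconnected K := by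
  refine isPreconnected_closed_iff.2 fun A B hA hB hAB hKA hKB => ?_
  have hcA : IsClosed (Prod.fst '' (K ∩ A)) := ((hK.inter_right hA).image continuous_fst).isClosed
  have hcB : IsClosed (Prod.fst '' (K ∩ B)) := ((hK.inter_right hB).image continuous_fst).isClosed
  have hcov : I ⊆ Prod.fst '' (K ∩ A) ∪ Prod.fst '' (K ∩ B) := by
    rw [← image_union, ← inter_union_distrib_left, inter_eq_left.2 hAB, hproj]
  have hneA : (I ∩ Prod.fst '' (K ∩ A)).Nonempty := by
    rw [← hproj, inter_eq_right.2 (image_mono inter_subset_left)]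
    exact hKA.image _
  have hneB : (I ∩ Prod.fst '' (K ∩ B)).Nonempty := by
    rw [← hproj, inter_eq_right.2 (image_mono inter_subset_left)]
    exact hKB.image _
  obtain ⟨r, -, ⟨⟨r₁, x⟩, ⟨hx, hxA⟩, hr₁⟩, ⟨⟨r₂, y⟩, ⟨hy, hyB⟩, hr₂⟩⟩ :=
    isPreconnected_closed_iff.1 hI _ _ hcA hcB hcov hneA hneB
  simp only at hr₁ hr₂
  subst hr₁ hr₂
  have hmk : Continuous fun z : X => (r₂, z) := by fun_prop
  obtain ⟨z, hz, hzA, hzB⟩ := isPreconnected_closed_iff.1 (hfib r₂) _ _ (hA.preimage hmk)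
    (hB.preimage hmk) (fun z hz => hAB hz) ⟨x, hx, hxA⟩ ⟨y, hy, hyB⟩
  exact ⟨(r₂, z), hz, hzA, hzB⟩

theorem GraphLimit.fiber_nonempty {X : Type*} [MetricSpace X] {S : ℕ → ℝ → ℝ≥0∞}
    {Θ : ℕ → Set (ℝ × X)} {ψ : ℕ → ℝ → ℝ} {S₀ : ℝ → ℝ≥0∞} {Θ₀ : Set (ℝ × X)} {ψ₀ : ℝ → ℝ}
    (h : GraphLimit S Θ ψ S₀ Θ₀ ψ₀) {r : ℝ} (hr : ∀ n, (fiber (Θ n) r).Nonempty) :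
    (fiber Θ₀ r).Nonempty := by
  by_contra hcon
  rw [not_nonempty_iff_eq_empty] at hcon
  have h1 : Tendsto (fun n : ℕ => (n, r)) atTop (atTop ×ˢ 𝓝 r) :=
    tendsto_id.prodMk tendsto_const_nhds
  obtain ⟨n, hn⟩ := (h1.eventually (h.upper r ∅ isOpen_empty hcon.subset)).exists
  exact (hr n).ne_empty (subset_empty_iff.1 hn)

theorem IsCompact.isCompact_fiber {X : Type*} [TopologicalSpace X] [T2Space X]
    {K : Set (ℝ × X)} (hK : IsCompact K) (r : ℝ) : IsCompact (fiber K r) := by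
  refine (hK.image continuous_snd).of_isClosed_subset
    (hK.isClosed.preimage (by fun_prop : Continuous fun x : X => (r, x))) ?_
  exact fun x hx => ⟨(r, x), hx, rfl⟩

/-! ### Sections of the limit graph. -/

namespace EnergyFunctional

variable {H : Type*} [NormedAddCommGroup H] [InnerProductSpace ℝ H] {𝓔 : EnergyFunctional H}

namespace ParametrizedGraph

variable {ρ L : ℝ} {τ : ℝ → ℝ} {θ : ℝ → H} {Θ : Set (ℝ × H)}

theorem isPreconnected_restrict (h : ParametrizedGraph 𝓔 ρ L τ θ Θ) {a b : ℝ}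
    (ha : a ∈ Icc (0 : ℝ) 1) (hb : b ∈ Icc (0 : ℝ) 1) :
    IsPreconnected (Θ ∩ uIcc a b ×ˢ univ) := by
  refine IsCompact.isPreconnected_of_fiber (I := uIcc a b)
    (h.compact.inter_right (isClosed_Icc.prod isClosed_univ)) isPreconnected_uIcc
    (subset_antisymm ?_ ?_) (fun r => ?_)
  · rintro _ ⟨p, hp, rfl⟩
    exact hp.2.1
  · exact fun r hr => ⟨(r, θ r), ⟨h.mem r (uIcc_subset_Icc ha hb hr), hr, mem_univ _⟩, rfl⟩
  · by_cases hr : r ∈ uIcc a b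
    · have : fiber (Θ ∩ uIcc a b ×ˢ univ) r = fiber Θ r := by
        ext x
        simp [fiber, hr]
      rw [this]
      exact h.conn.2 r
    · have : fiber (Θ ∩ uIcc a b ×ˢ univ) r = ∅ := by
        ext x
        simp [fiber, hr]
      rw [this]
      exact isPreconnected_empty

variable [CompleteSpace H] [TopologicalSpace.SeparableSpace H]

/-- A graph cannot leave quickly a region where the slope is large. -/
theorem mul_le_of_slope_gt (h𝓔 : 𝓔.Standing) (hL : 0 < L) (h : ParametrizedGraph 𝓔 ρ L τ θ Θ)
    {c ε s r : ℝ} {y y' : H} (hc : 0 < c)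
    (hslope : ∀ x ∈ Icc (0 : ℝ) 1, ∀ u ∈ 𝓔.dom, ‖u - y‖ < 2 * ε →
      ENNReal.ofReal c < 𝓔.slope (τ x) u)
    (hy' : y' ∈ fiber Θ s) (hyε : ‖y' - y‖ < ε) (hr : r ∈ Icc (0 : ℝ) 1)
    (hS : 𝓔.slopeFun τ Θ θ r ≤ ENNReal.ofReal c) : ε * c ≤ L * |r - s| := by
  by_contra! hcon
  have hs : s ∈ Icc (0 : ℝ) 1 := (h.subset hy').1
  have hε : 0 < ε := (norm_nonneg _).trans_lt hyε
  have hsubI : uIcc s r ⊆ Icc (0 : ℝ) 1 := uIcc_subset_Icc hs hr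
  have hfact : ∀ x ∈ Icc (0 : ℝ) 1, ∀ u ∈ fiber Θ x, ‖u - y‖ < 2 * ε →
      ENNReal.ofReal c < 𝓔.slopeFun τ Θ θ x ∧ u = θ x := by
    intro x hx u hu huy
    have h1 := hslope x hx u (h.subset hu).2.1 huy
    have hG : x ∈ 𝓔.graphG τ Θ := by
      refine ⟨hx, u, hu, fun hcrit => ?_⟩
      rw [slope_eq_zero_of_mem_crit hcrit] at h1
      exact not_lt_bot h1
    have huθ : u = θ x := by
      rw [h.single x hG] at hu
      exact hu
    rw [h.slopeFun_eq hx, ← huθ]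
    exact ⟨h1, rfl⟩
  obtain ⟨hSs, hy's⟩ := hfact s hs y' hy' (by linarith)
  have hB : IsCompact (uIcc s r ∩ 𝓔.slopeFun τ Θ θ ⁻¹' Iic (ENNReal.ofReal c)) :=
    ((h.lowerSemicontinuousOn h𝓔).mono hsubI).isCompact_inter_preimage_Iic isCompact_uIcc _
  -- `z` is the first parameter, going from `s` towards `r`, at which the slope is at most `c`;
  -- lower semicontinuity makes that set compact.
  obtain ⟨z, ⟨hz, hzc⟩, hzmin⟩ := hB.exists_isMinOn ⟨r, right_mem_uIcc, hS⟩
    (f := fun x => |x - s|) (by fun_prop)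
  have hzs : z ≠ s := fun hzs => absurd (hzs ▸ hzc) (not_le.2 hSs)
  have hzs' : 0 < |z - s| := abs_pos.2 (sub_ne_zero.2 hzs)
  have hzr : |z - s| ≤ |r - s| := abs_sub_left_of_mem_uIcc hz
  set p : ℝ → ℝ := fun k => s + k * (z - s) with hp
  have hps : ∀ k, |p k - s| = |k| * |z - s| := fun k => by
    rw [hp, ← abs_mul]; congr 1; ring
  have hpz : ∀ k ∈ Ioo (0 : ℝ) 1, p k ∈ uIcc s z := by
    intro k hk
    rcases le_total s z with hle | hle
    · rw [uIcc_of_le hle]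
      constructor <;> simp only [hp] <;> nlinarith [hk.1, hk.2]
    · rw [uIcc_of_ge hle]
      constructor <;> simp only [hp] <;> nlinarith [hk.1, hk.2]
  have hkey : ∀ k ∈ Ioo (0 : ℝ) 1, c * ‖θ (p k) - θ s‖ ≤ L * |r - s| := by
    intro k hk
    refine (h.mul_norm_sub_le h𝓔 hL hc fun x hx => ?_).trans
      ((h.abs_dissip_sub_le h𝓔 hL _ _).trans ?_)
    · by_contra hxc
      have hxB : x ∈ uIcc s r ∩ 𝓔.slopeFun τ Θ θ ⁻¹' Iic (ENNReal.ofReal c) :=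
        ⟨uIcc_subset_uIcc_left hz (uIcc_subset_uIcc_left (hpz k hk) hx), (not_le.1 hxc).le⟩
      have h1 : |z - s| ≤ |x - s| := hzmin hxB
      have h2 : |x - s| ≤ |p k - s| := abs_sub_left_of_mem_uIcc hx
      rw [hps, abs_of_pos hk.1] at h2
      nlinarith [hk.2]
    · refine mul_le_mul_of_nonneg_left ?_ hL.le
      rw [hps, abs_of_pos hk.1]
      nlinarith [hk.2, hk.1]
  -- Continuity of `θ` at `z` is not known. Compactness of the graph gives a limit `u` over `z` of
  -- the values before `z`; it is still within `2 * ε` of `y`, so the section is the point `u = θ z`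
  -- with slope above `c`, a contradiction.
  let g : Ultrafilter ℝ := Ultrafilter.of (𝓝[<] 1)
  have hg : (g : Filter ℝ) ≤ 𝓝[<] 1 := Ultrafilter.of_le _
  have hgI : ∀ᶠ k in (g : Filter ℝ), k ∈ Ioo (0 : ℝ) 1 := hg (Ioo_mem_nhdsLT one_pos)
  have hgp : Tendsto p g (𝓝 z) := by
    have : Tendsto p (𝓝 1) (𝓝 (p 1)) := Continuous.tendsto (by fun_prop) 1
    simp only [hp, one_mul, add_sub_cancel] at this
    exact this.mono_left (hg.trans nhdsWithin_le_nhds)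
  obtain ⟨⟨z', u⟩, hu, hlim⟩ := h.compact.ultrafilter_le_nhds (g.map fun k => (p k, θ (p k))) (by
    rw [Ultrafilter.coe_map, le_principal_iff, mem_map]
    filter_upwards [hgI] with k hk
    exact h.mem _ (hsubI (uIcc_subset_uIcc_left hz (hpz k hk))))
  rw [Ultrafilter.coe_map] at hlim
  have hlim1 : Tendsto p g (𝓝 z') := (continuous_fst.tendsto _).comp hlim
  have hlim2 : Tendsto (fun k => θ (p k)) g (𝓝 u) := (continuous_snd.tendsto _).comp hlim
  obtain rfl : z' = z := tendsto_nhds_unique hlim1 hgp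
  have hdist : c * ‖u - θ s‖ ≤ L * |r - s| :=
    le_of_tendsto ((hlim2.sub_const _).norm.const_mul c) (hgI.mono hkey)
  have hlt : ‖u - θ s‖ < ε := by nlinarith
  have huy : ‖u - y‖ < 2 * ε := by
    have := norm_sub_le_norm_sub_add_norm_sub u (θ s) y
    rw [← hy's] at this hlt
    linarith
  exact absurd (hfact z' (hsubI hz) u hu huy).1 (not_lt.2 hzc)

end ParametrizedGraph

/-- A limit of parametrized graphs at the time `t`, with a selection `ϑ` of the limit graph. -/
structure ApproxLimit (𝓔 : EnergyFunctional H) (t ρ L : ℝ) (τ : ℕ → ℝ → ℝ) (θ : ℕ → ℝ → H)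
    (Θ : ℕ → Set (ℝ × H)) (S₀ : ℝ → ℝ≥0∞) (Θ₀ : Set (ℝ × H)) (ψ₀ : ℝ → ℝ) (ϑ : ℝ → H) : Prop where
  standing : 𝓔.Standing
  lusin : 𝓔.FiberedLusin
  time_mem : t ∈ Icc 0 𝓔.T
  pos : 0 < L
  graph : ∀ n, ParametrizedGraph 𝓔 ρ L (τ n) (θ n) (Θ n)
  time : TendstoUniformlyOn τ (fun _ => t) atTop (Icc 0 1)
  subset : Θ₀ ⊆ Icc 0 1 ×ˢ 𝓔.sublevel ρ
  limit : GraphLimit (fun n => 𝓔.slopeFun (τ n) (Θ n) (θ n)) Θ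
    (fun n => 𝓔.dissip (τ n) (Θ n) (θ n)) S₀ Θ₀ ψ₀
  mem : ∀ r ∈ Icc (0 : ℝ) 1, ϑ r ∈ fiber Θ₀ r

namespace ApproxLimit

variable {t ρ L : ℝ} {τ : ℕ → ℝ → ℝ} {θ : ℕ → ℝ → H} {Θ : ℕ → Set (ℝ × H)} {S₀ : ℝ → ℝ≥0∞}
  {Θ₀ : Set (ℝ × H)} {ψ₀ : ℝ → ℝ} {ϑ : ℝ → H}

theorem tendsto_time (h : ApproxLimit 𝓔 t ρ L τ θ Θ S₀ Θ₀ ψ₀ ϑ) {ι : Type*} {l : Filter ι}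
    {n : ι → ℕ} (hn : Tendsto n l atTop) {x : ι → ℝ} (hx : ∀ᶠ i in l, x i ∈ Icc (0 : ℝ) 1) :
    Tendsto (fun i => τ (n i) (x i)) l (𝓝 t) := by
  rw [Metric.tendsto_nhds]
  intro ε hε
  filter_upwards [hn.eventually (Metric.tendstoUniformlyOn_iff.1 h.time ε hε), hx] with i hi hi'
  rw [dist_comm]
  exact hi _ hi'

theorem exists_tendsto (h : ApproxLimit 𝓔 t ρ L τ θ Θ S₀ Θ₀ ψ₀ ϑ) {ι : Type*} {g : Ultrafilter ι}
    {n : ι → ℕ} (hn : Tendsto n g atTop) {x : ι → ℝ} {r : ℝ} (hx : Tendsto x g (𝓝 r))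
    {u : ι → H} (hu : ∀ᶠ i in (g : Filter ι), u i ∈ fiber (Θ (n i)) (x i)) :
    ∃ u₀ ∈ fiber Θ₀ r, Tendsto u g (𝓝 u₀) := by
  obtain ⟨u₀, hu₀, hlim⟩ := (h.standing.isCompact_sublevel ρ).ultrafilter_le_nhds (g.map u) (by
    rw [Ultrafilter.coe_map, le_principal_iff, mem_map]
    filter_upwards [hu] with i hi
    exact ((h.graph _).subset hi).2)
  rw [Ultrafilter.coe_map] at hlim
  refine ⟨u₀, ?_, hlim⟩
  by_contra hcon
  obtain ⟨V, W, hV, hW, hVs, hWs, hVW⟩ := SeparatedNhds.of_isCompact_isCompact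
    (h.limit.compact.isCompact_fiber r) isCompact_singleton (disjoint_singleton_right.2 hcon)
  have h1 := (hn.prodMk hx).eventually (h.limit.upper r V hV hVs)
  have h2 := hlim (hW.mem_nhds (hWs rfl))
  obtain ⟨i, hi1, hi2, hi3⟩ := (h1.and (hu.and h2)).exists
  exact hVW.le_bot ⟨hi1 hi2, hi3⟩

/-- If the section split into two compact pieces, graph points close to the two pieces would be
joined by a connected part of `Θ n` over a short parameter interval; that part would lie in two
disjoint open sets and meet both. -/
theorem isPreconnected_fiber (h : ApproxLimit 𝓔 t ρ L τ θ Θ S₀ Θ₀ ψ₀ ϑ) (r : ℝ) :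
    IsPreconnected (fiber Θ₀ r) := by
  refine isPreconnected_closed_iff.2 fun A B hA hB hAB ⟨a, har, haA⟩ ⟨b, hbr, hbB⟩ => ?_
  by_contra hcon
  have hF := h.limit.compact.isCompact_fiber r
  have hdisj : Disjoint (fiber Θ₀ r ∩ A) (fiber Θ₀ r ∩ B) := by
    rw [Set.disjoint_iff]
    intro x hx
    exact hcon ⟨x, hx.1.1, hx.1.2, hx.2.2⟩
  obtain ⟨U, V, hU, hV, hUs, hVs, hUV⟩ := SeparatedNhds.of_isCompact_isCompact
    (hF.inter_right hA) (hF.inter_right hB) hdisj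
  have hup := h.limit.upper r (U ∪ V) (hU.union hV) fun x hx =>
    (hAB hx).imp (fun hxA => hUs ⟨hx, hxA⟩) (fun hxB => hVs ⟨hx, hxB⟩)
  obtain ⟨P, hP, Q, hQ, hPQ⟩ := eventually_prod_iff.1 hup
  obtain ⟨δ, hδ, hδQ⟩ := Metric.eventually_nhds_iff.1 hQ
  obtain ⟨q, hq, hqa⟩ := h.limit.lower (r, a) har
  obtain ⟨p, hp, hpb⟩ := h.limit.lower (r, b) hbr
  have hq1 : Tendsto (fun n => (q n).1) atTop (𝓝 r) := (continuous_fst.tendsto _).comp hqa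
  have hq2 : Tendsto (fun n => (q n).2) atTop (𝓝 a) := (continuous_snd.tendsto _).comp hqa
  have hp1 : Tendsto (fun n => (p n).1) atTop (𝓝 r) := (continuous_fst.tendsto _).comp hpb
  have hp2 : Tendsto (fun n => (p n).2) atTop (𝓝 b) := (continuous_snd.tendsto _).comp hpb
  obtain ⟨n, hn, hn1, hn2, hn3, hn4⟩ := (hP.and ((hq1.eventually (Metric.ball_mem_nhds r hδ)).and
    ((hp1.eventually (Metric.ball_mem_nhds r hδ)).and
      ((hq2.eventually (hU.mem_nhds (hUs ⟨har, haA⟩))).and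
        (hp2.eventually (hV.mem_nhds (hVs ⟨hbr, hbB⟩))))))).exists
  have hcon := (h.graph n).isPreconnected_restrict ((h.graph n).subset (hq n)).1
    ((h.graph n).subset (hp n)).1
  obtain ⟨⟨x, u⟩, -, ⟨-, hu1⟩, ⟨-, hu2⟩⟩ := hcon (univ ×ˢ U) (univ ×ˢ V) (isOpen_univ.prod hU)
    (isOpen_univ.prod hV) (by
      rintro ⟨x, u⟩ ⟨hxu, hx, -⟩
      have hxr : dist x r < δ := by
        have hconv : Convex ℝ (Metric.ball r δ) := convex_ball r δ
        have := (hconv.ordConnected).uIcc_subset hn1 hn2 hx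
        exact this
      exact (hPQ hn (hδQ hxr) hxu).imp (fun hh => ⟨mem_univ _, hh⟩) (fun hh => ⟨mem_univ _, hh⟩))
    ⟨q n, ⟨hq n, left_mem_uIcc, mem_univ _⟩, mem_univ _, hn3⟩
    ⟨p n, ⟨hp n, right_mem_uIcc, mem_univ _⟩, mem_univ _, hn4⟩
  exact hUV.le_bot ⟨hu1, hu2⟩

theorem eventually_forall_lt (h : ApproxLimit 𝓔 t ρ L τ θ Θ S₀ Θ₀ ψ₀ ϑ) {K : Set ℝ}
    (hK : IsCompact K) (hKI : K ⊆ Icc 0 1) {c : ℝ≥0∞} (hc : ∀ x ∈ K, c < S₀ x) :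
    ∀ᶠ n in atTop, ∀ x ∈ K, c < 𝓔.slopeFun (τ n) (Θ n) (θ n) x := by
  refine hK.induction_on (p := fun s => ∀ᶠ n in atTop, ∀ x ∈ s,
    c < 𝓔.slopeFun (τ n) (Θ n) (θ n) x) (by simp) (fun s s' hss' hs' => ?_)
    (fun s s' hs hs' => ?_) (fun x hx => ?_)
  · exact hs'.mono fun n hn x hx => hn x (hss' hx)
  · filter_upwards [hs, hs'] with n hn hn' x hx
    exact hx.elim (hn x) (hn' x)
  · obtain ⟨P, hP, Q, hQ, hPQ⟩ := eventually_prod_iff.1 (h.limit.eventually_lt x c (hc x hx))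
    exact ⟨_, nhdsWithin_mono x hKI hQ, hP.mono fun n hn y hy => hPQ hn hy⟩

variable [CompleteSpace H]

theorem abs_dissip_sub_le (h : ApproxLimit 𝓔 t ρ L τ θ Θ S₀ Θ₀ ψ₀ ϑ) (a b : ℝ) :
    |ψ₀ b - ψ₀ a| ≤ L * |b - a| :=
  le_of_tendsto ((h.limit.dissip b).sub (h.limit.dissip a)).abs
    (Eventually.of_forall fun n => (h.graph n).abs_dissip_sub_le h.standing h.pos a b)

theorem dissip_mono (h : ApproxLimit 𝓔 t ρ L τ θ Θ S₀ Θ₀ ψ₀ ϑ) : Monotone ψ₀ := fun a b hab =>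
  le_of_tendsto_of_tendsto' (h.limit.dissip a) (h.limit.dissip b) fun n =>
    (h.graph n).dissip_mono h.standing h.pos hab

variable [TopologicalSpace.SeparableSpace H]

/-- Near `r` the approximating slopes stay above some `M > 0`: sections are points and the curves
are `L / M`-Lipschitz, so graph points with parameters tending to `r` cannot have different limits.
-/
theorem fiber_eq (h : ApproxLimit 𝓔 t ρ L τ θ Θ S₀ Θ₀ ψ₀ ϑ) {r : ℝ} (hr : r ∈ Icc (0 : ℝ) 1)
    (hS : 0 < S₀ r) : fiber Θ₀ r = {ϑ r} := by
  refine subset_antisymm (fun x hx => ?_) (singleton_subset_iff.2 (h.mem r hr))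
  obtain ⟨M, hM0, hM⟩ : ∃ M : ℝ, 0 < M ∧ ENNReal.ofReal M < S₀ r := by
    obtain ⟨c, hc0, hc⟩ := exists_between hS
    exact ⟨c.toReal, ENNReal.toReal_pos hc0.ne' (hc.trans_le le_top).ne,
      by rwa [ENNReal.ofReal_toReal (hc.trans_le le_top).ne]⟩
  obtain ⟨P, hP, Q, hQ, hPQ⟩ := eventually_prod_iff.1 (h.limit.eventually_lt r _ hM)
  obtain ⟨δ, hδ, hδQ⟩ := Metric.mem_nhdsWithin_iff.1 hQ
  obtain ⟨q, hq, hqx⟩ := h.limit.lower (r, x) hx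
  obtain ⟨p, hp, hpy⟩ := h.limit.lower (r, ϑ r) (h.mem r hr)
  have hq1 : Tendsto (fun n => (q n).1) atTop (𝓝 r) := (continuous_fst.tendsto _).comp hqx
  have hq2 : Tendsto (fun n => (q n).2) atTop (𝓝 x) := (continuous_snd.tendsto _).comp hqx
  have hp1 : Tendsto (fun n => (p n).1) atTop (𝓝 r) := (continuous_fst.tendsto _).comp hpy
  have hp2 : Tendsto (fun n => (p n).2) atTop (𝓝 (ϑ r)) := (continuous_snd.tendsto _).comp hpy
  have hle : ∀ᶠ n in atTop, M * ‖(q n).2 - (p n).2‖ ≤ L * |(q n).1 - (p n).1| := by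
    filter_upwards [hP, hq1.eventually (Metric.ball_mem_nhds r hδ),
      hp1.eventually (Metric.ball_mem_nhds r hδ)] with n hn hnq hnp
    have hg := h.graph n
    have hqI := (hg.subset (hq n)).1
    have hpI := (hg.subset (hp n)).1
    have hlarge : ∀ y ∈ uIcc (p n).1 (q n).1,
        ENNReal.ofReal M < 𝓔.slopeFun (τ n) (Θ n) (θ n) y := fun y hy =>
      hPQ hn (hδQ ⟨(convex_ball r δ).ordConnected.uIcc_subset hnp hnq hy,
        uIcc_subset_Icc hpI hqI hy⟩)
    have hval : ∀ z ∈ Θ n, z.1 ∈ uIcc (p n).1 (q n).1 → z.2 = θ n z.1 := fun z hz hz' => by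
      have := hg.single z.1 ((hg.mem_graphG_iff h.standing).2 (pos_of_gt (hlarge _ hz')))
      have hz2 : z.2 ∈ fiber (Θ n) z.1 := hz
      rw [this] at hz2
      exact hz2
    rw [hval _ (hq n) right_mem_uIcc, hval _ (hp n) left_mem_uIcc]
    exact (hg.mul_norm_sub_le h.standing h.pos hM0 fun y hy => (hlarge y hy).le).trans
      (hg.abs_dissip_sub_le h.standing h.pos _ _)
  have hlim := le_of_tendsto_of_tendsto ((hq2.sub hp2).norm.const_mul M)
    ((hq1.sub hp1).abs.const_mul L) hle
  rw [sub_self, abs_zero, mul_zero] at hlim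
  have h0 : ‖x - ϑ r‖ ≤ 0 := by
    by_contra hpos
    push Not at hpos
    nlinarith [mul_pos hM0 hpos]
  exact sub_eq_zero.1 (norm_le_zero_iff.1 h0)

theorem tendsto_curve (h : ApproxLimit 𝓔 t ρ L τ θ Θ S₀ Θ₀ ψ₀ ϑ) {r : ℝ}
    (hr : r ∈ Icc (0 : ℝ) 1) (hS : 0 < S₀ r) :
    Tendsto (fun q : ℕ × ℝ => θ q.1 q.2) (atTop ×ˢ 𝓝[Icc 0 1] r) (𝓝 (ϑ r)) := by
  refine tendsto_nhds.2 fun V hV hVr => ?_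
  have h1 := (h.limit.upper r V hV (by
    rw [h.fiber_eq hr hS]; exact singleton_subset_iff.2 hVr)).filter_mono
    (Filter.prod_mono_right atTop (nhdsWithin_le_nhds (s := Icc 0 1)))
  have h2 : ∀ᶠ q : ℕ × ℝ in atTop ×ˢ 𝓝[Icc (0 : ℝ) 1] r, q.2 ∈ Icc (0 : ℝ) 1 :=
    tendsto_snd.eventually (eventually_mem_nhdsWithin (s := Icc (0 : ℝ) 1) (a := r))
  filter_upwards [h1, h2] with q hq hqI
  exact hq ((h.graph q.1).mem _ hqI)

theorem tendsto_selection (h : ApproxLimit 𝓔 t ρ L τ θ Θ S₀ Θ₀ ψ₀ ϑ) {r : ℝ}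
    (hr : r ∈ Icc (0 : ℝ) 1) (hS : 0 < S₀ r) : Tendsto ϑ (𝓝[Icc 0 1] r) (𝓝 (ϑ r)) := by
  refine tendsto_nhds.2 fun V hV hVr => ?_
  filter_upwards [(h.limit.compact.eventually_fiber_subset hV (by
    rw [h.fiber_eq hr hS]; exact singleton_subset_iff.2 hVr)).filter_mono nhdsWithin_le_nhds,
    self_mem_nhdsWithin] with x hx hxI
  exact hx (h.mem x hxI)

/-- For each `M' < M` the approximating slopes eventually exceed `M'` on the whole compact interval;
pass to the limit in `n`, then let `M'` increase to `M`. -/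
theorem mul_norm_sub_le (h : ApproxLimit 𝓔 t ρ L τ θ Θ S₀ Θ₀ ψ₀ ϑ) {a b M : ℝ}
    (ha : a ∈ Icc (0 : ℝ) 1) (hb : b ∈ Icc (0 : ℝ) 1) (hM : 0 < M)
    (hS : ∀ x ∈ uIcc a b, ENNReal.ofReal M ≤ S₀ x) :
    M * ‖ϑ b - ϑ a‖ ≤ |ψ₀ b - ψ₀ a| := by
  have hpos : ∀ x ∈ uIcc a b, 0 < S₀ x := fun x hx => (ENNReal.ofReal_pos.2 hM).trans_le (hS x hx)
  have hconv : ∀ x ∈ Icc (0 : ℝ) 1, 0 < S₀ x → Tendsto (fun n => θ n x) atTop (𝓝 (ϑ x)) :=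
    fun x hx hx' => (h.tendsto_curve hx hx').comp (tendsto_id.prodMk
      (tendsto_nhdsWithin_iff.2 ⟨tendsto_const_nhds, Eventually.of_forall fun _ => hx⟩))
  have key : ∀ M' ∈ Ioo 0 M, M' * ‖ϑ b - ϑ a‖ ≤ |ψ₀ b - ψ₀ a| := by
    intro M' hM'
    refine le_of_tendsto_of_tendsto (((hconv b hb (hpos b right_mem_uIcc)).sub
      (hconv a ha (hpos a left_mem_uIcc))).norm.const_mul M')
      ((h.limit.dissip b).sub (h.limit.dissip a)).abs ?_
    filter_upwards [h.eventually_forall_lt isCompact_uIcc (uIcc_subset_Icc ha hb)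
      (c := ENNReal.ofReal M') fun x hx =>
        ((ENNReal.ofReal_lt_ofReal_iff hM).2 hM'.2).trans_le (hS x hx)] with n hn
    exact (h.graph n).mul_norm_sub_le h.standing h.pos hM'.1 fun x hx => (hn x hx).le
  have hlim : Tendsto (fun M' : ℝ => M' * ‖ϑ b - ϑ a‖) (𝓝[<] M) (𝓝 (M * ‖ϑ b - ϑ a‖)) :=
    (Continuous.tendsto (by fun_prop) M).mono_left nhdsWithin_le_nhds
  exact le_of_tendsto hlim (eventually_of_mem (Ioo_mem_nhdsLT hM) key)

/-- At a noncritical `y` the slope exceeds some `c` near `(t, y)`. Graph points tending to `(r, y)`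
and a recovery sequence of vanishing slope have parameters at vanishing distance, against
`mul_le_of_slope_gt`. -/
theorem fiber_subset_crit (h : ApproxLimit 𝓔 t ρ L τ θ Θ S₀ Θ₀ ψ₀ ϑ) {r : ℝ}
    (hr : r ∈ Icc (0 : ℝ) 1) (hS : S₀ r = 0) : fiber Θ₀ r ⊆ 𝓔.crit t := by
  intro y hy
  by_contra hcrit
  have hydom : y ∈ 𝓔.dom := (h.subset hy).2.1
  rw [h.standing.mem_crit_iff h.time_mem] at hcrit
  obtain ⟨c, hc0, hc⟩ : ∃ c : ℝ, 0 < c ∧ ENNReal.ofReal c < 𝓔.slope t y := by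
    obtain ⟨c, hc0, hc⟩ := exists_between (pos_iff_ne_zero.2 hcrit)
    exact ⟨c.toReal, ENNReal.toReal_pos hc0.ne' (hc.trans_le le_top).ne,
      by rwa [ENNReal.ofReal_toReal (hc.trans_le le_top).ne]⟩
  have hev : ∀ᶠ q in 𝓝[Icc 0 𝓔.T] t ×ˢ 𝓝[𝓔.dom] y, ENNReal.ofReal c < 𝓔.slope q.1 q.2 := by
    refine h.standing.eventually_lt_slope (s := Prod.fst) (u := Prod.snd)
      (tendsto_fst.mono_right nhdsWithin_le_nhds) h.time_mem
      (tendsto_snd.mono_right nhdsWithin_le_nhds) hydom ?_ hc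
    exact tendsto_fst.eventually (eventually_mem_nhdsWithin (s := Icc 0 𝓔.T) (a := t))
  obtain ⟨P, hP, Q, hQ, hPQ⟩ := eventually_prod_iff.1 hev
  obtain ⟨η, hη, hηP⟩ := Metric.mem_nhdsWithin_iff.1 hP
  obtain ⟨δ, hδ, hδQ⟩ := Metric.mem_nhdsWithin_iff.1 hQ
  obtain ⟨x, hxI, hxr, hxS⟩ := h.limit.recovery r hr
  obtain ⟨q, hq, hqy⟩ := h.limit.lower (r, y) hy
  have hq1 : Tendsto (fun n => (q n).1) atTop (𝓝 r) := (continuous_fst.tendsto _).comp hqy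
  have hq2 : Tendsto (fun n => (q n).2) atTop (𝓝 y) := (continuous_snd.tendsto _).comp hqy
  have hgap : Tendsto (fun n => L * |x n - (q n).1|) atTop (𝓝 (L * |r - r|)) :=
    (hxr.sub hq1).abs.const_mul L
  rw [sub_self, abs_zero, mul_zero] at hgap
  rw [hS] at hxS
  obtain ⟨n, hn1, hn2, hn3, hn4⟩ := ((Metric.tendstoUniformlyOn_iff.1 h.time η hη).and
    ((hq2.eventually (Metric.ball_mem_nhds y (half_pos hδ))).and
      ((hgap.eventually_lt_const (show 0 < δ / 2 * c by positivity)).and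
        (hxS.eventually_lt_const (ENNReal.ofReal_pos.2 hc0))))).exists
  refine absurd ((h.graph n).mul_le_of_slope_gt h.standing h.pos (ε := δ / 2) hc0
    (fun z hz u hu huy => ?_) (hq n) (by rw [← dist_eq_norm]; exact hn2) (hxI n) hn4.le)
    (not_le.2 hn3)
  refine hPQ (hηP ⟨?_, (h.graph n).maps hz⟩) (hδQ ⟨?_, hu⟩)
  · rw [Metric.mem_ball, dist_comm]
    exact hn1 z hz
  · rw [Metric.mem_ball, dist_eq_norm]
    linarith

theorem slope_le (h : ApproxLimit 𝓔 t ρ L τ θ Θ S₀ Θ₀ ψ₀ ϑ) {r : ℝ}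
    (hr : r ∈ Icc (0 : ℝ) 1) : 𝓔.slope t (ϑ r) ≤ S₀ r := by
  rcases eq_or_ne (S₀ r) 0 with hS | hS
  · rw [slope_eq_zero_of_mem_crit (h.fiber_subset_crit hr hS (h.mem r hr))]
    exact zero_le
  obtain ⟨x, hxI, hxr, hxS⟩ := h.limit.recovery r hr
  refine le_of_forall_gt_imp_ge_of_dense fun c hc => ?_
  refine h.standing.slope_le_of_frequently
    (h.tendsto_time tendsto_id (Eventually.of_forall hxI)) h.time_mem
    ((h.tendsto_curve hr (pos_iff_ne_zero.2 hS)).comp (tendsto_id.prodMk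
      (tendsto_nhdsWithin_iff.2 ⟨hxr, Eventually.of_forall hxI⟩))) (h.subset (h.mem r hr)).2.1
    (Eventually.of_forall fun n => (h.graph n).maps (hxI n)) ?_
  refine ((hxS.eventually_lt_const hc).mono fun n hn => ?_).frequently
  rw [(h.graph n).slopeFun_eq (hxI n)] at hn
  exact hn.le

/-- This frees later arguments from tracking which point of a section a limit selects. -/
theorem en_eq (h : ApproxLimit 𝓔 t ρ L τ θ Θ S₀ Θ₀ ψ₀ ϑ) {r : ℝ} {x : H}
    (hx : x ∈ fiber Θ₀ r) : 𝓔.en t (ϑ r) = 𝓔.en t x := by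
  have hr : r ∈ Icc (0 : ℝ) 1 := (h.subset hx).1
  rcases eq_or_ne (S₀ r) 0 with hS | hS
  · exact h.standing.en_eq_of_isPreconnected h.lusin h.time_mem (h.isPreconnected_fiber r)
      (h.fiber_subset_crit hr hS) (h.mem r hr) hx
  · rw [h.fiber_eq hr (pos_iff_ne_zero.2 hS)] at hx
    rw [hx]

end ApproxLimit

end EnergyFunctional

/-! ### Oscillation and convergence of the energies. -/

namespace EnergyFunctional

variable {H : Type*} [NormedAddCommGroup H] [InnerProductSpace ℝ H] {𝓔 : EnergyFunctional H}
  [CompleteSpace H]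

theorem ParametrizedGraph.lintegral_deriv_le (h𝓔 : 𝓔.Standing) {ρ L : ℝ} {τ : ℝ → ℝ} {θ : ℝ → H}
    {Θ : Set (ℝ × H)} (hL : 0 < L) (h : ParametrizedGraph 𝓔 ρ L τ θ Θ) {K : ℝ} (hK : 0 ≤ K)
    {a b : ℝ} (ha : a ∈ Icc (0 : ℝ) 1) (hb : b ∈ Icc (0 : ℝ) 1) (hab : a ≤ b) :
    ∫⁻ r in Icc a b, ENNReal.ofReal (K * deriv τ r + 𝓔.rate τ Θ θ r) ≤
      ENNReal.ofReal (K * (τ b - τ a) + (𝓔.dissip τ Θ θ b - 𝓔.dissip τ Θ θ a)) := by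
  obtain ⟨K1, hK1⟩ := h.lip
  have hsub : uIcc a b ⊆ Icc (0 : ℝ) 1 := uIcc_subset_Icc ha hb
  have hac := (hK1.mono hsub).absolutelyContinuousOnInterval
  have hint := hac.intervalIntegrable_deriv
  have hrate := h.intervalIntegrable_rate h𝓔 hL a b
  have hnn : ∀ᵐ r ∂(volume.restrict (Icc a b)), 0 ≤ K * deriv τ r + 𝓔.rate τ Θ θ r := by
    rw [← restrict_Ioo_eq_restrict_Icc, ae_restrict_iff' measurableSet_Ioo]
    refine Eventually.of_forall fun r hr => ?_
    have h1 : 0 ≤ deriv τ r := by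
      rw [← derivWithin_of_mem_nhds (Icc_mem_nhds hr.1 hr.2)]
      exact ((h.mono.mono hsub).mono (uIcc_of_le hab).symm.subset).derivWithin_nonneg
    exact add_nonneg (mul_nonneg hK h1) (rate_nonneg r)
  have hsum := (hint.const_mul K).add hrate
  rw [← ofReal_integral_eq_lintegral_ofReal
    ((intervalIntegrable_iff_integrableOn_Icc_of_le hab).1 hsum) hnn]
  rw [integral_Icc_eq_integral_Ioc, ← intervalIntegral.integral_of_le hab,
    intervalIntegral.integral_add (hint.const_mul K) hrate, intervalIntegral.integral_const_mul,
    hac.integral_deriv_eq_sub, h.dissip_sub h𝓔 hL]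

namespace ApproxLimit

variable {t ρ L : ℝ} {τ : ℕ → ℝ → ℝ} {θ : ℕ → ℝ → H} {Θ : ℕ → Set (ℝ × H)} {S₀ : ℝ → ℝ≥0∞}
  {Θ₀ : Set (ℝ × H)} {ψ₀ : ℝ → ℝ} {ϑ : ℝ → H}

/-- Critical parameters violating the inclusion would accumulate at a point of the limit graph. Zero
slope passes to the limit and makes the energies converge to a critical value, which `W` contains.
-/
theorem eventually_en_mem (h : ApproxLimit 𝓔 t ρ L τ θ Θ S₀ Θ₀ ψ₀ ϑ) {W : Set ℝ} (hW : IsOpen W)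
    (hcW : 𝓔.en t '' 𝓔.crit t ⊆ W) : ∀ᶠ n in atTop, ∀ r ∈ Icc (0 : ℝ) 1,
      r ∉ 𝓔.graphG (τ n) (Θ n) → 𝓔.en (τ n r) (θ n r) ∈ W := by
  by_contra hcon
  rw [not_eventually] at hcon
  set B : Set ℕ := {n | ¬ ∀ r ∈ Icc (0 : ℝ) 1,
    r ∉ 𝓔.graphG (τ n) (Θ n) → 𝓔.en (τ n r) (θ n r) ∈ W}
  have hne : (atTop ⊓ 𝓟 B).NeBot := frequently_mem_iff_neBot.1 hcon
  let g : Ultrafilter ℕ := Ultrafilter.of (atTop ⊓ 𝓟 B)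
  have hg : (g : Filter ℕ) ≤ atTop ⊓ 𝓟 B := Ultrafilter.of_le _
  have hgt : Tendsto id (g : Filter ℕ) atTop := hg.trans inf_le_left
  have hgB : ∀ᶠ n in (g : Filter ℕ), n ∈ B := hg.trans inf_le_right (mem_principal_self _)
  have hex : ∀ n, ∃ r : ℝ, n ∈ B → r ∈ Icc (0 : ℝ) 1 ∧ r ∉ 𝓔.graphG (τ n) (Θ n) ∧
      𝓔.en (τ n r) (θ n r) ∉ W := by
    intro n
    by_cases hn : n ∈ B
    · have hn' := hn
      simp only [B, mem_ofPred_eq] at hn'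
      push Not at hn'
      obtain ⟨r, h1, h2, h3⟩ := hn'
      exact ⟨r, fun _ => ⟨h1, h2, h3⟩⟩
    · exact ⟨0, fun h => absurd h hn⟩
  choose r hr using hex
  have hrI : ∀ᶠ n in (g : Filter ℕ), r n ∈ Icc (0 : ℝ) 1 := hgB.mono fun n hn => (hr n hn).1
  obtain ⟨r₀, hr₀, hlim⟩ := isCompact_Icc.ultrafilter_le_nhds (g.map r) (by
    rw [Ultrafilter.coe_map, le_principal_iff, mem_map]
    exact hrI)
  rw [Ultrafilter.coe_map] at hlim
  obtain ⟨u₀, hu₀, hulim⟩ := h.exists_tendsto hgt hlim (u := fun n => θ n (r n))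
    (hrI.mono fun n hn => (h.graph n).mem _ hn)
  have hdom : u₀ ∈ 𝓔.dom := (h.subset hu₀).2.1
  have hτ := h.tendsto_time hgt hrI
  have hmaps : ∀ᶠ n in (g : Filter ℕ), τ n (r n) ∈ Icc 0 𝓔.T :=
    hrI.mono fun n hn => (h.graph n).maps hn
  have hslope : ∀ᶠ n in (g : Filter ℕ), 𝓔.slope (τ n (r n)) (θ n (r n)) ≤ 0 := by
    filter_upwards [hgB] with n hn
    rw [← (h.graph n).slopeFun_eq (hr n hn).1, slopeFun, indicator_of_notMem (hr n hn).2.1]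
  have hcrit : u₀ ∈ 𝓔.crit t := (h.standing.mem_crit_iff h.time_mem).2 (le_antisymm
    (h.standing.slope_le_of_frequently hτ h.time_mem hulim hdom hmaps hslope.frequently) zero_le)
  have hen := h.standing.tendsto_en hτ h.time_mem hulim hdom hmaps ENNReal.zero_ne_top hslope
  obtain ⟨n, hn, hn'⟩ := ((hen.eventually (hW.mem_nhds (hcW ⟨u₀, hcrit, rfl⟩))).and hgB).exists
  exact (hr n hn').2.2 hn

theorem tendsto_dissip (h : ApproxLimit 𝓔 t ρ L τ θ Θ S₀ Θ₀ ψ₀ ϑ) (r : ℝ) :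
    Tendsto ψ₀ (𝓝 r) (𝓝 (ψ₀ r)) := by
  refine tendsto_iff_dist_tendsto_zero.2 (squeeze_zero (fun _ => dist_nonneg)
    (fun x => (h.abs_dissip_sub_le r x)) ?_)
  have : Tendsto (fun x : ℝ => L * |x - r|) (𝓝 r) (𝓝 (L * |r - r|)) :=
    Continuous.tendsto (by fun_prop) r
  simpa using this

variable [TopologicalSpace.SeparableSpace H]

/-- The oscillation of the energies is asymptotically controlled by the dissipation. -/
theorem eventually_abs_en_sub_le (h : ApproxLimit 𝓔 t ρ L τ θ Θ S₀ Θ₀ ψ₀ ϑ) {ε : ℝ} (hε : 0 < ε) :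
    ∀ᶠ n in atTop, ∀ a ∈ Icc (0 : ℝ) 1, ∀ b ∈ Icc (0 : ℝ) 1,
      |𝓔.en (τ n b) (θ n b) - 𝓔.en (τ n a) (θ n a)| ≤
        |𝓔.dissip (τ n) (Θ n) (θ n) b - 𝓔.dissip (τ n) (Θ n) (θ n) a| + ε := by
  obtain ⟨K, hK0, hK⟩ := h.standing.exists_en_sub_le ρ
  obtain ⟨W, hcW, hW, hWε⟩ := (𝓔.en t '' 𝓔.crit t).exists_isOpen_lt_of_lt (μ := volume)
    (ENNReal.ofReal (ε / 2)) (by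
      rw [h.lusin t h.time_mem]
      exact ENNReal.ofReal_pos.2 (half_pos hε))
  -- Two time errors of this size, multiplied by `K`, cost at most `ε / 2`; the other half is the
  -- measure of `W`. The `+ 1` covers `K = 0`.
  have hδ : 0 < ε / (4 * (K + 1)) := by positivity
  filter_upwards [h.eventually_en_mem hW hcW, Metric.tendstoUniformlyOn_iff.1 h.time _ hδ]
    with n hn hτ a ha b hb
  wlog hab : a ≤ b generalizing a b
  · rw [abs_sub_comm, abs_sub_comm (𝓔.dissip _ _ _ b)]
    exact this b hb a ha (le_of_not_ge hab)
  have hg := h.graph n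
  set e : ℝ → ℝ := fun r => 𝓔.en (τ n r) (θ n r) with he
  obtain ⟨K2, hK2⟩ := hg.en_lip
  have hsub : Icc a b ⊆ Icc (0 : ℝ) 1 := Icc_subset_Icc ha.1 hb.2
  set A : Set ℝ := Icc a b ∩ 𝓔.graphG (τ n) (Θ n)
  have hA : MeasurableSet A := measurableSet_Icc.inter (hg.measurableSet_graphG h.standing)
  -- Every intermediate energy is attained, either at a noncritical parameter or, at a critical one,
  -- inside `W`.
  have hcover : uIcc (e a) (e b) ⊆ e '' A ∪ W := by
    intro y hy
    have hcont : ContinuousOn e (uIcc a b) := by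
      rw [uIcc_of_le hab]
      exact hK2.continuousOn.mono hsub
    obtain ⟨x, hx, rfl⟩ := intermediate_value_uIcc hcont hy
    rw [uIcc_of_le hab] at hx
    by_cases hG : x ∈ 𝓔.graphG (τ n) (Θ n)
    · exact Or.inl ⟨x, ⟨hx, hG⟩, rfl⟩
    · exact Or.inr (hn x (hsub hx) hG)
  have hvol : ENNReal.ofReal |e b - e a| ≤ ENNReal.ofReal (K * (τ n b - τ n a)
      + (𝓔.dissip (τ n) (Θ n) (θ n) b - 𝓔.dissip (τ n) (Θ n) (θ n) a))
      + ENNReal.ofReal (ε / 2) := by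
    calc ENNReal.ofReal |e b - e a| = volume (uIcc (e a) (e b)) := Real.volume_interval.symm
      _ ≤ volume (e '' A) + volume W := (measure_mono hcover).trans (measure_union_le _ _)
      _ ≤ _ := by
        refine add_le_add ?_ hWε.le
        refine ((hK2.mono (inter_subset_left.trans hsub)).volume_image_le_lintegral hA
          ((hg.ae_abs_deriv_en_le h.standing h.pos hK).mono fun r hr hrA => hr hrA.2)).trans ?_
        exact (lintegral_mono_set inter_subset_left).trans
          (hg.lintegral_deriv_le h.standing h.pos hK0 ha hb hab)
  have hψ : 0 ≤ 𝓔.dissip (τ n) (Θ n) (θ n) b - 𝓔.dissip (τ n) (Θ n) (θ n) a :=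
    sub_nonneg.2 (hg.dissip_mono h.standing h.pos hab)
  have hττ : 0 ≤ τ n b - τ n a := sub_nonneg.2 (hg.mono ha hb hab)
  rw [← ENNReal.ofReal_add (by positivity) (by positivity),
    ENNReal.ofReal_le_ofReal_iff (by positivity)] at hvol
  rw [abs_of_nonneg hψ]
  have h1 := hτ a ha
  have h2 := hτ b hb
  rw [Real.dist_eq, abs_lt] at h1 h2
  have h3 : K * (τ n b - τ n a) ≤ ε / 2 := by
    calc K * (τ n b - τ n a) ≤ (K + 1) * (2 * (ε / (4 * (K + 1)))) :=
          mul_le_mul (by linarith) (by linarith) hττ (by positivity)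
      _ = ε / 2 := by field_simp; ring
  linarith

/-- Along a recovery sequence slopes are bounded, hence energies converge; the oscillation estimate
transfers the limit from `x n` to `r`. -/
theorem tendsto_en (h : ApproxLimit 𝓔 t ρ L τ θ Θ S₀ Θ₀ ψ₀ ϑ) {r : ℝ} (hr : r ∈ Icc (0 : ℝ) 1)
    (hS : S₀ r < ∞) :
    Tendsto (fun n => 𝓔.en (τ n r) (θ n r)) atTop (𝓝 (𝓔.en t (ϑ r))) := by
  obtain ⟨x, hxI, hxr, hxS⟩ := h.limit.recovery r hr
  have h1 : Tendsto (fun n => 𝓔.en (τ n (x n)) (θ n (x n))) atTop (𝓝 (𝓔.en t (ϑ r))) := by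
    refine (tendsto_iff_ultrafilter _ _ _).2 fun g hg => ?_
    have hgt : Tendsto id (g : Filter ℕ) atTop := hg
    obtain ⟨u₀, hu₀, hulim⟩ := h.exists_tendsto hgt (hxr.mono_left hg) (u := fun n => θ n (x n))
      (Eventually.of_forall fun n => (h.graph n).mem _ (hxI n))
    rw [h.en_eq hu₀]
    refine h.standing.tendsto_en (h.tendsto_time hgt (Eventually.of_forall hxI)) h.time_mem hulim
      (h.subset hu₀).2.1 (Eventually.of_forall fun n => (h.graph n).maps (hxI n))
      (c := S₀ r + 1) (ENNReal.add_ne_top.2 ⟨hS.ne, ENNReal.one_ne_top⟩) ?_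
    filter_upwards [hg (hxS.eventually_lt_const (ENNReal.lt_add_right hS.ne one_ne_zero))]
      with n hn
    rw [← (h.graph n).slopeFun_eq (hxI n)]
    exact le_of_lt hn
  have h2 : Tendsto (fun n => 𝓔.en (τ n r) (θ n r) - 𝓔.en (τ n (x n)) (θ n (x n))) atTop
      (𝓝 0) := by
    rw [Metric.tendsto_nhds]
    intro ε hε
    have hgap : Tendsto (fun n => L * |r - x n|) atTop (𝓝 (L * |r - r|)) :=
      (tendsto_const_nhds.sub hxr).abs.const_mul L
    rw [sub_self, abs_zero, mul_zero] at hgap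
    filter_upwards [h.eventually_abs_en_sub_le (half_pos hε),
      hgap.eventually_lt_const (half_pos hε)] with n hn hn'
    rw [Real.dist_eq, sub_zero]
    have := hn (x n) (hxI n) r hr
    have := (h.graph n).abs_dissip_sub_le h.standing h.pos (x n) r
    linarith
  simpa using h2.add h1

theorem abs_en_sub_le_of_lt_top (h : ApproxLimit 𝓔 t ρ L τ θ Θ S₀ Θ₀ ψ₀ ϑ) {a b : ℝ}
    (ha : a ∈ Icc (0 : ℝ) 1) (hb : b ∈ Icc (0 : ℝ) 1) (hSa : S₀ a < ∞) (hSb : S₀ b < ∞) :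
    |𝓔.en t (ϑ b) - 𝓔.en t (ϑ a)| ≤ |ψ₀ b - ψ₀ a| := by
  refine le_of_forall_pos_le_add fun ε hε => ?_
  refine le_of_tendsto_of_tendsto ((h.tendsto_en hb hSb).sub (h.tendsto_en ha hSa)).abs
    (((h.limit.dissip b).sub (h.limit.dissip a)).abs.add_const ε) ?_
  exact (h.eventually_abs_en_sub_le hε).mono fun n hn => hn a ha b hb

/-- At a closure point with `S₀ r = ∞` the curve is continuous, but its energy a priori only lower
semicontinuous. Moving each approximating point to a minimizer of `S₀` between it and `r` bounds
slope times displacement by `L |c - r|`, which yields the upper bound. -/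
theorem exists_seq_tendsto_en (h : ApproxLimit 𝓔 t ρ L τ θ Θ S₀ Θ₀ ψ₀ ϑ) {r : ℝ}
    (hr : r ∈ closure {r | r ∈ Icc (0 : ℝ) 1 ∧ S₀ r < ∞}) :
    ∃ c : ℕ → ℝ, (∀ k, c k ∈ Icc (0 : ℝ) 1 ∧ S₀ (c k) < ∞) ∧ Tendsto c atTop (𝓝 r) ∧
      Tendsto (fun k => 𝓔.en t (ϑ (c k))) atTop (𝓝 (𝓔.en t (ϑ r))) := by
  have hrI : r ∈ Icc (0 : ℝ) 1 := closure_minimal (fun x hx => hx.1) isClosed_Icc hr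
  rcases (le_top : S₀ r ≤ ∞).lt_or_eq with hS | hS
  · exact ⟨fun _ => r, fun _ => ⟨hrI, hS⟩, tendsto_const_nhds, tendsto_const_nhds⟩
  obtain ⟨x, hx, hxr⟩ := mem_closure_iff_seq_limit.1 hr
  have hex : ∀ k, ∃ c ∈ uIcc r (x k), S₀ c < ∞ ∧
      (S₀ c).toReal * ‖ϑ c - ϑ r‖ ≤ L * |c - r| := by
    intro k
    have hne : r ≠ x k := fun hrx => (hx k).2.ne (hrx ▸ hS)
    obtain ⟨c, hc, -, hcS, hc'⟩ := exists_ne_argmin (θ := ϑ) (ψ := ψ₀)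
      (h.limit.lsc.lowerSemicontinuousOn _) hS hne fun y hy M hM hz =>
        h.mul_norm_sub_le hrI (uIcc_subset_Icc hrI (hx k).1 hy) hM hz
    refine ⟨c, hc, hcS.trans_lt (hx k).2, ?_⟩
    rcases hc' with ⟨-, hc'⟩ | hc'
    · exact hc'.trans (h.abs_dissip_sub_le _ _)
    · rw [hc', sub_self, norm_zero, mul_zero]
      exact mul_nonneg h.pos.le (abs_nonneg _)
  choose c hc hcS hcle using hex
  have hcI : ∀ k, c k ∈ Icc (0 : ℝ) 1 := fun k => uIcc_subset_Icc hrI (hx k).1 (hc k)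
  have hcr : Tendsto c atTop (𝓝 r) := by
    refine tendsto_iff_dist_tendsto_zero.2 (squeeze_zero (fun _ => dist_nonneg) (fun k => ?_)
      (tendsto_iff_dist_tendsto_zero.1 hxr))
    rw [Real.dist_eq, Real.dist_eq]
    exact abs_sub_left_of_mem_uIcc (hc k)
  refine ⟨c, fun k => ⟨hcI k, hcS k⟩, hcr, ?_⟩
  have hϑ : Tendsto (fun k => ϑ (c k)) atTop (𝓝 (ϑ r)) :=
    (h.tendsto_selection hrI (by rw [hS]; exact ENNReal.zero_lt_top)).comp
      (tendsto_nhdsWithin_iff.2 ⟨hcr, Eventually.of_forall hcI⟩)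
  have hdom : ∀ y ∈ Icc (0 : ℝ) 1, ϑ y ∈ 𝓔.dom := fun y hy => (h.subset (h.mem y hy)).2.1
  obtain ⟨lam, hlam, hle⟩ := h.standing.exists_en_le
  refine tendsto_order.2 ⟨fun a ha => h.standing.eventually_lt_en tendsto_const_nhds hϑ
    (Eventually.of_forall fun k => ⟨h.time_mem, hdom _ (hcI k)⟩) ha, fun a ha => ?_⟩
  have hup : Tendsto (fun k => 𝓔.en t (ϑ r) + L * |c k - r| + lam / 2 * ‖ϑ r - ϑ (c k)‖ ^ 2)
      atTop (𝓝 (𝓔.en t (ϑ r) + L * |r - r| + lam / 2 * ‖ϑ r - ϑ r‖ ^ 2)) :=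
    (tendsto_const_nhds.add ((hcr.sub_const r).abs.const_mul L)).add
      (((tendsto_const_nhds.sub hϑ).norm.pow 2).const_mul _)
  simp only [sub_self, norm_zero, abs_zero, mul_zero, add_zero, ne_eq, OfNat.ofNat_ne_zero,
    not_false_eq_true, zero_pow] at hup
  filter_upwards [hup.eventually_lt_const ha] with k hk
  refine lt_of_le_of_lt ?_ hk
  have := hle t h.time_mem (ϑ (c k)) (ϑ r) (hdom r hrI) (S₀ (c k)).toReal ENNReal.toReal_nonneg
    (by rw [ENNReal.ofReal_toReal (hcS k).ne]; exact h.slope_le (hcI k))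
  have h2 := hcle k
  rw [norm_sub_rev] at h2
  linarith

theorem abs_en_sub_le_of_mem_closure (h : ApproxLimit 𝓔 t ρ L τ θ Θ S₀ Θ₀ ψ₀ ϑ) {a b : ℝ}
    (ha : a ∈ closure {r | r ∈ Icc (0 : ℝ) 1 ∧ S₀ r < ∞})
    (hb : b ∈ closure {r | r ∈ Icc (0 : ℝ) 1 ∧ S₀ r < ∞}) :
    |𝓔.en t (ϑ b) - 𝓔.en t (ϑ a)| ≤ |ψ₀ b - ψ₀ a| := by
  obtain ⟨c, hc, hca, hce⟩ := h.exists_seq_tendsto_en ha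
  obtain ⟨d, hd, hdb, hde⟩ := h.exists_seq_tendsto_en hb
  exact le_of_tendsto_of_tendsto' (hde.sub hce).abs
    (((h.tendsto_dissip b).comp hdb).sub ((h.tendsto_dissip a).comp hca)).abs
    fun k => h.abs_en_sub_le_of_lt_top (hc k).1 (hd k).1 (hc k).2 (hd k).2

/-- Where `S₀ = ∞` the displacement estimate holds with every `M`, so `ϑ` is constant up to `α`
excluded. Closedness of the graph puts `ϑ r` in the section over `α`. -/
theorem en_eq_of_eq_top (h : ApproxLimit 𝓔 t ρ L τ θ Θ S₀ Θ₀ ψ₀ ϑ) {r α : ℝ}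
    (hr : r ∈ Icc (0 : ℝ) 1) (hα : α ∈ Icc (0 : ℝ) 1)
    (htop : ∀ z ∈ uIcc r α, z ≠ α → S₀ z = ∞) : 𝓔.en t (ϑ α) = 𝓔.en t (ϑ r) := by
  rcases eq_or_ne r α with rfl | hne
  · rfl
  refine h.en_eq ?_
  set p : ℝ → ℝ := fun k => α + k * (r - α) with hp
  have hpmem : ∀ k ∈ Ioo (0 : ℝ) 1, p k ∈ uIcc r α ∧ α ∉ uIcc r (p k) := by
    intro k hk
    rcases lt_or_gt_of_ne hne with hlt | hlt
    · have h1 : r ≤ p k := by simp only [hp]; nlinarith [hk.1, hk.2]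
      have h2 : p k < α := by simp only [hp]; nlinarith [hk.1, hk.2]
      rw [uIcc_of_le hlt.le, uIcc_of_le h1]
      exact ⟨⟨h1, h2.le⟩, fun hh => absurd hh.2 (not_le.2 h2)⟩
    · have h1 : p k ≤ r := by simp only [hp]; nlinarith [hk.1, hk.2]
      have h2 : α < p k := by simp only [hp]; nlinarith [hk.1, hk.2]
      rw [uIcc_of_ge hlt.le, uIcc_of_ge h1]
      exact ⟨⟨h2.le, h1⟩, fun hh => absurd hh.1 (not_le.2 h2)⟩
  have hconst : ∀ k ∈ Ioo (0 : ℝ) 1, (p k, ϑ r) ∈ Θ₀ := by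
    intro k hk
    obtain ⟨hk1, hk2⟩ := hpmem k hk
    have hpI : p k ∈ Icc (0 : ℝ) 1 := uIcc_subset_Icc hr hα hk1
    have hM : ∀ M : ℝ, 0 < M → M * ‖ϑ (p k) - ϑ r‖ ≤ |ψ₀ (p k) - ψ₀ r| := fun M hM =>
      h.mul_norm_sub_le hr hpI hM fun z hz => by
        rw [htop z (uIcc_subset_uIcc_left hk1 hz) fun hzα => hk2 (hzα ▸ hz)]
        exact le_top
    have heq : ϑ (p k) = ϑ r := by
      by_contra hcon
      have hpos : 0 < ‖ϑ (p k) - ϑ r‖ := norm_pos_iff.2 (sub_ne_zero.2 hcon)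
      have h1 := hM ((|ψ₀ (p k) - ψ₀ r| + 1) / ‖ϑ (p k) - ϑ r‖) (by positivity)
      rw [div_mul_cancel₀ _ hpos.ne'] at h1
      linarith
    rw [← heq]
    exact h.mem _ hpI
  have hlim : Tendsto (fun k => (p k, ϑ r)) (𝓝[>] 0) (𝓝 (p 0, ϑ r)) :=
    (Continuous.tendsto (by fun_prop) 0).mono_left nhdsWithin_le_nhds
  have := h.limit.compact.isClosed.mem_of_tendsto hlim
    (eventually_of_mem (Ioo_mem_nhdsGT one_pos) hconst)
  simpa [hp, fiber] using this

/-- Replace `a` and `b` by the first and last points of the closure between them: the energy is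
unchanged across the outer gaps, and `ψ₀` is monotone. -/
theorem abs_en_sub_le (h : ApproxLimit 𝓔 t ρ L τ θ Θ S₀ Θ₀ ψ₀ ϑ) {a b : ℝ}
    (ha : a ∈ Icc (0 : ℝ) 1) (hb : b ∈ Icc (0 : ℝ) 1) :
    |𝓔.en t (ϑ b) - 𝓔.en t (ϑ a)| ≤ |ψ₀ b - ψ₀ a| := by
  wlog hab : a ≤ b generalizing a b
  · rw [abs_sub_comm, abs_sub_comm (ψ₀ b)]
    exact this hb ha (le_of_not_ge hab)
  have hsub : Icc a b ⊆ Icc (0 : ℝ) 1 := Icc_subset_Icc ha.1 hb.2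
  set F := {r | r ∈ Icc (0 : ℝ) 1 ∧ S₀ r < ∞}
  have hout : ∀ z ∈ Icc a b, z ∉ closure F → S₀ z = ∞ := fun z hz hzF => by
    by_contra hne
    exact hzF (subset_closure ⟨hsub hz, lt_top_iff_ne_top.2 hne⟩)
  have hcpt : IsCompact (Icc a b ∩ closure F) := isCompact_Icc.inter_right isClosed_closure
  rcases (Icc a b ∩ closure F).eq_empty_or_nonempty with hemp | hne
  · rw [h.en_eq_of_eq_top ha hb fun z hz _ => ?_, sub_self, abs_zero]
    · exact abs_nonneg _
    · rw [uIcc_of_le hab] at hz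
      exact hout z hz fun hzF => (eq_empty_iff_forall_notMem.1 hemp z) ⟨hz, hzF⟩
  · obtain ⟨α, hα, hαmin⟩ := hcpt.exists_isLeast hne
    obtain ⟨β, hβ, hβmax⟩ := hcpt.exists_isGreatest hne
    have h1 : 𝓔.en t (ϑ α) = 𝓔.en t (ϑ a) := by
      refine h.en_eq_of_eq_top ha (hsub hα.1) fun z hz hzα => ?_
      rw [uIcc_of_le hα.1.1] at hz
      refine hout z ⟨hz.1, hz.2.trans hα.1.2⟩ fun hzF => hzα ?_
      exact le_antisymm hz.2 (hαmin ⟨⟨hz.1, hz.2.trans hα.1.2⟩, hzF⟩)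
    have h2 : 𝓔.en t (ϑ β) = 𝓔.en t (ϑ b) := by
      refine h.en_eq_of_eq_top hb (hsub hβ.1) fun z hz hzβ => ?_
      rw [uIcc_of_ge hβ.1.2] at hz
      refine hout z ⟨hβ.1.1.trans hz.1, hz.2⟩ fun hzF => hzβ ?_
      exact le_antisymm (hβmax ⟨⟨hβ.1.1.trans hz.1, hz.2⟩, hzF⟩) hz.1
    rw [← h1, ← h2]
    refine (h.abs_en_sub_le_of_mem_closure hα.2 hβ.2).trans ?_
    have hαβ : α ≤ β := hαmin hβ
    rw [abs_of_nonneg (sub_nonneg.2 (h.dissip_mono hαβ)),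
      abs_of_nonneg (sub_nonneg.2 (h.dissip_mono hab))]
    exact sub_le_sub (h.dissip_mono hβ.1.2) (h.dissip_mono hα.1.1)

theorem lipschitzOnWith_en (h : ApproxLimit 𝓔 t ρ L τ θ Θ S₀ Θ₀ ψ₀ ϑ) :
    LipschitzOnWith L.toNNReal (fun r => 𝓔.en t (ϑ r)) (Icc 0 1) := by
  refine LipschitzOnWith.of_dist_le_mul fun x hx y hy => ?_
  rw [Real.coe_toNNReal _ h.pos.le, Real.dist_eq, Real.dist_eq]
  exact (h.abs_en_sub_le hy hx).trans (h.abs_dissip_sub_le y x)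

theorem tendstoUniformlyOn_en (h : ApproxLimit 𝓔 t ρ L τ θ Θ S₀ Θ₀ ψ₀ ϑ) :
    TendstoUniformlyOn (fun n r => 𝓔.en (τ n r) (θ n r)) (fun r => 𝓔.en t (ϑ r)) atTop
      (closure {r | r ∈ Icc (0 : ℝ) 1 ∧ S₀ r < ∞}) := by
  set F := {r | r ∈ Icc (0 : ℝ) 1 ∧ S₀ r < ∞}
  have hFI : closure F ⊆ Icc (0 : ℝ) 1 := closure_minimal (fun x hx => hx.1) isClosed_Icc
  have hcpt : IsCompact (closure F) := isCompact_Icc.of_isClosed_subset isClosed_closure hFI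
  refine Metric.tendstoUniformlyOn_iff.2 fun ε hε => ?_
  refine hcpt.induction_on (p := fun s => ∀ᶠ n in atTop, ∀ x ∈ s,
    dist (𝓔.en t (ϑ x)) (𝓔.en (τ n x) (θ n x)) < ε) (by simp) (fun s s' hss' hs' => ?_)
    (fun s s' hs hs' => ?_) (fun x hx => ?_)
  · exact hs'.mono fun n hn x hx => hn x (hss' hx)
  · filter_upwards [hs, hs'] with n hn hn' x hx
    exact hx.elim (hn x) (hn' x)
  · have hL := h.pos
    -- The error splits into four quarters of `ε`: convergence at `y`, the slack in the oscillation
    -- estimate, and the variation of the approximating and limit energies over a distance below `ε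
    -- / (4 * L)`.
    have hδ : 0 < ε / (8 * L) := by positivity
    obtain ⟨y, hy, hxy⟩ := Metric.mem_closure_iff.1 hx _ hδ
    refine ⟨closure F ∩ Metric.ball x (ε / (8 * L)),
      inter_mem_nhdsWithin _ (Metric.ball_mem_nhds x hδ), ?_⟩
    filter_upwards [h.eventually_abs_en_sub_le (show 0 < ε / 4 by positivity),
      (h.tendsto_en hy.1 hy.2).eventually (Metric.ball_mem_nhds _ (show 0 < ε / 4 by positivity))]
      with n hn hn' z ⟨hzF, hzx⟩
    rw [Real.dist_eq] at hn'
    rw [Metric.mem_ball] at hzx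
    have hzy : L * |z - y| ≤ ε / 4 := by
      have h1 : |z - y| < ε / (8 * L) + ε / (8 * L) := by
        rw [← Real.dist_eq]
        exact (dist_triangle z x y).trans_lt (add_lt_add hzx hxy)
      calc L * |z - y| ≤ L * (ε / (8 * L) + ε / (8 * L)) := by gcongr
        _ = ε / 4 := by field_simp; ring
    have h1 := hn y hy.1 z (hFI hzF)
    have h2 := (h.graph n).abs_dissip_sub_le h.standing h.pos y z
    have h3 := (h.abs_en_sub_le hy.1 (hFI hzF)).trans (h.abs_dissip_sub_le y z)
    rw [Real.dist_eq]
    rw [abs_lt] at hn' ⊢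
    have h4 := abs_le.1 (h1.trans (add_le_add_left (h2.trans hzy) _))
    have h5 := abs_le.1 (h3.trans hzy)
    constructor <;> linarith [hn'.1, hn'.2, h4.1, h4.2, h5.1, h5.2]

end ApproxLimit

end EnergyFunctional

/-! ### The limit selection and admissibility. -/

namespace EnergyFunctional

variable {H : Type*} [NormedAddCommGroup H] [InnerProductSpace ℝ H] {𝓔 : EnergyFunctional H}

namespace ApproxLimit

variable {t ρ L : ℝ} {τ : ℕ → ℝ → ℝ} {θ : ℕ → ℝ → H} {Θ : ℕ → Set (ℝ × H)} {S₀ : ℝ → ℝ≥0∞}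
  {Θ₀ : Set (ℝ × H)} {ψ₀ : ℝ → ℝ} {ϑ : ℝ → H}

theorem kuratowskiLs_subset_fiber (h : ApproxLimit 𝓔 t ρ L τ θ Θ S₀ Θ₀ ψ₀ ϑ) (r : ℝ) :
    kuratowskiLs (𝓝[Icc 0 1 \ {r}] r) (fun s => ({ϑ s} : Set H)) ⊆ fiber Θ₀ r := by
  intro x hx
  by_contra hcon
  obtain ⟨V, W, hV, hW, hVs, hWs, hVW⟩ := SeparatedNhds.of_isCompact_isCompact
    (h.limit.compact.isCompact_fiber r) isCompact_singleton (disjoint_singleton_right.2 hcon)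
  obtain ⟨ε, hε, hεW⟩ := EMetric.mem_nhds_iff.1 (hW.mem_nhds (hWs rfl))
  have hev : ∀ᶠ s in 𝓝[Icc 0 1 \ {r}] r, ε ≤ Metric.infEDist x {ϑ s} := by
    filter_upwards [(h.limit.compact.eventually_fiber_subset hV hVs).filter_mono
      nhdsWithin_le_nhds, self_mem_nhdsWithin] with s hs hsI
    rw [Metric.infEDist_singleton]
    by_contra hlt
    rw [not_le, edist_comm] at hlt
    exact hVW.le_bot ⟨hs (h.mem s hsI.1), hεW hlt⟩
  have hle : ε ≤ liminf (fun s => Metric.infEDist x ({ϑ s} : Set H)) (𝓝[Icc 0 1 \ {r}] r) :=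
    le_liminf_of_le (by isBoundedDefault) hev
  have h0 : liminf (fun s => Metric.infEDist x ({ϑ s} : Set H)) (𝓝[Icc 0 1 \ {r}] r) = 0 := hx
  rw [h0] at hle
  exact hε.ne' (le_antisymm hle zero_le)

theorem fiber_subset_crit_of_notMem {r : ℝ} (hr : r ∈ Icc (0 : ℝ) 1 \ 𝓔.graphG (fun _ => t) Θ₀) :
    fiber Θ₀ r ⊆ 𝓔.crit t := by
  intro x hx
  by_contra hx'
  exact hr.2 ⟨hr.1, x, hx, hx'⟩

theorem exists_mem_fiber_frequently (h : ApproxLimit 𝓔 t ρ L τ θ Θ S₀ Θ₀ ψ₀ ϑ) {r : ℝ}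
    (hr : r ∈ Icc (0 : ℝ) 1) :
    ∃ x ∈ fiber Θ₀ r, ∀ ε > 0, ∃ᶠ n in atTop, Metric.infEDist x (fiber (Θ n) r) < ε := by
  let g : Ultrafilter ℕ := Ultrafilter.of atTop
  have hg : (g : Filter ℕ) ≤ atTop := Ultrafilter.of_le _
  obtain ⟨x, hx, hlim⟩ := h.exists_tendsto (n := id) hg (x := fun _ => r) tendsto_const_nhds
    (u := fun n => θ n r) (Eventually.of_forall fun n => (h.graph n).mem r hr)
  refine ⟨x, hx, fun ε hε => Frequently.filter_mono ?_ hg⟩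
  refine ((hlim.eventually (Metric.eball_mem_nhds x hε)).mono fun n hn => ?_).frequently
  refine (Metric.infEDist_le_edist_of_mem ((h.graph n).mem r hr)).trans_lt ?_
  rw [edist_comm]
  exact hn

variable [CompleteSpace H]

theorem lipschitzWith_dissip (h : ApproxLimit 𝓔 t ρ L τ θ Θ S₀ Θ₀ ψ₀ ϑ) :
    LipschitzWith L.toNNReal ψ₀ := by
  refine LipschitzWith.of_dist_le_mul fun x y => ?_
  rw [Real.coe_toNNReal _ h.pos.le, Real.dist_eq, Real.dist_eq]
  exact h.abs_dissip_sub_le y x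

variable [TopologicalSpace.SeparableSpace H]

theorem exists_lipschitzOnWith (h : ApproxLimit 𝓔 t ρ L τ θ Θ S₀ Θ₀ ψ₀ ϑ) {r : ℝ}
    (hS : 0 < S₀ r) : ∃ K : ℝ≥0, ∃ s ∈ 𝓝[Icc 0 1] r, LipschitzOnWith K ϑ s := by
  obtain ⟨c, hc0, hc⟩ := exists_between hS
  have hctop : c ≠ ∞ := (hc.trans_le le_top).ne
  have hM : 0 < c.toReal := ENNReal.toReal_pos hc0.ne' hctop
  obtain ⟨δ, hδ, hδS⟩ := Metric.eventually_nhds_iff_ball.1 (h.limit.lsc r c hc)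
  refine ⟨(L / c.toReal).toNNReal, Icc 0 1 ∩ Metric.ball r δ,
    inter_mem_nhdsWithin _ (Metric.ball_mem_nhds r hδ),
    LipschitzOnWith.of_dist_le_mul fun x hx y hy => ?_⟩
  rw [Real.coe_toNNReal _ (div_nonneg h.pos.le hM.le), dist_eq_norm, Real.dist_eq,
    div_mul_eq_mul_div, le_div_iff₀ hM, mul_comm]
  refine (h.mul_norm_sub_le hy.1 hx.1 hM fun z hz => ?_).trans (h.abs_dissip_sub_le y x)
  rw [ENNReal.ofReal_toReal hctop]
  exact (hδS z ((convex_ball r δ).ordConnected.uIcc_subset hy.2 hx.2 hz)).le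

/-- For `c < S₀ r` one has `S₀ > c` near `r`, so `c` times the difference quotient of `ϑ` is bounded
by that of `ψ₀`; let `c` increase to `S₀ r`, infinite values included. Where `ϑ` is not
differentiable, `deriv` is zero by convention. -/
theorem ae_slope_mul_le (h : ApproxLimit 𝓔 t ρ L τ θ Θ S₀ Θ₀ ψ₀ ϑ) :
    ∀ᵐ r, r ∈ Icc (0 : ℝ) 1 → 𝓔.slope t (ϑ r) * ‖deriv ϑ r‖ₑ ≤ ENNReal.ofReal (deriv ψ₀ r) ∧
      ENNReal.ofReal (deriv ψ₀ r) ≤ ENNReal.ofReal L := by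
  filter_upwards [h.lipschitzWith_dissip.ae_differentiableAt_real,
    compl_mem_ae_iff.2 (measure_singleton (0 : ℝ)),
    compl_mem_ae_iff.2 (measure_singleton (1 : ℝ))] with r hψ h0 h1 hr
  have hI : Icc (0 : ℝ) 1 ∈ 𝓝 r :=
    Icc_mem_nhds (lt_of_le_of_ne hr.1 (Ne.symm h0)) (lt_of_le_of_ne hr.2 h1)
  refine ⟨?_, ENNReal.ofReal_le_ofReal ?_⟩
  · rcases eq_or_ne (S₀ r) 0 with hS | hS
    · rw [slope_eq_zero_of_mem_crit (h.fiber_subset_crit hr hS (h.mem r hr)), zero_mul]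
      exact zero_le
    by_cases hϑ : DifferentiableAt ℝ ϑ r
    swap
    · rw [deriv_zero_of_not_differentiableAt hϑ]
      simp
    refine (mul_le_mul_left (h.slope_le hr) _).trans ?_
    refine ENNReal.mul_le_of_forall_lt fun c hc d hd => ?_
    refine le_trans (mul_le_mul_right hd.le c) ?_
    have hctop : c ≠ ∞ := (hc.trans_le le_top).ne
    rcases eq_or_ne c 0 with hc0 | hc0
    · simp [hc0]
    have hM : 0 < c.toReal := ENNReal.toReal_pos hc0 hctop
    obtain ⟨δ, hδ, hδS⟩ := Metric.eventually_nhds_iff_ball.1 (h.limit.lsc r c hc)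
    have hev : ∀ᶠ x in 𝓝[≠] r, c.toReal * ‖_root_.slope ϑ r x‖ ≤ |_root_.slope ψ₀ r x| := by
      filter_upwards [nhdsWithin_le_nhds hI, nhdsWithin_le_nhds (Metric.ball_mem_nhds r hδ),
        self_mem_nhdsWithin] with x hx hxδ hxr
      have hxr' : 0 < |x - r| := abs_pos.2 (sub_ne_zero.2 hxr)
      have := h.mul_norm_sub_le hr hx hM fun z hz => by
        rw [ENNReal.ofReal_toReal hctop]
        exact (hδS z ((convex_ball r δ).ordConnected.uIcc_subset (Metric.mem_ball_self hδ)
          hxδ hz)).le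
      rw [slope_def_field, slope_def_module, norm_smul, norm_inv, Real.norm_eq_abs, abs_div,
        le_div_iff₀ hxr']
      calc c.toReal * (|x - r|⁻¹ * ‖ϑ x - ϑ r‖) * |x - r| = c.toReal * ‖ϑ x - ϑ r‖ := by
            field_simp
        _ ≤ _ := this
    have hlim := le_of_tendsto_of_tendsto
      ((hasDerivAt_iff_tendsto_slope.1 hϑ.hasDerivAt).norm.const_mul c.toReal)
      (hasDerivAt_iff_tendsto_slope.1 hψ.hasDerivAt).abs hev
    rw [abs_of_nonneg h.dissip_mono.deriv_nonneg] at hlim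
    calc c * ‖deriv ϑ r‖ₑ = ENNReal.ofReal (c.toReal * ‖deriv ϑ r‖) := by
          rw [ENNReal.ofReal_mul hM.le, ENNReal.ofReal_toReal hctop, ofReal_norm]
      _ ≤ _ := ENNReal.ofReal_le_ofReal hlim
  · have := norm_deriv_le_of_lipschitz (x₀ := r) h.lipschitzWith_dissip
    rw [Real.coe_toNNReal _ h.pos.le] at this
    exact (le_abs_self _).trans this

/-- The right-hand side is the limit of the total dissipations, so this is the lower semicontinuity
of the dissipation integral. -/
theorem lintegral_slope_mul_le (h : ApproxLimit 𝓔 t ρ L τ θ Θ S₀ Θ₀ ψ₀ ϑ) {G : Set ℝ}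
    (hG : G ⊆ Icc 0 1) :
    ∫⁻ r in G, 𝓔.slope t (ϑ r) * ‖deriv ϑ r‖ₑ ≤ ENNReal.ofReal (ψ₀ 1) := by
  have hac := (h.lipschitzWith_dissip.lipschitzOnWith
    (s := uIcc 0 1)).absolutelyContinuousOnInterval
  have h0 : ψ₀ 0 = 0 := by
    refine tendsto_nhds_unique (h.limit.dissip 0) ?_
    simp [EnergyFunctional.dissip]
  calc ∫⁻ r in G, 𝓔.slope t (ϑ r) * ‖deriv ϑ r‖ₑ
      ≤ ∫⁻ r in Icc 0 1, 𝓔.slope t (ϑ r) * ‖deriv ϑ r‖ₑ := lintegral_mono_set hG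
    _ ≤ ∫⁻ r in Icc 0 1, ENNReal.ofReal (deriv ψ₀ r) :=
        setLIntegral_mono_ae' measurableSet_Icc (h.ae_slope_mul_le.mono fun r hr hrI => (hr hrI).1)
    _ = ENNReal.ofReal (∫ r in Icc 0 1, deriv ψ₀ r) :=
        (ofReal_integral_eq_lintegral_ofReal
          ((intervalIntegrable_iff_integrableOn_Icc_of_le zero_le_one).1
            hac.intervalIntegrable_deriv)
          (Eventually.of_forall fun r => h.dissip_mono.deriv_nonneg)).symm
    _ = ENNReal.ofReal (ψ₀ 1) := by
        rw [integral_Icc_eq_integral_Ioc, ← intervalIntegral.integral_of_le zero_le_one,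
          hac.integral_deriv_eq_sub, h0, sub_zero]

theorem pos_of_mem_graphG (h : ApproxLimit 𝓔 t ρ L τ θ Θ S₀ Θ₀ ψ₀ ϑ) {r : ℝ}
    (hr : r ∈ 𝓔.graphG (fun _ => t) Θ₀) : 0 < S₀ r := by
  obtain ⟨hrI, x, hx, hx'⟩ := hr
  refine pos_iff_ne_zero.2 fun hS => hx' (h.fiber_subset_crit hrI hS hx)

theorem curveG_eq (h : ApproxLimit 𝓔 t ρ L τ θ Θ S₀ Θ₀ ψ₀ ϑ) :
    𝓔.curveG t ϑ = 𝓔.graphG (fun _ => t) Θ₀ := by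
  ext r
  refine ⟨fun hr => ⟨hr.1, ϑ r, h.mem r hr.1, hr.2⟩, fun hr => ⟨hr.1, ?_⟩⟩
  obtain ⟨x, hx, hx'⟩ := hr.2
  rw [h.fiber_eq hr.1 (h.pos_of_mem_graphG hr)] at hx
  exact (mem_singleton_iff.1 hx) ▸ hx'

theorem exists_isOpen_curveG (h : ApproxLimit 𝓔 t ρ L τ θ Θ S₀ Θ₀ ψ₀ ϑ) :
    ∃ O : Set ℝ, IsOpen O ∧ 𝓔.curveG t ϑ = O ∩ Icc 0 1 := by
  refine ⟨(closure (Icc 0 1 \ 𝓔.curveG t ϑ))ᶜ, isClosed_closure.isOpen_compl, ?_⟩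
  ext r
  refine ⟨fun hr => ?_, fun hr => ?_⟩
  · refine ⟨?_, hr.1⟩
    have hS : 0 < S₀ r := h.pos_of_mem_graphG (h.curveG_eq ▸ hr)
    have hpos : 0 < 𝓔.slope t (ϑ r) := by
      rw [pos_iff_ne_zero, Ne, ← h.standing.mem_crit_iff h.time_mem]
      exact hr.2
    have hev := h.standing.eventually_lt_slope (l := 𝓝[Icc 0 1] r) (s := fun _ => t)
      tendsto_const_nhds h.time_mem (h.tendsto_selection hr.1 hS) (h.subset (h.mem r hr.1)).2.1
      (Eventually.of_forall fun _ => h.time_mem) hpos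
    rw [mem_compl_iff, mem_closure_iff_frequently, not_frequently]
    filter_upwards [eventually_nhdsWithin_iff.1 hev] with x hx hx'
    refine hx'.2 ⟨hx'.1, fun hcrit => ?_⟩
    have := hx hx'.1
    rw [slope_eq_zero_of_mem_crit hcrit] at this
    exact lt_irrefl _ this
  · by_contra hcon
    exact hr.1 (subset_closure ⟨hr.2, hcon⟩)

theorem locallyLipschitzOn_graphG (h : ApproxLimit 𝓔 t ρ L τ θ Θ S₀ Θ₀ ψ₀ ϑ) :
    LocallyLipschitzOn (𝓔.graphG (fun _ => t) Θ₀) ϑ := by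
  intro r hr
  obtain ⟨K, s, hs, hK⟩ := h.exists_lipschitzOnWith (h.pos_of_mem_graphG hr)
  exact ⟨K, s, nhdsWithin_mono r (fun x hx => hx.1) hs, hK⟩

theorem basicGraph (h : ApproxLimit 𝓔 t ρ L τ θ Θ S₀ Θ₀ ψ₀ ϑ) : 𝓔.BasicGraph t ρ Θ₀ := by
  have hproj : Prod.fst '' Θ₀ = Icc (0 : ℝ) 1 := by
    refine subset_antisymm ?_ fun r hr => ⟨(r, ϑ r), h.mem r hr, rfl⟩
    rintro _ ⟨p, hp, rfl⟩
    exact (h.subset hp).1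
  exact
    { subset := h.subset
      compact := h.limit.compact
      connected := ⟨⟨⟨(0, ϑ 0), h.mem 0 ⟨le_rfl, zero_le_one⟩⟩,
        h.limit.compact.isPreconnected_of_fiber isPreconnected_Icc hproj h.isPreconnected_fiber⟩,
        h.isPreconnected_fiber⟩
      proj := hproj
      singleton := fun s hs => ⟨ϑ s, h.fiber_eq hs.1 (h.pos_of_mem_graphG hs)⟩ }

theorem admissibleSelection (h : ApproxLimit 𝓔 t ρ L τ θ Θ S₀ Θ₀ ψ₀ ϑ) :
    𝓔.AdmissibleSelection t Θ₀ ϑ where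
  mem := h.mem
  locLip := h.locallyLipschitzOn_graphG
  ls_subset := fun r hr x hx => by
    have hxr := h.kuratowskiLs_subset_fiber r hx
    exact mem_iUnion₂.2 ⟨x, hxr, mem_connectedComponentIn (fiber_subset_crit_of_notMem hr hxr)⟩
  integral_lt := (h.lintegral_slope_mul_le fun x hx => hx.1).trans_lt ENNReal.ofReal_lt_top

theorem ae_restrict_slope_mul_le (h : ApproxLimit 𝓔 t ρ L τ θ Θ S₀ Θ₀ ψ₀ ϑ) :
    ∀ᵐ s ∂(volume.restrict (𝓔.graphG (fun _ => t) Θ₀)),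
      𝓔.slope t (ϑ s) * ‖deriv ϑ s‖ₑ ≤ ENNReal.ofReal L :=
  ae_restrict_of_ae_restrict_of_subset (t := Icc 0 1) (fun _ hx => hx.1)
    ((ae_restrict_iff' measurableSet_Icc).2
      (h.ae_slope_mul_le.mono fun _ hr hrI => (hr hrI).1.trans (hr hrI).2))

/-- One common point suffices: a section is either a point or connected and critical, and in the
latter case it cannot leave its component. -/
theorem fiber_subset_of_mem (h : ApproxLimit 𝓔 t ρ L τ θ Θ S₀ Θ₀ ψ₀ ϑ) {r : ℝ}
    (hr : r ∈ Icc (0 : ℝ) 1) {U : Set H} (hU : U ∈ 𝓔.transitionSets t) {x : H}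
    (hx : x ∈ fiber Θ₀ r) (hxU : x ∈ U) : fiber Θ₀ r ⊆ U := by
  rcases eq_or_ne (S₀ r) 0 with hS | hS
  · have hcrit := h.fiber_subset_crit hr hS
    rcases hU.2.2 with ⟨y, -, rfl⟩ | ⟨y, hy, rfl⟩
    · rw [connectedComponentIn_eq hxU]
      exact (h.isPreconnected_fiber r).subset_connectedComponentIn hx hcrit
    · exact absurd (hcrit hx) ((mem_singleton_iff.1 hxU) ▸ hy)
  · rw [h.fiber_eq hr (pos_iff_ne_zero.2 hS)] at hx ⊢
    rw [← mem_singleton_iff.1 hx]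
    exact singleton_subset_iff.2 hxU

theorem graphTransition (h : ApproxLimit 𝓔 t ρ L τ θ Θ S₀ Θ₀ ψ₀ ϑ) {U₀ U₁ : Set H}
    (h0 : fiber Θ₀ 0 ⊆ U₀) (h1 : fiber Θ₀ 1 ⊆ U₁) : 𝓔.GraphTransition t ρ U₀ U₁ Θ₀ where
  basic := h.basicGraph
  start_subset := h0
  end_subset := h1
  selection := by
    refine ⟨ϑ, h.admissibleSelection, ?_, L, h.pos, h.ae_restrict_slope_mul_le⟩
    ext ⟨r, x⟩
    constructor
    · rintro ⟨hx, hx'⟩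
      have hG : r ∈ 𝓔.graphG (fun _ => t) Θ₀ := ⟨(h.subset hx).1, x, hx, hx'⟩
      have hx2 : x ∈ fiber Θ₀ r := hx
      rw [h.fiber_eq hG.1 (h.pos_of_mem_graphG hG), mem_singleton_iff] at hx2
      exact ⟨r, hG, by rw [hx2]⟩
    · rintro ⟨s, hs, hsx⟩
      obtain ⟨rfl, rfl⟩ := Prod.mk.inj hsx
      rw [← h.curveG_eq] at hs
      exact ⟨h.mem s hs.1, hs.2⟩
  energy_lip := ⟨_, fun _ _ hx => h.en_eq hx, _, h.lipschitzOnWith_en⟩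

theorem admissibleTransition (h : ApproxLimit 𝓔 t ρ L τ θ Θ S₀ Θ₀ ψ₀ ϑ) {U₀ U₁ : Set H}
    (h0 : fiber Θ₀ 0 ⊆ U₀) (h1 : fiber Θ₀ 1 ⊆ U₁) : 𝓔.AdmissibleTransition t U₀ U₁ ϑ where
  mem_dom := fun s hs => (h.subset (h.mem s hs)).2.1
  start_mem := h0 (h.mem 0 ⟨le_rfl, zero_le_one⟩)
  end_mem := h1 (h.mem 1 ⟨zero_le_one, le_rfl⟩)
  relOpen := h.exists_isOpen_curveG
  locLip := h.curveG_eq ▸ h.locallyLipschitzOn_graphG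
  bound := ⟨L.toNNReal, h.curveG_eq ▸ h.ae_restrict_slope_mul_le⟩
  energy_lip := ⟨_, h.lipschitzOnWith_en⟩
  ls_subset := fun r hr x hx => by
    rw [h.curveG_eq] at hr
    have hxr := h.kuratowskiLs_subset_fiber r hx
    -- Cluster values of `ϑ` at `r` share with `ϑ r` a connected critical section, hence a
    -- component.
    refine mem_iUnion₂.2 ⟨ϑ r, rfl, ?_⟩
    exact (h.isPreconnected_fiber r).subset_connectedComponentIn (h.mem r hr.1)
      (fiber_subset_crit_of_notMem hr) hxr

theorem tendstoUniformlyOn_curve (h : ApproxLimit 𝓔 t ρ L τ θ Θ S₀ Θ₀ ψ₀ ϑ) {K : Set ℝ}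
    (hKG : K ⊆ 𝓔.curveG t ϑ) (hK : IsCompact K) : TendstoUniformlyOn θ ϑ atTop K := by
  refine Metric.tendstoUniformlyOn_iff.2 fun ε hε => ?_
  refine hK.induction_on (p := fun s => ∀ᶠ n in atTop, ∀ x ∈ s, dist (ϑ x) (θ n x) < ε) (by simp)
    (fun s s' hss' hs' => ?_) (fun s s' hs hs' => ?_) (fun x hx => ?_)
  · exact hs'.mono fun n hn x hx => hn x (hss' hx)
  · filter_upwards [hs, hs'] with n hn hn' x hx
    exact hx.elim (hn x) (hn' x)
  · have hxG := hKG hx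
    have hS := h.pos_of_mem_graphG (h.curveG_eq ▸ hxG)
    obtain ⟨P, hP, Q, hQ, hPQ⟩ := eventually_prod_iff.1
      ((h.tendsto_curve hxG.1 hS).eventually (Metric.ball_mem_nhds _ (half_pos hε)))
    have hQ' := (h.tendsto_selection hxG.1 hS).eventually (Metric.ball_mem_nhds _ (half_pos hε))
    refine ⟨_, nhdsWithin_mono x (fun z hz => (hKG hz).1) (hQ.and hQ'), hP.mono fun n hn z hz => ?_⟩
    have h1 : dist (θ n z) (ϑ x) < ε / 2 := hPQ hn hz.1
    have h2 : dist (ϑ z) (ϑ x) < ε / 2 := hz.2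
    have := dist_triangle_right (ϑ z) (θ n z) (ϑ x)
    linarith

end ApproxLimit

end EnergyFunctional

/-! ### Assembly of the theorem. -/

theorem mem_kuratowskiLs_of_frequently {X : Type*} [PseudoMetricSpace X] {F : ℕ → Set X} {x : X}
    (h : ∀ ε > 0, ∃ᶠ n in atTop, Metric.infEDist x (F n) < ε) : x ∈ kuratowskiLs atTop F := by
  refine le_antisymm (le_of_forall_gt_imp_ge_of_dense fun ε hε => ?_) zero_le
  exact liminf_le_of_frequently_le ((h ε hε).mono fun n hn => hn.le) (by isBoundedDefault)

theorem GraphLimit.gammaTendstoOn {X : Type*} [MetricSpace X] {S : ℕ → ℝ → ℝ≥0∞}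
    {Θ : ℕ → Set (ℝ × X)} {ψ : ℕ → ℝ → ℝ} {S₀ : ℝ → ℝ≥0∞} {Θ₀ : Set (ℝ × X)} {ψ₀ : ℝ → ℝ}
    (h : GraphLimit S Θ ψ S₀ Θ₀ ψ₀) : GammaTendstoOn (Icc 0 1) S S₀ := by
  refine ⟨fun r _ x hx hxr => le_of_forall_lt_imp_le_of_dense fun c hc => ?_, h.recovery⟩
  have hlim : Tendsto (fun n => (n, x n)) atTop (atTop ×ˢ 𝓝[Icc 0 1] r) :=
    tendsto_id.prodMk (tendsto_nhdsWithin_iff.2 ⟨hxr, Eventually.of_forall hx⟩)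
  exact le_liminf_of_le (by isBoundedDefault)
    ((hlim.eventually (h.eventually_lt r c hc)).mono fun n hn => hn.le)

theorem theorem4p6 {H : Type*} [NormedAddCommGroup H] [InnerProductSpace ℝ H] [CompleteSpace H]
    [TopologicalSpace.SeparableSpace H]
    (𝓔 : EnergyFunctional H) (h𝓔 : 𝓔.Standing) (hC : 𝓔.FiberedLusin)
    (t : ℝ) (ht : t ∈ Icc 0 𝓔.T) (ρ : ℝ) (hρ : 0 < ρ)
    (U₀ U₁ : Set H) (hU₀ : U₀ ∈ 𝓔.transitionSets t) (hU₁ : U₁ ∈ 𝓔.transitionSets t)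
    (θ : ℕ → ℝ → H) (τ : ℕ → ℝ → ℝ) (Θ : ℕ → Set (ℝ × H)) (L L' : ℝ) (hL : 0 < L) (hL' : 0 < L')
    (hτ_maps : ∀ n, MapsTo (τ n) (Icc 0 1) (Icc 0 𝓔.T))
    (hΘ_sub : ∀ n, Θ n ⊆ Icc 0 1 ×ˢ 𝓔.sublevel ρ)
    (hΘ_compact : ∀ n, IsCompact (Θ n))
    (hΘ_conn : ∀ n, FiberwiseConnected (Θ n))
    (h_mem : ∀ n, ∀ r ∈ Icc (0 : ℝ) 1, θ n r ∈ fiber (Θ n) r)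
    (h_single : ∀ n, ∀ r ∈ 𝓔.graphG (τ n) (Θ n), fiber (Θ n) r = {θ n r})
    (hτ_lip : ∀ n, ∃ K : ℝ≥0, LipschitzOnWith K (τ n) (Icc 0 1))
    (hτ_mono : ∀ n, MonotoneOn (τ n) (Icc 0 1))
    (hθ_lip : ∀ n, LocallyLipschitzOn (𝓔.graphG (τ n) (Θ n)) (θ n))
    (h_bound : ∀ n, ∀ᵐ r ∂(volume.restrict (𝓔.graphG (τ n) (Θ n))),
      ENNReal.ofReal (deriv (τ n) r) + 𝓔.slope (τ n r) (θ n r) * ‖deriv (θ n) r‖ₑ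
        ≤ ENNReal.ofReal L)
    (h_en_lip : ∀ n, ∃ K : ℝ≥0, LipschitzOnWith K (fun r => 𝓔.en (τ n r) (θ n r)) (Icc 0 1))
    (h_en_deriv : ∀ n, ∀ᵐ r ∂(volume.restrict (Ioo (0 : ℝ) 1)),
      deriv (fun r => 𝓔.en (τ n r) (θ n r)) r ≤ L')
    (h_ls₀ : kuratowskiLs atTop (fun n => fiber (Θ n) 0) ⊆ U₀)
    (h_ls₁ : kuratowskiLs atTop (fun n => fiber (Θ n) 1) ⊆ U₁)
    (hτ_lim : TendstoUniformlyOn τ (fun _ => t) atTop (Icc 0 1)) :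
    ∃ (φ : ℕ → ℕ) (Θ₀ : Set (ℝ × H)) (S : ℝ → ℝ≥0∞) (ϑ : ℝ → H) (e : ℝ → ℝ),
      StrictMono φ ∧
      𝓔.BasicGraph t ρ Θ₀ ∧
      LowerSemicontinuousOn S (Icc 0 1) ∧
      MapsTo ϑ (Icc 0 1) (𝓔.sublevel ρ) ∧
      -- convergence of the slopes and of the graphs
      GammaTendstoOn (Icc 0 1)
        (fun n => 𝓔.slopeFun (τ (φ n)) (Θ (φ n)) (θ (φ n))) S ∧
      KuratowskiTendsto (fun n => Θ (φ n)) Θ₀ ∧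
      -- the limit is an admissible graph transition with admissible selection `ϑ`
      𝓔.GraphTransition t ρ U₀ U₁ Θ₀ ∧
      𝓔.AdmissibleSelection t Θ₀ ϑ ∧
      𝓔.AdmissibleTransition t U₀ U₁ ϑ ∧
      -- convergence of the curves
      𝓔.curveG t ϑ = 𝓔.graphG (fun _ => t) Θ₀ ∧
      (∀ K ⊆ 𝓔.curveG t ϑ, IsCompact K →
        TendstoUniformlyOn (fun n => θ (φ n)) ϑ atTop K) ∧
      -- lower semicontinuity of the energy-dissipation integral
      (∫⁻ r in 𝓔.curveG t ϑ, 𝓔.slope t (ϑ r) * ‖deriv ϑ r‖ₑ ≤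
        Filter.liminf (fun n => ∫⁻ r in 𝓔.graphG (τ (φ n)) (Θ (φ n)),
          𝓔.slope (τ (φ n) r) (θ (φ n) r) * ‖deriv (θ (φ n)) r‖ₑ) atTop) ∧
      (∀ᵐ r ∂(volume.restrict (Ioo (0 : ℝ) 1)),
        𝓔.slope t (ϑ r) * ‖deriv ϑ r‖ₑ ≤ ENNReal.ofReal L) ∧
      -- the limit energy and the convergence of the energies
      𝓔.IsGraphEnergy t Θ₀ e ∧
      LipschitzOnWith L.toNNReal e (Icc 0 1) ∧
      TendstoUniformlyOn (fun n r => 𝓔.en (τ (φ n) r) (θ (φ n) r)) e atTop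
        (closure {r | r ∈ Icc (0 : ℝ) 1 ∧ S r < ∞}) := by
  have hg : ∀ n, EnergyFunctional.ParametrizedGraph 𝓔 ρ L (τ n) (θ n) (Θ n) := fun n =>
    { maps := hτ_maps n
      subset := hΘ_sub n
      compact := hΘ_compact n
      conn := hΘ_conn n
      mem := h_mem n
      single := h_single n
      lip := hτ_lip n
      mono := hτ_mono n
      locLip := hθ_lip n
      bound := h_bound n
      en_lip := h_en_lip n }
  obtain ⟨φ, S, Θ₀, ψ₀, hφ, hsub, hlim⟩ := exists_subseq_graphLimit
    (fun n => 𝓔.slopeFun (τ n) (Θ n) (θ n)) (ψ := fun n => 𝓔.dissip (τ n) (Θ n) (θ n))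
    (isCompact_Icc.prod (h𝓔.isCompact_sublevel ρ)) hΘ_sub hΘ_compact (fun n => (hΘ_conn n).1.1) hL
    (fun n => (hg n).abs_dissip_sub_le h𝓔 hL) (fun n => by simp [EnergyFunctional.dissip])
  have hsel : ∀ r, ∃ x : H, r ∈ Icc (0 : ℝ) 1 → x ∈ fiber Θ₀ r := fun r => by
    by_cases hr : r ∈ Icc (0 : ℝ) 1
    · obtain ⟨x, hx⟩ := hlim.fiber_nonempty fun n => ⟨_, h_mem (φ n) r hr⟩
      exact ⟨x, fun _ => hx⟩
    · exact ⟨0, fun h => absurd h hr⟩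
  -- The choice is arbitrary: every selection of the limit graph has the required properties.
  choose ϑ hϑ using hsel
  have h : EnergyFunctional.ApproxLimit 𝓔 t ρ L (fun n => τ (φ n)) (fun n => θ (φ n))
      (fun n => Θ (φ n)) S Θ₀ ψ₀ ϑ :=
    { standing := h𝓔
      lusin := hC
      time_mem := ht
      pos := hL
      graph := fun n => hg (φ n)
      time := fun u hu => hφ.tendsto_atTop.eventually (hτ_lim u hu)
      subset := hsub
      limit := hlim
      mem := hϑ }
  -- A limit point of the end values along the subsequence belongs to the upper limit of the full
  -- sequence, hence to `U`; the whole section follows.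
  have hend : ∀ r ∈ Icc (0 : ℝ) 1, ∀ U ∈ 𝓔.transitionSets t,
      kuratowskiLs atTop (fun n => fiber (Θ n) r) ⊆ U → fiber Θ₀ r ⊆ U := by
    intro r hr U hU hUr
    obtain ⟨x, hx, hx'⟩ := h.exists_mem_fiber_frequently hr
    exact h.fiber_subset_of_mem hr hU hx (hUr (mem_kuratowskiLs_of_frequently fun ε hε =>
      hφ.tendsto_atTop.frequently (hx' ε hε)))
  have h0 := hend 0 ⟨le_rfl, zero_le_one⟩ U₀ hU₀ h_ls₀
  have h1 := hend 1 ⟨zero_le_one, le_rfl⟩ U₁ hU₁ h_ls₁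
  refine ⟨φ, Θ₀, S, ϑ, fun r => 𝓔.en t (ϑ r), hφ, h.basicGraph,
    hlim.lsc.lowerSemicontinuousOn _, fun r hr => (h.subset (hϑ r hr)).2, hlim.gammaTendstoOn,
    hlim.kuratowski, h.graphTransition h0 h1, h.admissibleSelection, h.admissibleTransition h0 h1,
    h.curveG_eq, fun K hKG hK => h.tendstoUniformlyOn_curve hKG hK, ?_, ?_,
    fun _ _ hx => h.en_eq hx, h.lipschitzOnWith_en, h.tendstoUniformlyOn_en⟩
  · simp only [(hg _).lintegral_eq_ofReal_dissip h𝓔 hL]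
    have hψ := (ENNReal.continuous_ofReal.tendsto _).comp (hlim.dissip 1)
    refine le_of_le_of_eq ?_ hψ.liminf_eq.symm
    exact h.lintegral_slope_mul_le fun r hr => hr.1
  · refine (ae_restrict_iff' measurableSet_Ioo).2 (h.ae_slope_mul_le.mono fun r hr hrI => ?_)
    exact (hr (Ioo_subset_Icc_self hrI)).1.trans (hr (Ioo_subset_Icc_self hrI)).2
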